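/- **Setting.** Let $I$ be a non-empty index set and let $n(\alpha)\ge 1$ for $\alpha\in I$. Let $A=\bigoplus_{\alpha\in I}A_\alpha$ be the algebraic direct sum of the full matrix $^*$-algebras $A_\alpha=M_{n(\alpha)}(\mathbb C)$, and write $M(A\otimes A)=\prod_{\alpha,\beta}A_\alpha\otimes A_\beta$. Let $(A,\Delta)$ be a discrete quantum group. That is, $\Delta:A\to M(A\otimes A)$ is a coassociative $^*$-homomorphism such that the maps $a\otimes a'\mapsto\Delta(a)(1\otimes a')$ and $a\otimes a'\mapsto(a\otimes 1)\Delta(a')$ are well-defined bijections of $A\otimes A$ onto itself (so $(A,\Delta)$ is a multiplier Hopf $^*$-algebra). Let $\varepsilon$ be its counit and $S$ its (bijective) antipode. The reduced dual is $B=\bigoplus_\alpha A_\alpha'$, where $A_\alpha'$ is the dual space of $A_\alpha$. Write $\langle a,b\rangle$ for the pairing of $a\in A$ with $b\in B$. Then $B$ is a $^*$-algebra with $$\langle a,bb'\rangle=\langle\Delta(a),b'\otimes b\rangle,\qquad \langle a,b^*\rangle=\overline{\langle S(a^*),b\rangle},$$ and it has the coproduct $\Delta:B\to B\otimes B$, written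 $\Delta(b)=\sum_{(b)}b_{(1)}\otimes b_{(2)}$, that is determined by $\langle a\otimes a',\Delta(b)\rangle=\langle aa',b\rangle$. **Statement.** 1. There is a unique $h\in A$ (the cointegral) with $h\ne0$, $h^*=h=h^2$ and $ah=\varepsilon(a)h$ for all $a\in A$. There is a unique left integral $\varphi_A$ on $A$ with $\varphi_A(h)=1$, that is, a unique linear functional $\varphi_A:A\to\mathbb C$ with $(\iota\otimes\varphi_A)\Delta(a)=\varphi_A(a)1$ for all $a\in A$ and $\varphi_A(h)=1$. Put $\varphi_B(b)=\langle h,b\rangle$ for $b\in B$. The functionals $\varphi_A$ and $\varphi_B$ are positive: $\varphi_A(a^*a)\ge0$ and $\varphi_B(b^*b)\ge0$. Let $\mathcal H_A,\mathcal H_B$ be the GNS spaces of $\varphi_A,\varphi_B$ and $\Lambda_A:A\to\mathcal H_A$, $\Lambda_B:B\to\mathcal H_B$ the canonical maps, so that $\langle\Lambda_A(a),\Lambda_A(a')\rangle=\varphi_A(a^*a')$ and $\langle\Lambda_B(b),\Lambda_B(b')\rangle=\varphi_B(b^*b')$ (inner products are linear in the second variable). 2. (Fourier transform.) For each $a\in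 A$ the functional $\varphi_A(S^{-1}(\,\cdot\,)a)$ belongs to $B$, and there is a unique unitary operator $F:\mathcal H_A\to\mathcal H_B$ with $$F\Lambda_A(a)=\Lambda_B\bigl(\varphi_A(S^{-1}(\,\cdot\,)a)\bigr)\qquad(a\in A).$$ 3. There is a unique representation of $B$ on $\mathcal H_B$ by bounded operators with $b\Lambda_B(b')=\Lambda_B(bb')$. Let $\overline B$ be the norm closure of its image. There is a unique unitary operator $u$ on the Hilbert space tensor product $\mathcal H_B\otimes\mathcal H_B$ (the left regular corepresentation of $B$) with $$u^*(\eta\otimes\Lambda_B(b))=\sum_{(b)}b_{(1)}\eta\otimes\Lambda_B(b_{(2)})\qquad(\eta\in\mathcal H_B,\ b\in B).$$ For $\zeta,\xi\in\mathcal H_B$ let $(\iota\otimes\omega_{\zeta,\xi})u$ be the bounded operator on $\mathcal H_B$ with $\langle\eta',((\iota\otimes\omega_{\zeta,\xi})u)\eta\rangle=\langle\eta'\otimes\zeta,u(\eta\otimes\xi)\rangle$. These operators belong to $\overline B$, and for each $a\in A$ the functional $\langle a,\,\cdot\,\rangle$ on $B$ has a continuous extension $\omega_a$ to $\overline B$.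 There is a unique $^*$-representation $\pi$ of $A$ by bounded operators on $\mathcal H_B$ with $\pi(a)=(\omega_a\otimes\iota)u$, that is, with $$\langle\zeta,\pi(a)\xi\rangle=\omega_a\bigl((\iota\otimes\omega_{\zeta,\xi})u\bigr)\qquad(a\in A,\ \zeta,\xi\in\mathcal H_B).$$ 4. With this $\pi$ and this $F$, $F^*\pi(\,\cdot\,)F$ is the GNS representation of $A$ on $\mathcal H_A$: $$F^*\pi(a)F\,\Lambda_A(a')=\Lambda_A(aa')\qquad(a,a'\in A).$$ -/

import Mathlib

open scoped TensorProduct ComplexOrder DirectSum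

namespace QuantumDuality

universe v

variable {I : Type v}

/-! ### Direct sums of matrix algebras and their multiplier algebras -/

/-- The component `A_α`: the `*`-algebra of `n α × n α` complex matrices. -/
abbrev Mat (n : I → ℕ) (α : I) : Type := Matrix (Fin (n α)) (Fin (n α)) ℂ

/-- The algebraic direct sum `A = ∑ ⊕ A_α` of the matrix algebras `A_α`, as a `*`-subalgebra of the
direct product `∏ A_α = M(A)`: the families with only finitely many non-zero components. -/
def directSum (n : I → ℕ) : NonUnitalStarSubalgebra ℂ (∀ α, Mat n α) where
  carrier := {a | {α | a α ≠ 0}.Finite}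
  add_mem' {a b} ha hb := (ha.union hb).subset fun α h => by
    by_contra hc
    have h1 : a α = 0 := by_contra fun h' => hc (Or.inl h')
    have h2 : b α = 0 := by_contra fun h' => hc (Or.inr h')
    exact h (by simp [h1, h2])
  zero_mem' := by simp
  mul_mem' {a b} ha hb := ha.subset fun α h => fun hc => h (by simp [hc])
  smul_mem' c a ha := ha.subset fun α h => fun hc => h (by simp [hc])
  star_mem' {a} ha := ha.subset fun α h => fun hc => h (by simp [hc])

/-- The `*`-algebra `A`, as a type. -/
abbrev Alg (n : I → ℕ) : Type v := directSum n

/-- The multiplier algebra `M(A ⊗ A)`: the direct product of the algebras `A_α ⊗ A_β`. -/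
abbrev MultAA (n : I → ℕ) : Type v := ∀ p : I × I, Mat n p.1 ⊗[ℂ] Mat n p.2

/-- The projection of `A` onto its component `A_α`. -/
def comp (n : I → ℕ) (α : I) : Alg n →ₗ[ℂ] Mat n α where
  toFun a := a.1 α
  map_add' _ _ := rfl
  map_smul' _ _ := rfl

/-- The canonical embedding of `A ⊗ A` in `M(A ⊗ A)`. -/
def toMult (n : I → ℕ) : Alg n ⊗[ℂ] Alg n →ₗ[ℂ] MultAA n :=
  LinearMap.pi fun p => TensorProduct.map (comp n p.1) (comp n p.2)

/-- The element `a ⊗ 1` of `M(A ⊗ A)`. -/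
def inclL {n : I → ℕ} (a : Alg n) : MultAA n := fun p => a.1 p.1 ⊗ₜ 1

/-- The element `1 ⊗ a` of `M(A ⊗ A)`. -/
def inclR {n : I → ℕ} (a : Alg n) : MultAA n := fun p => 1 ⊗ₜ a.1 p.2

/-- A discrete quantum group: a direct sum `A` of full matrix algebras with a coproduct `Δ` that
makes it a multiplier Hopf `*`-algebra. That is, `Δ : A → M(A ⊗ A)` is a `*`-homomorphism, the
elements `Δ(a)(1 ⊗ b)` and `(a ⊗ 1)Δ(b)` belong to `A ⊗ A`, the linear maps
`T₁ : a ⊗ b ↦ Δ(a)(1 ⊗ b)` and `T₂ : a ⊗ b ↦ (a ⊗ 1)Δ(b)` are bijections of `A ⊗ A`, and `Δ` is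
coassociative. The maps `T₁` and `T₂` are determined by `Δ`, because `toMult` is injective. -/
structure DiscreteQuantumGroup (n : I → ℕ) where
  /-- The coproduct. -/
  Δ : Alg n →⋆ₙₐ[ℂ] MultAA n
  T₁ : Alg n ⊗[ℂ] Alg n ≃ₗ[ℂ] Alg n ⊗[ℂ] Alg n
  T₂ : Alg n ⊗[ℂ] Alg n ≃ₗ[ℂ] Alg n ⊗[ℂ] Alg n
  T₁_spec : ∀ a b, toMult n (T₁ (a ⊗ₜ b)) = Δ a * inclR b
  T₂_spec : ∀ a b, toMult n (T₂ (a ⊗ₜ b)) = inclL a * Δ b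
  /-- Coassociativity:
  `(a ⊗ 1 ⊗ 1)((Δ ⊗ ι)(Δ(b)(1 ⊗ c))) = ((ι ⊗ Δ)((a ⊗ 1)Δ(b)))(1 ⊗ 1 ⊗ c)` in `A ⊗ A ⊗ A`, that is,
  `(T₂ ⊗ ι)(ι ⊗ T₁) = (ι ⊗ T₁)(T₂ ⊗ ι)`. -/
  coassoc : ∀ a b c : Alg n,
    T₂.toLinearMap.rTensor (Alg n) ((TensorProduct.assoc ℂ _ _ _).symm (a ⊗ₜ T₁ (b ⊗ₜ c))) =
      (TensorProduct.assoc ℂ _ _ _).symm (T₁.toLinearMap.lTensor (Alg n)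
        (TensorProduct.assoc ℂ _ _ _ (T₂ (a ⊗ₜ b) ⊗ₜ c)))

/-! ### Auxiliary facts on direct sums -/

section Aux

variable {n : I → ℕ}

/-- The inclusion of the component `A_α` in `A`. -/
def incl [DecidableEq I] (n : I → ℕ) (α : I) : Mat n α →ₗ[ℂ] Alg n where
  toFun x := ⟨Pi.single α x, (Set.finite_singleton α).subset fun β h => by
    by_contra hc
    exact h (Pi.single_eq_of_ne hc x)⟩
  map_add' x y := Subtype.ext (Pi.single_add α x y)
  map_smul' c x := Subtype.ext (Pi.single_smul α c x)

lemma incl_apply [DecidableEq I] (α β : I) (x : Mat n α) :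
    (incl n α x).1 β = (Pi.single α x : ∀ γ, Mat n γ) β := rfl

lemma alg_ext {a b : Alg n} (h : ∀ α, a.1 α = b.1 α) : a = b := Subtype.ext (funext h)

lemma mul_comp (a b : Alg n) (α : I) : (a * b).1 α = a.1 α * b.1 α := rfl

lemma star_comp (a : Alg n) (α : I) : (star a).1 α = star (a.1 α) := rfl

lemma incl_one_mul [DecidableEq I] (α : I) (a : Alg n) :
    incl n α 1 * a = incl n α (a.1 α) := by
  refine alg_ext fun β => ?_
  rw [mul_comp, incl_apply, incl_apply]
  by_cases h : β = α
  · subst h; simp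
  · simp [Pi.single_eq_of_ne h]

lemma mul_incl_one [DecidableEq I] (α : I) (a : Alg n) :
    a * incl n α 1 = incl n α (a.1 α) := by
  refine alg_ext fun β => ?_
  rw [mul_comp, incl_apply, incl_apply]
  by_cases h : β = α
  · subst h; simp
  · simp [Pi.single_eq_of_ne h]

lemma incl_eq_zero [DecidableEq I] {α : I} {x : Mat n α} (h : incl n α x = 0) : x = 0 := by
  have := congrArg (fun a : Alg n => a.1 α) h
  simpa [incl_apply] using this

/-- The product of `A` is non-degenerate. -/
lemma eq_of_mul_right {x y : Alg n} (h : ∀ c, x * c = y * c) : x = y := by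
  classical
  refine alg_ext fun α => ?_
  have := h (incl n α 1)
  rw [mul_incl_one, mul_incl_one, ← sub_eq_zero, ← map_sub] at this
  exact sub_eq_zero.1 (incl_eq_zero this)

lemma eq_of_mul_left {x y : Alg n} (h : ∀ c, c * x = c * y) : x = y := by
  classical
  refine alg_ext fun α => ?_
  have := h (incl n α 1)
  rw [incl_one_mul, incl_one_mul, ← sub_eq_zero, ← map_sub] at this
  exact sub_eq_zero.1 (incl_eq_zero this)

lemma sum_incl [DecidableEq I] (a : Alg n) (t : Finset I) (h : ∀ α, a.1 α ≠ 0 → α ∈ t) :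
    ∑ α ∈ t, incl n α (a.1 α) = a := by
  refine alg_ext fun β => ?_
  have : (∑ α ∈ t, incl n α (a.1 α)).1 β = ∑ α ∈ t, (incl n α (a.1 α)).1 β :=
    map_sum (comp n β) _ _
  rw [this]
  simp only [incl_apply]
  by_cases hb : β ∈ t
  · rw [Finset.sum_eq_single_of_mem β hb fun α _ hne => Pi.single_eq_of_ne hne.symm _]
    simp
  · have h0 : a.1 β = 0 := by_contra fun h' => hb (h β h')
    rw [h0]
    exact Finset.sum_eq_zero fun α hα => Pi.single_eq_of_ne (fun e => hb (by rw [e]; exact hα)) _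

lemma exists_incl_sum [DecidableEq I] (z : Alg n ⊗[ℂ] Alg n) : ∃ s : Finset I, ∀ t, s ⊆ t →
    ∑ α ∈ t, ∑ β ∈ t, TensorProduct.map (incl n α) (incl n β) (toMult n z (α, β)) = z := by
  induction z with
  | zero => exact ⟨∅, fun t _ => by simp⟩
  | add x y hx hy =>
    obtain ⟨s, hs⟩ := hx
    obtain ⟨s', hs'⟩ := hy
    refine ⟨s ∪ s', fun t ht => ?_⟩
    have h1 := hs t (Finset.union_subset_left ht)
    have h2 := hs' t (Finset.union_subset_right ht)
    conv_rhs => rw [← h1, ← h2]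
    simp only [map_add, Pi.add_apply, Finset.sum_add_distrib]
  | tmul a b =>
    refine ⟨a.2.toFinset ∪ b.2.toFinset, fun t ht => ?_⟩
    have ha := sum_incl a t fun α h => ht (Finset.mem_union_left _ (a.2.mem_toFinset.2 h))
    have hb := sum_incl b t fun α h => ht (Finset.mem_union_right _ (b.2.mem_toFinset.2 h))
    conv_rhs => rw [← ha, ← hb, TensorProduct.sum_tmul]
    refine Finset.sum_congr rfl fun α _ => ?_
    rw [TensorProduct.tmul_sum]
    rfl

lemma toMult_injective : Function.Injective (toMult n) := by
  classical
  refine (injective_iff_map_eq_zero _).2 fun z hz => ?_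
  obtain ⟨s, hs⟩ := exists_incl_sum z
  rw [← hs s subset_rfl, hz]
  simp

lemma toMult_tmul (a b : Alg n) : toMult n (a ⊗ₜ b) = inclL a * inclR b := by
  funext p
  simp [toMult, inclL, inclR, comp]

lemma inclL_mul_inclR (a b : Alg n) : inclL a * inclR b = inclR b * inclL a := by
  funext p
  simp [inclL, inclR]

lemma inclL_mul (a b : Alg n) : inclL (a * b) = inclL a * inclL b := by
  funext p
  simp [inclL, mul_comp]

lemma inclR_mul (a b : Alg n) : inclR (a * b) = inclR a * inclR b := by
  funext p
  simp [inclR, mul_comp]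

lemma toMult_rTensor_mulRight (p : Alg n) (w : Alg n ⊗[ℂ] Alg n) :
    toMult n ((LinearMap.mulRight ℂ p).rTensor (Alg n) w) = toMult n w * inclL p := by
  induction w with
  | zero => simp
  | add x y hx hy => simp only [map_add, hx, hy, add_mul]
  | tmul a b =>
    rw [LinearMap.rTensor_tmul, toMult_tmul, toMult_tmul, LinearMap.mulRight_apply, inclL_mul,
      mul_assoc, mul_assoc, inclL_mul_inclR]

lemma toMult_lTensor_mulRight (p : Alg n) (w : Alg n ⊗[ℂ] Alg n) :
    toMult n ((LinearMap.mulRight ℂ p).lTensor (Alg n) w) = toMult n w * inclR p := by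
  induction w with
  | zero => simp
  | add x y hx hy => simp only [map_add, hx, hy, add_mul]
  | tmul a b =>
    rw [LinearMap.lTensor_tmul, toMult_tmul, toMult_tmul, LinearMap.mulRight_apply, inclR_mul,
      mul_assoc]

lemma toMult_lTensor_mulLeft (p : Alg n) (w : Alg n ⊗[ℂ] Alg n) :
    toMult n ((LinearMap.mulLeft ℂ p).lTensor (Alg n) w) = inclR p * toMult n w := by
  induction w with
  | zero => simp
  | add x y hx hy => simp only [map_add, hx, hy, mul_add]
  | tmul a b =>
    rw [LinearMap.lTensor_tmul, toMult_tmul, toMult_tmul, LinearMap.mulLeft_apply, inclR_mul,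
      ← mul_assoc, ← mul_assoc, inclL_mul_inclR]

lemma multAA_star_mul (x y : MultAA n) : star (x * y) = star y * star x := by
  funext p
  simp only [Pi.star_apply, Pi.mul_apply]
  induction x p with
  | zero => simp
  | add a b ha hb => rw [add_mul, star_add, ha, hb, star_add, mul_add]
  | tmul a b =>
    induction y p with
    | zero => simp
    | add c d hc hd => rw [mul_add, star_add, hc, hd, star_add, add_mul]
    | tmul c d => simp

lemma toMult_star (z : Alg n ⊗[ℂ] Alg n) : toMult n (star z) = star (toMult n z) := by
  induction z with
  | zero => simp
  | add x y hx hy => rw [star_add, map_add, hx, hy, map_add, star_add]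
  | tmul a b =>
    rw [TensorProduct.star_tmul, toMult_tmul, toMult_tmul]
    funext p
    simp [inclL, inclR, star_comp]

lemma star_inclL (a : Alg n) : star (inclL a) = inclL (star a) := by
  funext p
  simp [inclL, star_comp]

lemma star_inclR (a : Alg n) : star (inclR a) = inclR (star a) := by
  funext p
  simp [inclR, star_comp]

end Aux

/-! ### The counit and the antipode -/

namespace DiscreteQuantumGroup

variable {n : I → ℕ} (D : DiscreteQuantumGroup n)

/-- `ε` is a counit: `(ε ⊗ ι)(Δ(a)(1 ⊗ b)) = ab` and `(ι ⊗ ε)((a ⊗ 1)Δ(b)) = ab`. -/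
structure IsCounit (ε : Alg n →ₗ[ℂ] ℂ) : Prop where
  left : ∀ a b, TensorProduct.lid ℂ (Alg n) (ε.rTensor (Alg n) (D.T₁ (a ⊗ₜ b))) = a * b
  right : ∀ a b, TensorProduct.rid ℂ (Alg n) (ε.lTensor (Alg n) (D.T₂ (a ⊗ₜ b))) = a * b

/-- `S` is an antipode for the counit `ε`: `m(S ⊗ ι)(Δ(a)(1 ⊗ b)) = ε(a)b` and
`m(ι ⊗ S)((a ⊗ 1)Δ(b)) = ε(b)a`. -/
structure IsAntipode (ε : Alg n →ₗ[ℂ] ℂ) (S : Alg n →ₗ[ℂ] Alg n) : Prop where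
  left : ∀ a b, LinearMap.mul' ℂ (Alg n) (S.rTensor (Alg n) (D.T₁ (a ⊗ₜ b))) = ε a • b
  right : ∀ a b, LinearMap.mul' ℂ (Alg n) (S.lTensor (Alg n) (D.T₂ (a ⊗ₜ b))) = ε b • a

section Existence


lemma T₁_lTensor_mulRight (c : Alg n) (z : Alg n ⊗[ℂ] Alg n) :
    D.T₁ ((LinearMap.mulRight ℂ c).lTensor (Alg n) z) =
      (LinearMap.mulRight ℂ c).lTensor (Alg n) (D.T₁ z) := by
  induction z with
  | zero => simp
  | add x y hx hy => simp only [map_add, hx, hy]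
  | tmul a b =>
    apply toMult_injective
    rw [toMult_lTensor_mulRight, LinearMap.lTensor_tmul, D.T₁_spec, D.T₁_spec,
      LinearMap.mulRight_apply, inclR_mul, mul_assoc]

lemma T₁_symm_lTensor_mulRight (c : Alg n) (z : Alg n ⊗[ℂ] Alg n) :
    D.T₁.symm ((LinearMap.mulRight ℂ c).lTensor (Alg n) z) =
      (LinearMap.mulRight ℂ c).lTensor (Alg n) (D.T₁.symm z) := by
  rw [LinearEquiv.symm_apply_eq, T₁_lTensor_mulRight, LinearEquiv.apply_symm_apply]

/-- Two linear maps on `A ⊗ A` agree as soon as they agree on the image under `T₁` of the elementary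
tensors. -/
lemma ext_T₁ {V : Type*} [AddCommMonoid V] [Module ℂ V] {f g : Alg n ⊗[ℂ] Alg n →ₗ[ℂ] V}
    (h : ∀ a b, f (D.T₁ (a ⊗ₜ b)) = g (D.T₁ (a ⊗ₜ b))) : f = g := by
  have : f ∘ₗ D.T₁.toLinearMap = g ∘ₗ D.T₁.toLinearMap := TensorProduct.ext' h
  ext1
  refine LinearMap.ext fun a => LinearMap.ext fun b => ?_
  have := LinearMap.congr_fun this (D.T₁.symm (a ⊗ₜ b))
  simpa using this

lemma ext_T₂ {V : Type*} [AddCommMonoid V] [Module ℂ V] {f g : Alg n ⊗[ℂ] Alg n →ₗ[ℂ] V}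
    (h : ∀ a b, f (D.T₂ (a ⊗ₜ b)) = g (D.T₂ (a ⊗ₜ b))) : f = g := by
  have : f ∘ₗ D.T₂.toLinearMap = g ∘ₗ D.T₂.toLinearMap := TensorProduct.ext' h
  ext1
  refine LinearMap.ext fun a => LinearMap.ext fun b => ?_
  have := LinearMap.congr_fun this (D.T₂.symm (a ⊗ₜ b))
  simpa using this

/-- Coassociativity in terms of the inverse of `T₁`: `T₂ ⊗ ι` and `ι ⊗ T₁⁻¹` commute. -/
lemma coassoc_symm (x y z : Alg n) :
    D.T₁.symm.toLinearMap.lTensor (Alg n) (TensorProduct.assoc ℂ _ _ _ (D.T₂ (x ⊗ₜ y) ⊗ₜ z)) =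
      TensorProduct.assoc ℂ _ _ _ (D.T₂.toLinearMap.rTensor (Alg n)
        ((TensorProduct.assoc ℂ _ _ _).symm (x ⊗ₜ D.T₁.symm (y ⊗ₜ z)))) := by
  let G : Alg n ⊗[ℂ] Alg n →ₗ[ℂ] Alg n ⊗[ℂ] (Alg n ⊗[ℂ] Alg n) :=
    (TensorProduct.assoc ℂ (Alg n) (Alg n) (Alg n)).toLinearMap ∘ₗ
      D.T₂.toLinearMap.rTensor (Alg n) ∘ₗ
      (TensorProduct.assoc ℂ (Alg n) (Alg n) (Alg n)).symm.toLinearMap ∘ₗ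
      TensorProduct.mk ℂ (Alg n) (Alg n ⊗[ℂ] Alg n) x
  have inv : ∀ w, D.T₁.symm.toLinearMap.lTensor (Alg n)
      (D.T₁.toLinearMap.lTensor (Alg n) w) = w := fun w => by
    rw [← LinearMap.comp_apply, ← LinearMap.lTensor_comp, LinearEquiv.symm_comp,
      LinearMap.lTensor_id, LinearMap.id_apply]
  have key : G = D.T₁.symm.toLinearMap.lTensor (Alg n) ∘ₗ G ∘ₗ D.T₁.toLinearMap := by
    refine TensorProduct.ext' fun b c => ?_
    have h : G (D.T₁ (b ⊗ₜ c)) = D.T₁.toLinearMap.lTensor (Alg n) (G (b ⊗ₜ c)) :=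
      (congrArg (TensorProduct.assoc ℂ (Alg n) (Alg n) (Alg n)) (D.coassoc x b c)).trans
        (LinearEquiv.apply_symm_apply _ _)
    exact ((congrArg (D.T₁.symm.toLinearMap.lTensor (Alg n)) h).trans (inv _)).symm
  have h2 := LinearMap.congr_fun key (D.T₁.symm (y ⊗ₜ z))
  have h3 : G (D.T₁ (D.T₁.symm (y ⊗ₜ z))) =
      TensorProduct.assoc ℂ _ _ _ (D.T₂ (x ⊗ₜ y) ⊗ₜ z) := by
    rw [LinearEquiv.apply_symm_apply]; rfl
  exact (congrArg (D.T₁.symm.toLinearMap.lTensor (Alg n)) h3).symm.trans h2.symm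

/-- The element `(ι ⊗ m)(T₂ ⊗ ι)(p ⊗ v)`, computed in `M(A ⊗ A)`. -/
lemma toMult_contract (p : Alg n) (v : Alg n ⊗[ℂ] Alg n) :
    toMult n ((LinearMap.mul' ℂ (Alg n)).lTensor (Alg n) (TensorProduct.assoc ℂ _ _ _
      (D.T₂.toLinearMap.rTensor (Alg n) ((TensorProduct.assoc ℂ _ _ _).symm (p ⊗ₜ v))))) =
      inclL p * toMult n (D.T₁ v) := by
  let G : Alg n ⊗[ℂ] Alg n →ₗ[ℂ] MultAA n := toMult n ∘ₗ
    (LinearMap.mul' ℂ (Alg n)).lTensor (Alg n) ∘ₗ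
    (TensorProduct.assoc ℂ (Alg n) (Alg n) (Alg n)).toLinearMap ∘ₗ
      D.T₂.toLinearMap.rTensor (Alg n) ∘ₗ
      (TensorProduct.assoc ℂ (Alg n) (Alg n) (Alg n)).symm.toLinearMap ∘ₗ
      TensorProduct.mk ℂ (Alg n) (Alg n ⊗[ℂ] Alg n) p
  have key : G = LinearMap.mulLeft ℂ (inclL p) ∘ₗ toMult n ∘ₗ D.T₁.toLinearMap := by
    refine TensorProduct.ext' fun r s => ?_
    have h : ∀ w : Alg n ⊗[ℂ] Alg n, (LinearMap.mul' ℂ (Alg n)).lTensor (Alg n)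
        (TensorProduct.assoc ℂ _ _ _ (w ⊗ₜ s)) = (LinearMap.mulRight ℂ s).lTensor (Alg n) w := by
      let H : Alg n ⊗[ℂ] Alg n →ₗ[ℂ] Alg n ⊗[ℂ] Alg n :=
        (LinearMap.mul' ℂ (Alg n)).lTensor (Alg n) ∘ₗ
        (TensorProduct.assoc ℂ (Alg n) (Alg n) (Alg n)).toLinearMap ∘ₗ
        (TensorProduct.mk ℂ (Alg n ⊗[ℂ] Alg n) (Alg n)).flip s
      have : H = (LinearMap.mulRight ℂ s).lTensor (Alg n) := TensorProduct.ext' fun a b => rfl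
      exact fun w => LinearMap.congr_fun this w
    have h2 := congrArg (toMult n) (h (D.T₂ (p ⊗ₜ r)))
    rw [toMult_lTensor_mulRight, D.T₂_spec, mul_assoc, ← D.T₁_spec] at h2
    exact h2
  exact LinearMap.congr_fun key v

lemma counit_key (x y c : Alg n) :
    x ⊗ₜ[ℂ] LinearMap.mul' ℂ (Alg n) (D.T₁.symm (y ⊗ₜ c)) =
      LinearMap.mul' ℂ (Alg n) (D.T₂.symm (x ⊗ₜ y)) ⊗ₜ[ℂ] c := by
  let L : Alg n ⊗[ℂ] Alg n →ₗ[ℂ] Alg n ⊗[ℂ] Alg n :=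
    (LinearMap.mul' ℂ (Alg n)).lTensor (Alg n) ∘ₗ D.T₁.symm.toLinearMap.lTensor (Alg n) ∘ₗ
      (TensorProduct.assoc ℂ (Alg n) (Alg n) (Alg n)).toLinearMap ∘ₗ
      (TensorProduct.mk ℂ (Alg n ⊗[ℂ] Alg n) (Alg n)).flip c
  let R : Alg n ⊗[ℂ] Alg n →ₗ[ℂ] Alg n ⊗[ℂ] Alg n :=
    (TensorProduct.mk ℂ (Alg n) (Alg n)).flip c ∘ₗ LinearMap.mul' ℂ (Alg n) ∘ₗ D.T₂.symm.toLinearMap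
  have : L = R := by
    refine D.ext_T₂ (f := L) (g := R) fun p q => ?_
    apply toMult_injective
    have h1 := congrArg (fun w => toMult n ((LinearMap.mul' ℂ (Alg n)).lTensor (Alg n) w))
      (D.coassoc_symm p q c)
    have h2 : toMult n (R (D.T₂ (p ⊗ₜ q))) = toMult n ((p * q) ⊗ₜ c) := by
      simp [R]
    rw [h2, toMult_tmul, inclL_mul, mul_assoc, ← toMult_tmul]
    refine h1.trans ((D.toMult_contract p _).trans ?_)
    rw [LinearEquiv.apply_symm_apply]
  exact LinearMap.congr_fun this (x ⊗ₜ y)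

/-- Every multiplier Hopf `*`-algebra has exactly one counit. -/
theorem existsUnique_counit : ∃! ε, D.IsCounit ε := by
  rcases subsingleton_or_nontrivial (Alg n) with hA | hA
  · have : Subsingleton (Alg n →ₗ[ℂ] ℂ) := ⟨fun f g => LinearMap.ext fun a => by
      rw [Subsingleton.elim a 0, map_zero, map_zero]⟩
    exact ⟨0, ⟨fun _ _ => Subsingleton.elim _ _, fun _ _ => Subsingleton.elim _ _⟩,
      fun _ _ => Subsingleton.elim _ _⟩
  obtain ⟨x₀, hx₀⟩ := exists_ne (0 : Alg n)
  obtain ⟨ω, hω⟩ : ∃ ω : Module.Dual ℂ (Alg n), ω x₀ = 1 := by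
    have := (Module.forall_dual_apply_eq_zero_iff ℂ x₀).not.2 hx₀
    push Not at this
    obtain ⟨g, hg⟩ := this
    exact ⟨(g x₀)⁻¹ • g, by simp [hg]⟩
  let ε : Alg n →ₗ[ℂ] ℂ :=
    ω ∘ₗ LinearMap.mul' ℂ (Alg n) ∘ₗ D.T₂.symm.toLinearMap ∘ₗ TensorProduct.mk ℂ _ _ x₀
  have h1 : ∀ y c, LinearMap.mul' ℂ (Alg n) (D.T₁.symm (y ⊗ₜ c)) = ε y • c := fun y c => by
    have := congrArg (TensorProduct.lid ℂ (Alg n) ∘ ω.rTensor (Alg n)) (D.counit_key x₀ y c)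
    simpa [hω, ε] using this
  have h2 : ∀ x y, LinearMap.mul' ℂ (Alg n) (D.T₂.symm (x ⊗ₜ y)) = ε y • x := fun x y => by
    have := D.counit_key x y x₀
    rw [h1] at this
    have := congrArg (TensorProduct.rid ℂ (Alg n) ∘ ω.lTensor (Alg n)) this
    simpa [hω] using this.symm
  have h1' : (TensorProduct.lid ℂ (Alg n)).toLinearMap ∘ₗ ε.rTensor (Alg n) =
      LinearMap.mul' ℂ (Alg n) ∘ₗ D.T₁.symm.toLinearMap :=
    TensorProduct.ext' fun a b => by simpa using (h1 a b).symm
  have h2' : (TensorProduct.rid ℂ (Alg n)).toLinearMap ∘ₗ ε.lTensor (Alg n) =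
      LinearMap.mul' ℂ (Alg n) ∘ₗ D.T₂.symm.toLinearMap :=
    TensorProduct.ext' fun a b => by simpa using (h2 a b).symm
  refine ⟨ε, ⟨fun a b => ?_, fun a b => ?_⟩, fun ε' hε' => LinearMap.ext fun a => ?_⟩
  · simpa using LinearMap.congr_fun h1' (D.T₁ (a ⊗ₜ b))
  · simpa using LinearMap.congr_fun h2' (D.T₂ (a ⊗ₜ b))
  · have h3 : (TensorProduct.lid ℂ (Alg n)).toLinearMap ∘ₗ ε'.rTensor (Alg n) =
        LinearMap.mul' ℂ (Alg n) ∘ₗ D.T₁.symm.toLinearMap :=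
      D.ext_T₁ fun a b => by simpa using hε'.left a b
    have h4 := LinearMap.congr_fun (h3.trans h1'.symm) (a ⊗ₜ x₀)
    have h5 : ε' a • x₀ = ε a • x₀ := by simpa using h4
    exact smul_left_injective ℂ hx₀ h5

end Existence

/-- The counit of a discrete quantum group. -/
noncomputable def ε : Alg n →ₗ[ℂ] ℂ := D.existsUnique_counit.choose

lemma isCounit : D.IsCounit D.ε := D.existsUnique_counit.choose_spec.1

section Existence

lemma counit_T₁ (z : Alg n ⊗[ℂ] Alg n) :
    TensorProduct.lid ℂ (Alg n) (D.ε.rTensor (Alg n) (D.T₁ z)) = LinearMap.mul' ℂ (Alg n) z := by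
  induction z with
  | zero => simp
  | add x y hx hy => simp only [map_add, hx, hy]
  | tmul a b => rw [D.isCounit.left, LinearMap.mul'_apply]

lemma counit_T₂ (z : Alg n ⊗[ℂ] Alg n) :
    TensorProduct.rid ℂ (Alg n) (D.ε.lTensor (Alg n) (D.T₂ z)) = LinearMap.mul' ℂ (Alg n) z := by
  induction z with
  | zero => simp
  | add x y hx hy => simp only [map_add, hx, hy]
  | tmul a b => rw [D.isCounit.right, LinearMap.mul'_apply]

lemma subsingleton_of_counit (h : D.ε = 0) : Subsingleton (Alg n) := by
  classical
  have h0 : ∀ a b : Alg n, a * b = 0 := fun a b => by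
    rw [← D.isCounit.left, h]; simp
  refine ⟨fun a b => eq_of_mul_right fun c => ?_⟩
  rw [h0, h0]

lemma exists_counit_eq_one [Nontrivial (Alg n)] : ∃ e, D.ε e = 1 := by
  by_contra hc
  push Not at hc
  have : D.ε = 0 := LinearMap.ext fun a => by
    by_contra h
    exact hc ((D.ε a)⁻¹ • a) (by simp only [map_smul, smul_eq_mul]; exact inv_mul_cancel₀ h)
  exact not_subsingleton (Alg n) (D.subsingleton_of_counit this)

/-- The map `p ⊗ q ↦ T₁(a ⊗ q)(p ⊗ 1)`, that is, multiplication by `Δ(a)` on the left. -/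
noncomputable def mulComul (a : Alg n) : Alg n ⊗[ℂ] Alg n →ₗ[ℂ] Alg n ⊗[ℂ] Alg n :=
  TensorProduct.lift (LinearMap.compl₂ (LinearMap.rTensorHom (Alg n) ∘ₗ (LinearMap.mul ℂ (Alg n)).flip)
    (D.T₁.toLinearMap ∘ₗ TensorProduct.mk ℂ (Alg n) (Alg n) a))

lemma mulComul_tmul (a p q : Alg n) : D.mulComul a (p ⊗ₜ q) =
    (LinearMap.mulRight ℂ p).rTensor (Alg n) (D.T₁ (a ⊗ₜ q)) := rfl

lemma toMult_mulComul (a : Alg n) (z : Alg n ⊗[ℂ] Alg n) :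
    toMult n (D.mulComul a z) = D.Δ a * toMult n z := by
  induction z with
  | zero => simp
  | add x y hx hy => simp only [map_add, mul_add, hx, hy]
  | tmul p q =>
    rw [mulComul_tmul, toMult_rTensor_mulRight, D.T₁_spec, toMult_tmul, inclL_mul_inclR, mul_assoc]

lemma mulComul_T₁ (a b c : Alg n) : D.mulComul a (D.T₁ (b ⊗ₜ c)) = D.T₁ ((a * b) ⊗ₜ c) := by
  apply toMult_injective
  rw [toMult_mulComul, D.T₁_spec, D.T₁_spec, map_mul, mul_assoc]

lemma lid_counit_mulComul (a : Alg n) (z : Alg n ⊗[ℂ] Alg n) :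
    TensorProduct.lid ℂ (Alg n) (D.ε.rTensor (Alg n) (D.mulComul a z)) =
      a * TensorProduct.lid ℂ (Alg n) (D.ε.rTensor (Alg n) z) := by
  have := D.ext_T₁
    (f := (TensorProduct.lid ℂ (Alg n)).toLinearMap ∘ₗ D.ε.rTensor (Alg n) ∘ₗ D.mulComul a)
    (g := LinearMap.mulLeft ℂ a ∘ₗ (TensorProduct.lid ℂ (Alg n)).toLinearMap ∘ₗ D.ε.rTensor (Alg n))
    fun b c => by
      simp only [LinearMap.comp_apply, LinearEquiv.coe_coe, mulComul_T₁, counit_T₁,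
        LinearMap.mul'_apply, LinearMap.mulLeft_apply, mul_assoc]
  exact LinearMap.congr_fun this z

lemma counit_mul (a b : Alg n) : D.ε (a * b) = D.ε a * D.ε b := by
  rcases subsingleton_or_nontrivial (Alg n) with hA | hA
  · rw [Subsingleton.elim (a * b) 0, Subsingleton.elim a 0]; simp
  have := D.ext_T₁
    (f := (TensorProduct.lid ℂ (Alg n)).toLinearMap ∘ₗ D.ε.rTensor (Alg n) ∘ₗ
      (LinearMap.mulRight ℂ b).rTensor (Alg n))
    (g := D.ε b • ((TensorProduct.lid ℂ (Alg n)).toLinearMap ∘ₗ D.ε.rTensor (Alg n)))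
    fun r s => by
      simp only [LinearMap.comp_apply, LinearEquiv.coe_coe, LinearMap.smul_apply, counit_T₁,
        ← mulComul_tmul, lid_counit_mulComul, LinearMap.mul'_apply, LinearMap.rTensor_tmul,
        TensorProduct.lid_tmul, mul_smul_comm]
  obtain ⟨x, hx⟩ := exists_ne (0 : Alg n)
  have h := LinearMap.congr_fun this (a ⊗ₜ x)
  simp only [LinearMap.comp_apply, LinearEquiv.coe_coe, LinearMap.smul_apply,
    LinearMap.rTensor_tmul, TensorProduct.lid_tmul, LinearMap.mulRight_apply, smul_smul] at h
  rw [mul_comm]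
  rw [mul_comm (D.ε b)] at h
  rw [mul_comm]
  exact smul_left_injective ℂ hx h

lemma star_T₁ (a b : Alg n) : toMult n (star (D.T₁ (a ⊗ₜ b))) = inclR (star b) * D.Δ (star a) := by
  rw [toMult_star, D.T₁_spec, multAA_star_mul, star_inclR, map_star]

lemma star_T₂ (a b : Alg n) : toMult n (star (D.T₂ (a ⊗ₜ b))) = D.Δ (star b) * inclL (star a) := by
  rw [toMult_star, D.T₂_spec, multAA_star_mul, star_inclL, map_star]

lemma lTensor_mulRight_star_T₁ (a b c : Alg n) :
    (LinearMap.mulRight ℂ c).lTensor (Alg n) (star (D.T₁ (star a ⊗ₜ star b))) =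
      (LinearMap.mulLeft ℂ b).lTensor (Alg n) (D.T₁ (a ⊗ₜ c)) := by
  apply toMult_injective
  rw [toMult_lTensor_mulRight, toMult_lTensor_mulLeft, star_T₁, D.T₁_spec, star_star, star_star,
    mul_assoc]

lemma lTensor_mulRight_star_T₂ (a c d : Alg n) :
    (LinearMap.mulRight ℂ d).lTensor (Alg n) (star (D.T₂ (star c ⊗ₜ star a))) =
      (LinearMap.mulRight ℂ c).rTensor (Alg n) (D.T₁ (a ⊗ₜ d)) := by
  apply toMult_injective
  rw [toMult_lTensor_mulRight, toMult_rTensor_mulRight, star_T₂, D.T₁_spec, star_star, star_star,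
    mul_assoc, mul_assoc, inclL_mul_inclR]

lemma counit_star (a : Alg n) : D.ε (star a) = star (D.ε a) := by
  rcases subsingleton_or_nontrivial (Alg n) with hA | hA
  · rw [Subsingleton.elim (star a) 0, Subsingleton.elim a 0]; simp
  let ε' : Alg n →ₗ[ℂ] ℂ :=
    { toFun := fun a => star (D.ε (star a))
      map_add' := fun x y => by simp
      map_smul' := fun c x => by simp }
  have h1 : ∀ z : Alg n ⊗[ℂ] Alg n, TensorProduct.lid ℂ (Alg n) (ε'.rTensor (Alg n) (star z)) =
      star (TensorProduct.lid ℂ (Alg n) (D.ε.rTensor (Alg n) z)) := fun z => by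
    induction z with
    | zero => simp
    | add x y hx hy => rw [star_add, map_add, map_add, hx, hy, map_add, map_add, star_add]
    | tmul p q => simp [ε']
  have h2 : ∀ (f : Alg n →ₗ[ℂ] ℂ) (c : Alg n) (z : Alg n ⊗[ℂ] Alg n),
      TensorProduct.lid ℂ (Alg n) (f.rTensor (Alg n) ((LinearMap.mulRight ℂ c).lTensor (Alg n) z)) =
      TensorProduct.lid ℂ (Alg n) (f.rTensor (Alg n) z) * c := fun f c z => by
    induction z with
    | zero => simp
    | add x y hx hy => simp only [map_add, hx, hy, add_mul]
    | tmul p q => simp [smul_mul_assoc]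
  have h3 : ∀ (f : Alg n →ₗ[ℂ] ℂ) (c : Alg n) (z : Alg n ⊗[ℂ] Alg n),
      TensorProduct.lid ℂ (Alg n) (f.rTensor (Alg n) ((LinearMap.mulLeft ℂ c).lTensor (Alg n) z)) =
      c * TensorProduct.lid ℂ (Alg n) (f.rTensor (Alg n) z) := fun f c z => by
    induction z with
    | zero => simp
    | add x y hx hy => simp only [map_add, hx, hy, mul_add]
    | tmul p q => simp [mul_smul_comm]
  have h4 : ∀ z : Alg n ⊗[ℂ] Alg n, TensorProduct.lid ℂ (Alg n) (ε'.rTensor (Alg n) z) =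
      TensorProduct.lid ℂ (Alg n) (D.ε.rTensor (Alg n) z) := fun z => by
    have := D.ext_T₁ (f := (TensorProduct.lid ℂ (Alg n)).toLinearMap ∘ₗ ε'.rTensor (Alg n))
      (g := (TensorProduct.lid ℂ (Alg n)).toLinearMap ∘ₗ D.ε.rTensor (Alg n)) fun p q => by
        refine eq_of_mul_left fun b => ?_
        simp only [LinearMap.comp_apply, LinearEquiv.coe_coe]
        rw [← h3, ← h3, ← lTensor_mulRight_star_T₁, h2, h1, lTensor_mulRight_star_T₁, h3]
        rw [D.isCounit.left, D.isCounit.left, star_mul, star_star, star_star, mul_assoc]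
    exact LinearMap.congr_fun this z
  obtain ⟨x, hx⟩ := exists_ne (0 : Alg n)
  have h5 := h4 (star a ⊗ₜ x)
  simp only [LinearMap.rTensor_tmul, TensorProduct.lid_tmul] at h5
  have h6 := smul_left_injective ℂ hx h5
  simpa [ε'] using h6.symm

/-- The map `a ⊗ b ↦ (ε ⊗ ι)(T₁⁻¹(a ⊗ b))`, which turns out to be `a ⊗ b ↦ S(a)b`. -/
noncomputable def preAntipode : Alg n ⊗[ℂ] Alg n →ₗ[ℂ] Alg n :=
  (TensorProduct.lid ℂ (Alg n)).toLinearMap ∘ₗ D.ε.rTensor (Alg n) ∘ₗ D.T₁.symm.toLinearMap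

lemma preAntipode_T₁ (a b : Alg n) : D.preAntipode (D.T₁ (a ⊗ₜ b)) = D.ε a • b := by
  simp [preAntipode]

lemma preAntipode_mulRight (c : Alg n) (z : Alg n ⊗[ℂ] Alg n) :
    D.preAntipode ((LinearMap.mulRight ℂ c).lTensor (Alg n) z) = D.preAntipode z * c := by
  have := D.ext_T₁ (f := D.preAntipode ∘ₗ (LinearMap.mulRight ℂ c).lTensor (Alg n))
    (g := LinearMap.mulRight ℂ c ∘ₗ D.preAntipode) fun a b => by
      simp only [LinearMap.comp_apply]
      rw [← T₁_lTensor_mulRight, LinearMap.lTensor_tmul, preAntipode_T₁, preAntipode_T₁]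
      simp
  exact LinearMap.congr_fun this z

lemma preAntipode_mulComul (a : Alg n) (z : Alg n ⊗[ℂ] Alg n) :
    D.preAntipode (D.mulComul a z) = D.ε a • D.preAntipode z := by
  have := D.ext_T₁ (f := D.preAntipode ∘ₗ D.mulComul a) (g := D.ε a • D.preAntipode) fun b c => by
      simp only [LinearMap.comp_apply, LinearMap.smul_apply]
      rw [mulComul_T₁, preAntipode_T₁, preAntipode_T₁, counit_mul, mul_smul]
  exact LinearMap.congr_fun this z

lemma preAntipode_rTensor (p : Alg n) (w : Alg n ⊗[ℂ] Alg n) :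
    D.preAntipode ((LinearMap.mulRight ℂ p).rTensor (Alg n) w) =
      D.preAntipode (p ⊗ₜ D.preAntipode w) := by
  have := D.ext_T₁ (f := D.preAntipode ∘ₗ (LinearMap.mulRight ℂ p).rTensor (Alg n))
    (g := D.preAntipode ∘ₗ TensorProduct.mk ℂ _ _ p ∘ₗ D.preAntipode) fun a q => by
      simp only [LinearMap.comp_apply]
      rw [← mulComul_tmul, preAntipode_mulComul, preAntipode_T₁]
      simp
  exact LinearMap.congr_fun this w

/-- `a (S(b) c)` does not depend on how it is bracketed. -/
lemma mul_preAntipode (c : Alg n) (z : Alg n ⊗[ℂ] Alg n) :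
    LinearMap.mul' ℂ (Alg n) ((D.preAntipode ∘ₗ (TensorProduct.mk ℂ _ _).flip c).lTensor (Alg n) z) =
      TensorProduct.rid ℂ (Alg n) (D.ε.lTensor (Alg n) (D.T₂.symm z)) * c := by
  let e : Alg n ⊗[ℂ] Alg n →ₗ[ℂ] Alg n :=
    (TensorProduct.lid ℂ (Alg n)).toLinearMap ∘ₗ D.ε.rTensor (Alg n)
  have h0 : ∀ w : Alg n ⊗[ℂ] Alg n,
      (D.preAntipode ∘ₗ (TensorProduct.mk ℂ (Alg n) (Alg n)).flip c).lTensor (Alg n) w =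
      e.lTensor (Alg n) (D.T₁.symm.toLinearMap.lTensor (Alg n)
        (TensorProduct.assoc ℂ _ _ _ (w ⊗ₜ c))) := fun w => by
    have : (D.preAntipode ∘ₗ (TensorProduct.mk ℂ (Alg n) (Alg n)).flip c).lTensor (Alg n) =
      e.lTensor (Alg n) ∘ₗ D.T₁.symm.toLinearMap.lTensor (Alg n) ∘ₗ
        (TensorProduct.assoc ℂ (Alg n) (Alg n) (Alg n)).toLinearMap ∘ₗ
        (TensorProduct.mk ℂ (Alg n ⊗[ℂ] Alg n) (Alg n)).flip c := TensorProduct.ext' fun a b => rfl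
    exact LinearMap.congr_fun this w
  have h1 : ∀ (p : Alg n) (v : Alg n ⊗[ℂ] Alg n), LinearMap.mul' ℂ (Alg n) (e.lTensor (Alg n)
      (TensorProduct.assoc ℂ _ _ _ (D.T₂.toLinearMap.rTensor (Alg n)
        ((TensorProduct.assoc ℂ _ _ _).symm (p ⊗ₜ v))))) = p * LinearMap.mul' ℂ (Alg n) v := by
    intro p v
    let G : Alg n ⊗[ℂ] Alg n →ₗ[ℂ] Alg n := LinearMap.mul' ℂ (Alg n) ∘ₗ e.lTensor (Alg n) ∘ₗ
      (TensorProduct.assoc ℂ (Alg n) (Alg n) (Alg n)).toLinearMap ∘ₗ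
      D.T₂.toLinearMap.rTensor (Alg n) ∘ₗ
      (TensorProduct.assoc ℂ (Alg n) (Alg n) (Alg n)).symm.toLinearMap ∘ₗ
      TensorProduct.mk ℂ (Alg n) (Alg n ⊗[ℂ] Alg n) p
    have hG : G = LinearMap.mulLeft ℂ p ∘ₗ LinearMap.mul' ℂ (Alg n) := by
      refine TensorProduct.ext' fun r s => ?_
      have h : ∀ w : Alg n ⊗[ℂ] Alg n, LinearMap.mul' ℂ (Alg n) (e.lTensor (Alg n)
          (TensorProduct.assoc ℂ _ _ _ (w ⊗ₜ s))) =
          TensorProduct.rid ℂ (Alg n) (D.ε.lTensor (Alg n) w) * s := by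
        let H : Alg n ⊗[ℂ] Alg n →ₗ[ℂ] Alg n := LinearMap.mul' ℂ (Alg n) ∘ₗ e.lTensor (Alg n) ∘ₗ
          (TensorProduct.assoc ℂ (Alg n) (Alg n) (Alg n)).toLinearMap ∘ₗ
          (TensorProduct.mk ℂ (Alg n ⊗[ℂ] Alg n) (Alg n)).flip s
        have hH : H = LinearMap.mulRight ℂ s ∘ₗ (TensorProduct.rid ℂ (Alg n)).toLinearMap ∘ₗ
            D.ε.lTensor (Alg n) := TensorProduct.ext' fun a b => by
          have : H (a ⊗ₜ b) = a * (D.ε b • s) := rfl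
          rw [this]
          simp [mul_smul_comm]
        exact fun w => LinearMap.congr_fun hH w
      have h2 := h (D.T₂ (p ⊗ₜ r))
      rw [D.isCounit.right] at h2
      exact h2.trans (mul_assoc p r s)
    exact LinearMap.congr_fun hG v
  have := D.ext_T₂
    (f := LinearMap.mul' ℂ (Alg n) ∘ₗ
      (D.preAntipode ∘ₗ (TensorProduct.mk ℂ (Alg n) (Alg n)).flip c).lTensor (Alg n))
    (g := LinearMap.mulRight ℂ c ∘ₗ (TensorProduct.rid ℂ (Alg n)).toLinearMap ∘ₗ
      D.ε.lTensor (Alg n) ∘ₗ D.T₂.symm.toLinearMap) fun p q => by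
      have h2 : ∀ v : Alg n ⊗[ℂ] Alg n, LinearMap.mul' ℂ (Alg n) (D.T₁.symm v) =
          TensorProduct.lid ℂ (Alg n) (D.ε.rTensor (Alg n) v) := fun v => by
        rw [← counit_T₁, LinearEquiv.apply_symm_apply]
      refine (congrArg (LinearMap.mul' ℂ (Alg n)) (h0 (D.T₂ (p ⊗ₜ q)))).trans ?_
      refine (congrArg (fun w => LinearMap.mul' ℂ (Alg n) (e.lTensor (Alg n) w))
        (D.coassoc_symm p q c)).trans ((h1 p _).trans ?_)
      rw [h2]
      simp [mul_smul_comm]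
  exact LinearMap.congr_fun this z

/-- Every multiplier Hopf `*`-algebra on a direct sum of matrix algebras has exactly one antipode. -/
theorem existsUnique_antipode : ∃! S, D.IsAntipode D.ε S := by
  rcases subsingleton_or_nontrivial (Alg n) with hA | hA
  · have : Subsingleton (Alg n →ₗ[ℂ] Alg n) := ⟨fun f g => LinearMap.ext fun a =>
      Subsingleton.elim _ _⟩
    exact ⟨0, ⟨fun _ _ => Subsingleton.elim _ _, fun _ _ => Subsingleton.elim _ _⟩,
      fun _ _ => Subsingleton.elim _ _⟩
  obtain ⟨e, he⟩ := D.exists_counit_eq_one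
  let S : Alg n →ₗ[ℂ] Alg n :=
    { toFun := fun b => D.preAntipode (star (D.T₂ (star b ⊗ₜ star e)))
      map_add' := fun x y => by
        rw [star_add, TensorProduct.add_tmul, map_add, star_add, map_add]
      map_smul' := fun c x => by
        rw [star_smul, ← TensorProduct.smul_tmul', map_smul, star_smul, star_star, map_smul]
        rfl }
  have hS : ∀ b d, S b * d = D.preAntipode (b ⊗ₜ d) := fun b d => by
    change D.preAntipode (star (D.T₂ (star b ⊗ₜ star e))) * d = _
    rw [← preAntipode_mulRight, lTensor_mulRight_star_T₂, preAntipode_rTensor, preAntipode_T₁, he,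
      one_smul]
  have hS' : LinearMap.mul' ℂ (Alg n) ∘ₗ S.rTensor (Alg n) = D.preAntipode :=
    TensorProduct.ext' fun a b => by simpa using hS a b
  refine ⟨S, ⟨fun a b => ?_, fun a b => ?_⟩, fun S' h => ?_⟩
  · rw [← preAntipode_T₁, ← hS']; rfl
  · refine eq_of_mul_right fun c => ?_
    have h1 : ∀ z : Alg n ⊗[ℂ] Alg n, LinearMap.mul' ℂ (Alg n) (S.lTensor (Alg n) z) * c =
        LinearMap.mul' ℂ (Alg n)
          ((D.preAntipode ∘ₗ (TensorProduct.mk ℂ _ _).flip c).lTensor (Alg n) z) := fun z => by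
      induction z with
      | zero => simp
      | add x y hx hy => simp only [map_add, add_mul, hx, hy]
      | tmul x y => simp [mul_assoc, hS]
    rw [h1, mul_preAntipode]
    simp
  · have h1 : LinearMap.mul' ℂ (Alg n) ∘ₗ S'.rTensor (Alg n) = D.preAntipode :=
      D.ext_T₁ fun a b => by rw [preAntipode_T₁]; exact h.left a b
    refine LinearMap.ext fun a => eq_of_mul_right fun d => ?_
    have h2 := LinearMap.congr_fun (h1.trans hS'.symm) (a ⊗ₜ d)
    simpa using h2

end Existence

/-- The antipode of a discrete quantum group. -/
noncomputable def S : Alg n →ₗ[ℂ] Alg n := D.existsUnique_antipode.choose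

lemma isAntipode : D.IsAntipode D.ε D.S := D.existsUnique_antipode.choose_spec.1

section Antipode

lemma mul'_antipode : LinearMap.mul' ℂ (Alg n) ∘ₗ D.S.rTensor (Alg n) = D.preAntipode :=
  D.ext_T₁ fun a b => by rw [preAntipode_T₁]; exact D.isAntipode.left a b

lemma antipode_mul_eq (a b : Alg n) : D.S a * b = D.preAntipode (a ⊗ₜ b) := by
  rw [← mul'_antipode]; simp

lemma antipode_mul (a b : Alg n) : D.S (a * b) = D.S b * D.S a := by
  refine eq_of_mul_right fun c => ?_
  have := D.preAntipode_rTensor b (a ⊗ₜ c)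
  rw [LinearMap.rTensor_tmul, LinearMap.mulRight_apply] at this
  rw [antipode_mul_eq, this, mul_assoc, antipode_mul_eq D a, antipode_mul_eq]

/-- `S(S(a^*)^*) = a`. -/
lemma antipode_star_antipode_star (a : Alg n) : D.S (star (D.S (star a))) = a := by
  rcases subsingleton_or_nontrivial (Alg n) with hA | hA
  · exact Subsingleton.elim _ _
  let R : Alg n →ₗ[ℂ] Alg n :=
    { toFun := fun a => star (D.S (star a))
      map_add' := fun x y => by simp
      map_smul' := fun c x => by simp }
  let N₄ : Alg n ⊗[ℂ] Alg n →ₗ[ℂ] Alg n :=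
    TensorProduct.lift ((LinearMap.mul ℂ (Alg n) ∘ₗ R).flip)
  have hN₄ : ∀ z, N₄ (star z) = star (LinearMap.mul' ℂ (Alg n) (D.S.lTensor (Alg n) z)) := fun z => by
    induction z with
    | zero => simp
    | add x y hx hy => rw [star_add, map_add, hx, hy, map_add, map_add, star_add]
    | tmul p q => simp [N₄, R]
  have h1 : ∀ z, D.S (N₄ z) = LinearMap.mul' ℂ (Alg n) (TensorProduct.map D.S (D.S ∘ₗ R) z) := fun z => by
    induction z with
    | zero => simp
    | add x y hx hy => simp only [map_add, hx, hy]
    | tmul p q => simp [N₄, antipode_mul]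
  have h2 : ∀ z, LinearMap.mul' ℂ (Alg n) (TensorProduct.map D.S (D.S ∘ₗ R) (star z)) =
      D.preAntipode (star z) := fun z => by
    obtain ⟨w, rfl⟩ := D.T₂.surjective z
    induction w with
    | zero => simp
    | add x y hx hy => rw [map_add, star_add, map_add, map_add, hx, hy, map_add]
    | tmul c a =>
      rw [← h1, hN₄, D.isAntipode.right, star_smul, ← counit_star, map_smul]
      refine eq_of_mul_right fun d => ?_
      have := D.lTensor_mulRight_star_T₂ (star a) (star c) d
      rw [star_star, star_star] at this
      rw [← preAntipode_mulRight, this, preAntipode_rTensor, preAntipode_T₁, ← antipode_mul_eq]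
      simp [mul_smul_comm, smul_mul_assoc]
  have h3 : ∀ x y, D.S x * D.S (R y) = D.S x * y := fun x y => by
    have := h2 (star (x ⊗ₜ y))
    rw [star_star, ← antipode_mul_eq] at this
    simpa using this
  obtain ⟨e, he⟩ := D.exists_counit_eq_one
  refine eq_of_mul_left fun c => ?_
  have h4 : ∀ (z : Alg n ⊗[ℂ] Alg n), LinearMap.mul' ℂ (Alg n) (D.S.lTensor (Alg n) z) * D.S (R a) =
      LinearMap.mul' ℂ (Alg n) (D.S.lTensor (Alg n) z) * a := fun z => by
    induction z with
    | zero => simp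
    | add x y hx hy => simp only [map_add, add_mul, hx, hy]
    | tmul p q => simp [mul_assoc, h3]
  have h5 := h4 (D.T₂ (c ⊗ₜ e))
  rw [D.isAntipode.right, he, one_smul] at h5
  exact h5

lemma antipode_bijective : Function.Bijective D.S := by
  refine ⟨fun a b h => ?_, fun a => ⟨_, D.antipode_star_antipode_star a⟩⟩
  have key : ∀ c, star (D.S (star (D.S c))) = c := fun c => by
    have := D.antipode_star_antipode_star (star c)
    rw [star_star] at this
    rw [this, star_star]
  rw [← key a, h, key]

/-- The antipode as a linear bijection of `A`, with inverse `S⁻¹`. -/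
noncomputable def antipodeEquiv : Alg n ≃ₗ[ℂ] Alg n := LinearEquiv.ofBijective D.S D.antipode_bijective

end Antipode

end DiscreteQuantumGroup

/-! ### The reduced dual space and its pairing with `A` -/

section DualSpace

variable [DecidableEq I] (n : I → ℕ)

/-- The reduced dual space `B`: the direct sum of the dual spaces `B_α = A_α'`. -/
abbrev DualSpace : Type v := ⨁ α, Module.Dual ℂ (Mat n α)

/-- The pairing `⟨a, b⟩ = ∑ ⟨a_α, b_α⟩` of `A` with `B`, as the map `b ↦ ⟨·, b⟩` from `B` to `A'`. -/
noncomputable def pairing : DualSpace n →ₗ[ℂ] Module.Dual ℂ (Alg n) :=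
  DirectSum.toModule ℂ I _ fun α => (comp n α).dualMap

/-- The pairing `⟨x, t⟩` of `x` in `M(A ⊗ A)` with `t` in `B ⊗ B`, given by
`⟨x, b ⊗ b'⟩ = ∑ ⟨x_{αβ}, b_α ⊗ b'_β⟩`, as the map `t ↦ ⟨·, t⟩`. -/
noncomputable def pairing₂ : DualSpace n ⊗[ℂ] DualSpace n →ₗ[ℂ] Module.Dual ℂ (MultAA n) :=
  TensorProduct.lift <| DirectSum.toModule ℂ I _ fun α => LinearMap.flip <|
    DirectSum.toModule ℂ I _ fun β => LinearMap.flip <|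
      (TensorProduct.mk ℂ (Module.Dual ℂ (Mat n α)) (Module.Dual ℂ (Mat n β))).compr₂
        ((LinearMap.proj (R := ℂ) (φ := fun p : I × I => Mat n p.1 ⊗[ℂ] Mat n p.2)
          (α, β)).dualMap ∘ₗ TensorProduct.dualDistrib ℂ (Mat n α) (Mat n β))

/-- The coproduct of `B`, dual to the product of `A`. On `B_α` it is the transpose
`A_α' → (A_α ⊗ A_α)' = A_α' ⊗ A_α'` of the multiplication of `A_α`. -/
noncomputable def dualComul : DualSpace n →ₗ[ℂ] DualSpace n ⊗[ℂ] DualSpace n :=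
  DirectSum.toModule ℂ I _ fun α =>
    TensorProduct.map (DirectSum.lof ℂ I (fun γ => Module.Dual ℂ (Mat n γ)) α)
        (DirectSum.lof ℂ I (fun γ => Module.Dual ℂ (Mat n γ)) α) ∘ₗ
      (TensorProduct.dualDistribEquiv ℂ (Mat n α) (Mat n α)).symm.toLinearMap ∘ₗ
        (LinearMap.mul' ℂ (Mat n α)).dualMap

variable {n}

/-- The element of `B` given by a linear functional on `A` that vanishes on all but finitely many
of the components. -/
noncomputable def reduced (f : Module.Dual ℂ (Alg n)) (hf : {γ | f ∘ₗ incl n γ ≠ 0}.Finite) :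
    DualSpace n :=
  DirectSum.mk (fun γ => Module.Dual ℂ (Mat n γ)) hf.toFinset fun γ => f ∘ₗ incl n γ

lemma reduced_apply (f : Module.Dual ℂ (Alg n)) (hf : {γ | f ∘ₗ incl n γ ≠ 0}.Finite) (γ : I) :
    reduced f hf γ = f ∘ₗ incl n γ := by
  by_cases h : γ ∈ hf.toFinset
  · exact DirectSum.mk_apply_of_mem h
  · have h' : f ∘ₗ incl n γ = 0 := by
      by_contra hc
      exact h (hf.mem_toFinset.2 hc)
    rw [h']
    exact DirectSum.mk_apply_of_notMem h

lemma pairing_lof (α : I) (g : Module.Dual ℂ (Mat n α)) (a : Alg n) :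
    pairing n (DirectSum.lof ℂ I (fun γ => Module.Dual ℂ (Mat n γ)) α g) a = g (a.1 α) := by
  simp [pairing, comp]

lemma pairing_incl (b : DualSpace n) (γ : I) (x : Mat n γ) :
    pairing n b (incl n γ x) = b γ x := by
  induction b using DirectSum.induction_on with
  | zero => simp
  | add b c hb hc => rw [map_add, LinearMap.add_apply, hb, hc]; rfl
  | of α g =>
    refine (pairing_lof α g _).trans ?_
    rw [incl_apply]
    by_cases h : α = γ
    · subst h; simp
    · rw [Pi.single_eq_of_ne h, DirectSum.of_eq_of_ne _ _ _ (Ne.symm h)]; simp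

/-- Elements of `B` are determined by the functionals on `A` that they define. -/
lemma pairing_injective : Function.Injective (pairing n) := fun b c h => by
  refine DFinsupp.ext fun γ => LinearMap.ext fun x => ?_
  have := LinearMap.congr_fun h (incl n γ x)
  rwa [pairing_incl, pairing_incl] at this

lemma functional_ext {f g : Module.Dual ℂ (Alg n)} (h : ∀ γ x, f (incl n γ x) = g (incl n γ x)) :
    f = g := by
  refine LinearMap.ext fun a => ?_
  rw [← sum_incl a a.2.toFinset fun α hα => a.2.mem_toFinset.2 hα, map_sum, map_sum]
  exact Finset.sum_congr rfl fun α _ => h α _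

lemma pairing_reduced (f : Module.Dual ℂ (Alg n)) (hf : {γ | f ∘ₗ incl n γ ≠ 0}.Finite) :
    pairing n (reduced f hf) = f :=
  functional_ext fun γ x => by rw [pairing_incl, reduced_apply]; rfl

lemma pairing₂_tmul_toMult (b b' : DualSpace n) (a a' : Alg n) :
    pairing₂ n (b ⊗ₜ b') (toMult n (a ⊗ₜ a')) = pairing n b a * pairing n b' a' := by
  induction b using DirectSum.induction_on with
  | zero => simp
  | add b c hb hc => simp only [TensorProduct.add_tmul, map_add, LinearMap.add_apply, hb, hc, add_mul]
  | of α g =>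
    induction b' using DirectSum.induction_on with
    | zero => simp
    | add b c hb hc =>
      simp only [TensorProduct.tmul_add, map_add, LinearMap.add_apply, hb, hc, mul_add]
    | of β g' =>
      simp only [← DirectSum.lof_eq_of ℂ, pairing_lof]
      simp [pairing₂, toMult, comp]

/-- The defining property `⟨a ⊗ a', Δ(b)⟩ = ⟨aa', b⟩` of the coproduct of `B`. -/
lemma pairing₂_dualComul (b : DualSpace n) (a a' : Alg n) :
    pairing₂ n (dualComul n b) (toMult n (a ⊗ₜ a')) = pairing n b (a * a') := by
  induction b using DirectSum.induction_on with
  | zero => simp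
  | add b c hb hc => simp only [map_add, LinearMap.add_apply, hb, hc]
  | of α g =>
    rw [← DirectSum.lof_eq_of ℂ, pairing_lof, mul_comp]
    have h : (LinearMap.applyₗ (toMult n (a ⊗ₜ a'))) ∘ₗ pairing₂ n ∘ₗ
        TensorProduct.map (DirectSum.lof ℂ I (fun γ => Module.Dual ℂ (Mat n γ)) α)
          (DirectSum.lof ℂ I (fun γ => Module.Dual ℂ (Mat n γ)) α) =
        (LinearMap.applyₗ (a.1 α ⊗ₜ[ℂ] a'.1 α)) ∘ₗ
          (TensorProduct.dualDistribEquiv ℂ (Mat n α) (Mat n α)).toLinearMap :=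
      TensorProduct.ext' fun f f' => by
        have := pairing₂_tmul_toMult (DirectSum.lof ℂ I (fun γ => Module.Dual ℂ (Mat n γ)) α f)
          (DirectSum.lof ℂ I (fun γ => Module.Dual ℂ (Mat n γ)) α f') a a'
        rw [pairing_lof, pairing_lof] at this
        exact this
    have h2 := LinearMap.congr_fun h ((TensorProduct.dualDistribEquiv ℂ (Mat n α) (Mat n α)).symm
      ((LinearMap.mul' ℂ (Mat n α)).dualMap g))
    have h3 : dualComul n (DirectSum.lof ℂ I (fun γ => Module.Dual ℂ (Mat n γ)) α g) =
        TensorProduct.map (DirectSum.lof ℂ I (fun γ => Module.Dual ℂ (Mat n γ)) α)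
          (DirectSum.lof ℂ I (fun γ => Module.Dual ℂ (Mat n γ)) α)
          ((TensorProduct.dualDistribEquiv ℂ (Mat n α) (Mat n α)).symm
            ((LinearMap.mul' ℂ (Mat n α)).dualMap g)) := by
      simp only [dualComul, DirectSum.toModule_lof]; rfl
    rw [h3]
    refine h2.trans ?_
    rw [LinearMap.comp_apply, LinearEquiv.coe_coe, LinearEquiv.apply_symm_apply]
    rfl

/-- A linear map on `A` that factors through multiplication by a fixed element vanishes on all but
finitely many of the components. -/
lemma finite_of_mul {V : Type*} [AddCommMonoid V] [Module ℂ V] (f : Alg n →ₗ[ℂ] V) (c : Alg n)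
    (h : ∀ a, c * a = 0 → a * c = 0 → f a = 0) : {γ | f ∘ₗ incl n γ ≠ 0}.Finite := by
  refine c.2.subset fun γ hγ => fun hc => hγ ?_
  refine LinearMap.ext fun x => h _ (alg_ext fun β => ?_) (alg_ext fun β => ?_)
  all_goals
    rw [mul_comp, incl_apply]
    by_cases hb : β = γ
    · subst hb
      rw [hc]
      simp
    · rw [Pi.single_eq_of_ne hb]
      simp

end DualSpace

/-! ### The dual `*`-algebra -/

namespace DiscreteQuantumGroup

variable {n : I → ℕ} (D : DiscreteQuantumGroup n)

lemma comul_mul_toMult_T₁ (a : Alg n) (z : Alg n ⊗[ℂ] Alg n) :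
    D.Δ a * toMult n (D.T₁ z) = toMult n (D.T₁ ((LinearMap.mulLeft ℂ a).rTensor (Alg n) z)) := by
  induction z with
  | zero => simp
  | add x y hx hy => simp only [map_add, mul_add, hx, hy]
  | tmul p q => simp [D.T₁_spec, mul_assoc]

variable [DecidableEq I]

/-- Each component of `Δ` is a map that vanishes on all but finitely many components of `A`. -/
lemma finite_comul_comp (p : I × I) :
    {γ | (LinearMap.proj p ∘ₗ (D.Δ : Alg n →ₗ[ℂ] MultAA n)) ∘ₗ incl n γ ≠ 0}.Finite := by
  let E : Alg n ⊗[ℂ] Alg n := incl n p.1 1 ⊗ₜ incl n p.2 1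
  have hE : toMult n E p = 1 := by
    simp [E, toMult, comp, incl_apply, Algebra.TensorProduct.one_def]
  have h1 : ∀ z : Alg n ⊗[ℂ] Alg n, {γ | ∃ x : Mat n γ,
      (LinearMap.mulLeft ℂ (incl n γ x)).rTensor (Alg n) z ≠ 0}.Finite := fun z => by
    induction z with
    | zero => simp
    | add x y hx hy =>
      refine (hx.union hy).subset fun γ hγ => ?_
      obtain ⟨m, hm⟩ := hγ
      by_contra hc
      have h1 : (LinearMap.mulLeft ℂ (incl n γ m)).rTensor (Alg n) x = 0 :=
        by_contra fun h => hc (Or.inl ⟨m, h⟩)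
      have h2 : (LinearMap.mulLeft ℂ (incl n γ m)).rTensor (Alg n) y = 0 :=
        by_contra fun h => hc (Or.inr ⟨m, h⟩)
      exact hm (by rw [map_add, h1, h2, add_zero])
    | tmul a b =>
      refine a.2.subset fun γ hγ => fun hc => ?_
      obtain ⟨m, hm⟩ := hγ
      have : incl n γ m * a = 0 := alg_ext fun β => by
        rw [mul_comp, incl_apply]
        by_cases hb : β = γ
        · subst hb; rw [hc]; simp
        · rw [Pi.single_eq_of_ne hb]; simp
      exact hm (by simp [this])
  refine (h1 (D.T₁.symm E)).subset fun γ hγ => ?_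
  by_contra hc
  refine hγ (LinearMap.ext fun x => ?_)
  have h2 : (LinearMap.mulLeft ℂ (incl n γ x)).rTensor (Alg n) (D.T₁.symm E) = 0 :=
    by_contra fun h => hc ⟨x, h⟩
  have h3 := D.comul_mul_toMult_T₁ (incl n γ x) (D.T₁.symm E)
  rw [h2, LinearEquiv.apply_symm_apply, map_zero, map_zero] at h3
  have h4 : D.Δ (incl n γ x) p * toMult n E p = 0 := congrFun h3 p
  rw [hE, mul_one] at h4
  exact h4

lemma finite_comul (t : DualSpace n ⊗[ℂ] DualSpace n) :
    {γ | (pairing₂ n t ∘ₗ (D.Δ : Alg n →ₗ[ℂ] MultAA n)) ∘ₗ incl n γ ≠ 0}.Finite := by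
  have hadd : ∀ t t' : DualSpace n ⊗[ℂ] DualSpace n,
      {γ | (pairing₂ n t ∘ₗ (D.Δ : Alg n →ₗ[ℂ] MultAA n)) ∘ₗ incl n γ ≠ 0}.Finite →
      {γ | (pairing₂ n t' ∘ₗ (D.Δ : Alg n →ₗ[ℂ] MultAA n)) ∘ₗ incl n γ ≠ 0}.Finite →
      {γ | (pairing₂ n (t + t') ∘ₗ (D.Δ : Alg n →ₗ[ℂ] MultAA n)) ∘ₗ incl n γ ≠ 0}.Finite := by
    intro t t' h h'
    refine (h.union h').subset fun γ hγ => ?_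
    by_contra hc
    have h1 : (pairing₂ n t ∘ₗ (D.Δ : Alg n →ₗ[ℂ] MultAA n)) ∘ₗ incl n γ = 0 :=
      by_contra fun h => hc (Or.inl h)
    have h2 : (pairing₂ n t' ∘ₗ (D.Δ : Alg n →ₗ[ℂ] MultAA n)) ∘ₗ incl n γ = 0 :=
      by_contra fun h => hc (Or.inr h)
    exact hγ (by rw [map_add, LinearMap.add_comp, LinearMap.add_comp, h1, h2, add_zero])
  induction t with
  | zero => simp
  | add x y hx hy => exact hadd x y hx hy
  | tmul b b' =>
    induction b using DirectSum.induction_on with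
    | zero => simp
    | add b c hb hc => rw [TensorProduct.add_tmul]; exact hadd _ _ hb hc
    | of α g =>
      induction b' using DirectSum.induction_on with
      | zero => simp
      | add b c hb hc => rw [TensorProduct.tmul_add]; exact hadd _ _ hb hc
      | of β g' =>
        refine (D.finite_comul_comp (α, β)).subset fun γ hγ hc => hγ ?_
        refine LinearMap.ext fun x => ?_
        have h1 : D.Δ (incl n γ x) (α, β) = 0 := LinearMap.congr_fun hc x
        have h2 : ∀ m : MultAA n, m (α, β) = 0 → pairing₂ n
            (DirectSum.of (fun γ => Module.Dual ℂ (Mat n γ)) α g ⊗ₜ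
              DirectSum.of (fun γ => Module.Dual ℂ (Mat n γ)) β g') m = 0 := fun m hm => by
          simp only [← DirectSum.lof_eq_of ℂ]
          simp [pairing₂, hm]
        exact h2 _ h1

/-- The product of `B`: `⟨a, bb'⟩ = ⟨Δ(a), b' ⊗ b⟩`. -/
noncomputable def dualMul : DualSpace n →ₗ[ℂ] DualSpace n →ₗ[ℂ] DualSpace n :=
  LinearMap.mk₂ ℂ
    (fun b b' => reduced (pairing₂ n (b' ⊗ₜ b) ∘ₗ (D.Δ : Alg n →ₗ[ℂ] MultAA n)) (D.finite_comul _))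
    (fun b c d => pairing_injective (by
      simp only [map_add, pairing_reduced, TensorProduct.tmul_add, LinearMap.add_comp]))
    (fun r b d => pairing_injective (by
      simp only [map_smul, pairing_reduced, TensorProduct.tmul_smul, LinearMap.smul_comp]))
    (fun b c d => pairing_injective (by
      simp only [map_add, pairing_reduced, TensorProduct.add_tmul, LinearMap.add_comp]))
    (fun r b d => pairing_injective (by
      simp only [map_smul, pairing_reduced, ← TensorProduct.smul_tmul', LinearMap.smul_comp]))

lemma pairing_dualMul (b b' : DualSpace n) (a : Alg n) :
    pairing n (D.dualMul b b') a = pairing₂ n (b' ⊗ₜ b) (D.Δ a) := by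
  simp only [dualMul, LinearMap.mk₂_apply, pairing_reduced]
  rfl

/-- The functional `a ↦ ⟨S(a^*), b⟩⁻`, which is conjugate linear in `b`. -/
noncomputable def starFunctional (b : DualSpace n) : Module.Dual ℂ (Alg n) where
  toFun a := star (pairing n b (D.S (star a)))
  map_add' x y := by simp
  map_smul' c x := by simp

lemma finite_starFunctional (b : DualSpace n) :
    {γ | D.starFunctional b ∘ₗ incl n γ ≠ 0}.Finite := by
  induction b using DirectSum.induction_on with
  | zero =>
    have : D.starFunctional 0 = 0 := LinearMap.ext fun a => by simp [starFunctional]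
    simp [this]
  | add b c hb hc =>
    have h : D.starFunctional (b + c) = D.starFunctional b + D.starFunctional c :=
      LinearMap.ext fun a => by simp [starFunctional]
    refine (hb.union hc).subset fun γ hγ => ?_
    by_contra h'
    have h1 : D.starFunctional b ∘ₗ incl n γ = 0 := by_contra fun h => h' (Or.inl h)
    have h2 : D.starFunctional c ∘ₗ incl n γ = 0 := by_contra fun h => h' (Or.inr h)
    exact hγ (by rw [h, LinearMap.add_comp, h1, h2, add_zero])
  | of α g =>
    obtain ⟨w, hw⟩ := D.antipode_bijective.2 (incl n α 1)
    refine finite_of_mul _ (star w) fun a _ ha => ?_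
    have h1 : D.S (star a) * incl n α 1 = 0 := by
      have h2 : w * star a = 0 := by
        have := congrArg star ha
        rwa [star_mul, star_star, star_zero] at this
      rw [← hw, ← antipode_mul, h2, map_zero]
    rw [mul_incl_one] at h1
    have h2 : star (pairing n (DirectSum.lof ℂ I (fun γ => Module.Dual ℂ (Mat n γ)) α g)
        (D.S (star a))) = 0 := by
      rw [pairing_lof, incl_eq_zero h1, map_zero, star_zero]
    exact h2

/-- The involution of `B`: `⟨a, b^*⟩ = ⟨S(a^*), b⟩⁻`. -/
noncomputable def dualStar : DualSpace n →ₗ⋆[ℂ] DualSpace n where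
  toFun b := reduced (D.starFunctional b) (D.finite_starFunctional b)
  map_add' b c := pairing_injective (by
    rw [map_add, pairing_reduced, pairing_reduced, pairing_reduced]
    exact LinearMap.ext fun a => by simp [starFunctional])
  map_smul' r b := pairing_injective (by
    rw [map_smul, pairing_reduced, pairing_reduced]
    exact LinearMap.ext fun a => by simp [starFunctional])

lemma pairing_dualStar (b : DualSpace n) (a : Alg n) :
    pairing n (D.dualStar b) a = star (pairing n b (D.S (star a))) :=
  LinearMap.congr_fun (pairing_reduced (D.starFunctional b) (D.finite_starFunctional b)) a

/-- The functional `φ(S⁻¹(·)a)`. -/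
noncomputable def fourierFunctional (φ : Alg n →ₗ[ℂ] ℂ) (a : Alg n) : Module.Dual ℂ (Alg n) :=
  φ ∘ₗ LinearMap.mulRight ℂ a ∘ₗ D.antipodeEquiv.symm.toLinearMap

lemma finite_fourierFunctional (φ : Alg n →ₗ[ℂ] ℂ) (a : Alg n) :
    {γ | D.fourierFunctional φ a ∘ₗ incl n γ ≠ 0}.Finite := by
  refine finite_of_mul _ (D.S a) fun x hx _ => ?_
  have h : D.antipodeEquiv.symm x * a = 0 := by
    refine D.antipode_bijective.1 ?_
    rw [antipode_mul, map_zero]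
    have : D.S (D.antipodeEquiv.symm x) = x := D.antipodeEquiv.apply_symm_apply x
    rw [this, hx]
  change φ (D.antipodeEquiv.symm x * a) = 0
  rw [h, map_zero]

/-- The element `b = φ(S⁻¹(·)a)` of `B`. -/
noncomputable def fourier (φ : Alg n →ₗ[ℂ] ℂ) (a : Alg n) : DualSpace n :=
  reduced (D.fourierFunctional φ a) (D.finite_fourierFunctional φ a)

lemma pairing_fourier (φ : Alg n →ₗ[ℂ] ℂ) (a x : Alg n) :
    pairing n (D.fourier φ a) x = φ (D.antipodeEquiv.symm x * a) :=
  LinearMap.congr_fun (pairing_reduced _ (D.finite_fourierFunctional φ a)) x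

/-! ### Cointegral and integrals -/

/-- `h` is the cointegral of `A`: a non-zero self-adjoint idempotent with `ah = ε(a)h`. -/
structure IsCointegral (h : Alg n) : Prop where
  ne_zero : h ≠ 0
  star_eq : star h = h
  mul_self : h * h = h
  mul_eq : ∀ a, a * h = D.ε a • h

/-- `φ` is left invariant: `(ι ⊗ φ)Δ(a) = φ(a)1` in `M(A)`, that is,
`(ι ⊗ φ)((c ⊗ 1)Δ(a)) = φ(a)c` for all `c` in `A`. -/
def IsLeftInvariant (φ : Alg n →ₗ[ℂ] ℂ) : Prop :=
  ∀ c a, TensorProduct.rid ℂ (Alg n) (φ.lTensor (Alg n) (D.T₂ (c ⊗ₜ a))) = φ a • c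

/-- The integral `φ_B : b ↦ ⟨h, b⟩` on `B`. -/
noncomputable def dualIntegral (h : Alg n) : DualSpace n →ₗ[ℂ] ℂ := (pairing n).flip h

end DiscreteQuantumGroup

/-! ### GNS spaces -/

section GNS

variable {V : Type*} [AddCommGroup V] [Module ℂ V]

/-- For a `*`-algebra `V` with multiplication `μ` and involution `st` and a linear functional `φ`,
the sesquilinear form `(x, y) ↦ φ(x^* y)`. It is positive semidefinite when `φ` is positive. -/
def gnsForm (μ : V →ₗ[ℂ] V →ₗ[ℂ] V) (st : V →ₗ⋆[ℂ] V) (φ : V →ₗ[ℂ] ℂ) : V →ₗ⋆[ℂ] V →ₗ[ℂ] ℂ :=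
  (μ.compr₂ φ) ∘ₛₗ st

/-- The space `V` with the semi-inner product given by a positive semidefinite form. -/
def PreGNS {s : V →ₗ⋆[ℂ] V →ₗ[ℂ] ℂ} (_ : s.IsPosSemidef) : Type _ := V

variable {s : V →ₗ⋆[ℂ] V →ₗ[ℂ] ℂ} (hs : s.IsPosSemidef)

instance : AddCommGroup (PreGNS hs) := inferInstanceAs (AddCommGroup V)

instance : Module ℂ (PreGNS hs) := inferInstanceAs (Module ℂ V)

/-- The semi-inner product on `V`, conjugate linear in the first variable. -/
abbrev preGNSCore : PreInnerProductSpace.Core ℂ (PreGNS hs) where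
  inner x y := s x y
  conj_inner_symm x y := hs.isSymm.eq y x
  re_inner_nonneg x := (RCLike.nonneg_iff.mp (hs.isNonneg.nonneg x)).1
  add_left x y z := LinearMap.map_add₂ s (x : V) (y : V) (z : V)
  smul_left x y r := LinearMap.map_smulₛₗ₂ s r (x : V) (y : V)

noncomputable instance : SeminormedAddCommGroup (PreGNS hs) :=
  InnerProductSpace.Core.toSeminormedAddCommGroup (c := preGNSCore hs)

noncomputable instance : InnerProductSpace ℂ (PreGNS hs) := InnerProductSpace.ofCore (preGNSCore hs)

/-- The GNS space: the Hilbert space obtained from `V` by separation and completion. -/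
abbrev GNSSpace : Type _ := UniformSpace.Completion (PreGNS hs)

/-- The canonical map `Λ : V → H`. -/
noncomputable def Λ : V →ₗ[ℂ] GNSSpace hs :=
  (UniformSpace.Completion.toComplL (𝕜 := ℂ) (E := PreGNS hs)).toLinearMap ∘ₗ
    (LinearMap.id : V →ₗ[ℂ] V)

lemma inner_Λ (x y : V) : inner ℂ (Λ hs x) (Λ hs y) = s x y :=
  UniformSpace.Completion.inner_coe (𝕜 := ℂ) (E := PreGNS hs) x y

lemma denseRange_Λ : DenseRange (Λ hs) :=
  UniformSpace.Completion.denseRange_coe (α := PreGNS hs)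

/-- `ρ` is the GNS representation of the algebra `V` with multiplication `μ`: the bounded operators
`ρ(x)` satisfy `ρ(x)Λ(y) = Λ(xy)`. -/
def IsGNSRepresentation (μ : V →ₗ[ℂ] V →ₗ[ℂ] V) (ρ : V → GNSSpace hs →L[ℂ] GNSSpace hs) : Prop :=
  ∀ x y, ρ x (Λ hs y) = Λ hs (μ x y)

end GNS

/-! ### Operators on Hilbert space tensor products -/

section HilbertTensor

variable (K H : Type*) [NormedAddCommGroup K] [InnerProductSpace ℂ K] [CompleteSpace K]
  [NormedAddCommGroup H] [InnerProductSpace ℂ H] [CompleteSpace H]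

/-- The Hilbert space tensor product. -/
abbrev HilbertTensor : Type _ := UniformSpace.Completion (K ⊗[ℂ] H)

variable {K H}

/-- The canonical map from the algebraic to the Hilbert space tensor product. -/
noncomputable def toHilbertTensor : K ⊗[ℂ] H →L[ℂ] HilbertTensor K H :=
  UniformSpace.Completion.toComplL

/-- The bounded operator `η ↦ η ⊗ ξ` from `K` to `K ⊗ H`. -/
noncomputable def tmulRight (ξ : H) : K →L[ℂ] HilbertTensor K H :=
  toHilbertTensor ∘L (TensorProduct.mkL ℂ K H).flip ξ

/-- The right slice `(ι ⊗ ω_{ζ,ξ})u` of an operator `u` on `K ⊗ H`, where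
`ω_{ζ,ξ}(x) = ⟨ζ, xξ⟩`: the operator on `K` with `⟨η', ((ι ⊗ ω_{ζ,ξ})u)η⟩ = ⟨η' ⊗ ζ, u(η ⊗ ξ)⟩`. -/
noncomputable def sliceRight (u : HilbertTensor K H →L[ℂ] HilbertTensor K H) (ζ ξ : H) :
    K →L[ℂ] K :=
  ContinuousLinearMap.adjoint (tmulRight ζ) ∘L u ∘L tmulRight ξ

end HilbertTensor

/-! ### The left regular corepresentation of `B` and the representation of `A` that it determines -/

section Corepresentation

variable {n : I → ℕ}

/-- The C`*`-algebra completion of `B` acting on a Hilbert space by bounded operators: the norm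
closure of the space of operators `lam(b)`. -/
noncomputable def dualCompletion {K : Type*} [NormedAddCommGroup K] [InnerProductSpace ℂ K]
    (lam : DualSpace n →ₗ[ℂ] (K →L[ℂ] K)) : Submodule ℂ (K →L[ℂ] K) :=
  (LinearMap.range lam).topologicalClosure

lemma mem_dualCompletion {K : Type*} [NormedAddCommGroup K] [InnerProductSpace ℂ K]
    (lam : DualSpace n →ₗ[ℂ] (K →L[ℂ] K)) (b : DualSpace n) : lam b ∈ dualCompletion lam :=
  Submodule.le_topologicalClosure _ (LinearMap.mem_range_self lam b)

/-- The form `(a, a') ↦ φ(a^* a')` on `A`. -/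
noncomputable def formA (φ : Alg n →ₗ[ℂ] ℂ) : Alg n →ₗ⋆[ℂ] Alg n →ₗ[ℂ] ℂ :=
  gnsForm (LinearMap.mul ℂ (Alg n)) (starLinearEquiv ℂ).toLinearMap φ

variable [DecidableEq I]

/-- `π` is the map `π(a) = (ω_a ⊗ ι)u` determined by the unitary operator `u` on `K ⊗ H`. Here `ω_a`
is the continuous extension to the completion of `B` (acting on `K`) of the functional
`b ↦ ⟨a, b⟩`, the right slices `(ι ⊗ ω_{ζ,ξ})u` of `u` belong to this completion, and `π(a)` is the
operator on `H` with `⟨ζ, π(a)ξ⟩ = ω_a((ι ⊗ ω_{ζ,ξ})u)`. -/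
def IsDeterminedBy {K H : Type*} [NormedAddCommGroup K] [InnerProductSpace ℂ K] [CompleteSpace K]
    [NormedAddCommGroup H] [InnerProductSpace ℂ H] [CompleteSpace H]
    (lam : DualSpace n →ₗ[ℂ] (K →L[ℂ] K)) (u : HilbertTensor K H ≃ₗᵢ[ℂ] HilbertTensor K H)
    (π : Alg n → H →L[ℂ] H) : Prop :=
  ∀ a, ∃ ω : dualCompletion lam →L[ℂ] ℂ,
    (∀ b, ω ⟨lam b, mem_dualCompletion lam b⟩ = pairing n b a) ∧
    ∀ ζ ξ, ∃ hmem : sliceRight (u.toContinuousLinearEquiv : _ →L[ℂ] _) ζ ξ ∈ dualCompletion lam,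
      inner ℂ ζ (π a ξ) = ω ⟨_, hmem⟩

namespace DiscreteQuantumGroup

variable (D : DiscreteQuantumGroup n)

/-- The form `(b, b') ↦ φ_B(b^* b')` on `B`. -/
noncomputable def formB (h : Alg n) : DualSpace n →ₗ⋆[ℂ] DualSpace n →ₗ[ℂ] ℂ :=
  gnsForm D.dualMul D.dualStar (dualIntegral h)

/-- `u` is the left regular corepresentation of `B`, where `lam` is the GNS representation of `B`:
the unitary operator on `H_B ⊗ H_B` with `u^*(η ⊗ Λ_B(b)) = ∑ b₍₁₎η ⊗ Λ_B(b₍₂₎)`. -/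
def IsLeftRegularCorepresentation {h : Alg n} (hB : (D.formB h).IsPosSemidef)
    (lam : DualSpace n →ₗ[ℂ] (GNSSpace hB →L[ℂ] GNSSpace hB))
    (u : HilbertTensor (GNSSpace hB) (GNSSpace hB) ≃ₗᵢ[ℂ]
      HilbertTensor (GNSSpace hB) (GNSSpace hB)) : Prop :=
  ∀ η b, u.symm (toHilbertTensor (η ⊗ₜ Λ hB b)) =
    toHilbertTensor (TensorProduct.map
      ((ContinuousLinearMap.apply ℂ (GNSSpace hB) η).toLinearMap ∘ₗ lam) (Λ hB) (dualComul n b))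

end DiscreteQuantumGroup

end Corepresentation

end QuantumDuality

open QuantumDuality

/-!
The reduced dual `B` is spanned by the matrix coefficients `u_{ij}` of the components of `A`, with
`Δ(u_{ij}) = ∑ u_{ik} ⊗ u_{kj}`, and the axioms of `(A, Δ)` dualize: `B` is an associative algebra
(coassociativity) with a multiplicative coproduct and counit, with the functional `ε` as its unit,
and with the anti-multiplicative map `b ↦ b ∘ S`, which is inverse to the antipode of `B`. From
these facts it follows that `B` is a `*`-algebra in which the matrix `u` satisfies `u^*u = 1`
(`sum_star_coeff_mul_coeff`).

*The integrals.* The counit is a character of a direct sum of simple algebras, so it lives on a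
single one-dimensional component, whose unit is the cointegral `h`. Consider the map `G : B → A`,
`G(b) = (b ⊗ ι)Δ(h)` (`invFourier`). Strong invariance of `φ_B = ⟨h, ·⟩` gives
`aG(b) = G(b(S(a) ·))` and `G(b)a = G(b(· S⁻¹(a)))` (`mul_invFourier`, `invFourier_mul`), so the
kernel of `G` is stable under two-sided translations and its range is a two-sided ideal. As the
blocks are simple and `u^*u = 1`, `G` is bijective. A functional `φ` is a left integral with
`φ(h) = 1` exactly when `φ ∘ G` is the counit of `B`, which gives existence and uniqueness, and
then `G` is the inverse of the Fourier transform (`fourier_invFourier`).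

*Positivity.* It suffices to treat an element `r` that consists of one row `k` of a component.
There `φ(r^*G(u_{ii})r)` can be computed in two ways. It is the `(i, i)` entry of `s^*s` with
`s = S⁻¹(r)`, which is positive for a suitable choice of the component and of `i`, and it is
a multiple of `φ(r^*r)` by an entry of `Δ(h)`, which is non-negative because `h` is a projection
(`row_nonneg`). The Plancherel formula `φ(G(b)^*G(b')) = φ_B(b^*b')` (`formA_invFourier`)
transports positivity to `φ_B` and makes the Fourier transform isometric.

*The corepresentation.* Left multiplication on `B` is bounded because `u^*u = 1`. Invariance of
`φ_B` shows that `η ⊗ Λ(b) ↦ ∑ b₍₁₎η ⊗ Λ(b₍₂₎)` preserves inner products (`inner_coregular`), and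
its range is dense because the map has an explicit inverse in terms of `b ↦ b ∘ S`
(`sum_coregular`). The slices of `u` along `Λ(b)` are therefore elements of `B`, and `ω_a` is the
vector functional `⟨Λ(1), · Λ(c)⟩`, where `c` is the Fourier transform of `a`. Evaluation yields
`π(a)Λ(b) = Λ(b(S(a) ·))` (`apply_of_isDeterminedBy`), which is what the Fourier transform makes
of left multiplication by `a` (`fourier_mul`).
-/

set_option linter.unusedSectionVars false

namespace QuantumDuality

universe v

variable {I : Type v} [DecidableEq I] {n : I → ℕ}

/-! ### Matrix coefficients and the pairing of the dual with the direct sum -/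

/-- The matrix coefficient `u_{ij}` of the component `A_α`, as an element of `B`: the functional
that reads off the `(i, j)` entry of the component in `A_α`. -/
noncomputable def coeff (n : I → ℕ) (α : I) (i j : Fin (n α)) : DualSpace n :=
  DirectSum.lof ℂ I (fun γ => Module.Dual ℂ (Mat n γ)) α (Matrix.entryLinearMap ℂ ℂ i j)

lemma pairing_coeff (α : I) (i j : Fin (n α)) (a : Alg n) :
    pairing n (coeff n α i j) a = a.1 α i j := by
  rw [coeff, pairing_lof]; rfl

/-- The matrix coefficients span `B`. -/
lemma coeff_induction {p : DualSpace n → Prop} (zero : p 0) (add : ∀ b c, p b → p c → p (b + c))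
    (smul : ∀ (r : ℂ) b, p b → p (r • b)) (coeff : ∀ α i j, p (coeff n α i j)) (b : DualSpace n) :
    p b := by
  have hsum : ∀ {ι : Type} (s : Finset ι) (f : ι → DualSpace n), (∀ i, p (f i)) →
      p (∑ i ∈ s, f i) := fun s f hf => Finset.sum_induction f p add zero fun i _ => hf i
  induction b using DirectSum.induction_on with
  | zero => exact zero
  | add b c hb hc => exact add b c hb hc
  | of α g =>
    have hg : g = ∑ i, ∑ j, g (Matrix.single i j 1) • Matrix.entryLinearMap ℂ ℂ i j := by
      refine LinearMap.ext fun x => ?_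
      conv_lhs => rw [Matrix.matrix_eq_sum_single x]
      simp only [map_sum, LinearMap.sum_apply, LinearMap.smul_apply, Matrix.entryLinearMap_apply]
      refine Finset.sum_congr rfl fun i _ => Finset.sum_congr rfl fun j _ => ?_
      rw [← mul_one (x i j), ← smul_eq_mul (x i j), ← Matrix.smul_single, map_smul]
      simp [mul_comm]
    rw [← DirectSum.lof_eq_of ℂ, hg, map_sum]
    refine hsum _ _ fun i => ?_
    rw [map_sum]
    refine hsum _ _ fun j => ?_
    rw [map_smul]
    exact smul _ _ (coeff α i j)

lemma dual_hom_ext {V : Type*} [AddCommMonoid V] [Module ℂ V] {f g : DualSpace n →ₗ[ℂ] V}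
    (h : ∀ α i j, f (coeff n α i j) = g (coeff n α i j)) : f = g := by
  refine LinearMap.ext fun b => ?_
  induction b using coeff_induction with
  | zero => simp
  | add b c hb hc => rw [map_add, map_add, hb, hc]
  | smul r b hb => rw [map_smul, map_smul, hb]
  | coeff α i j => exact h α i j

/-- Elements of `A` are determined by their pairings with `B`. -/
lemma alg_ext_pairing {a a' : Alg n} (h : ∀ b, pairing n b a = pairing n b a') : a = a' := by
  refine alg_ext fun α => Matrix.ext fun i j => ?_
  rw [← pairing_coeff, h, pairing_coeff]

lemma dual_ext {b c : DualSpace n} (h : ∀ a, pairing n b a = pairing n c a) : b = c :=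
  pairing_injective (LinearMap.ext h)

lemma exists_support (b : DualSpace n) : ∃ s : Finset I, ∀ α, b α ≠ 0 → α ∈ s := by
  classical
  exact ⟨DFinsupp.support b, fun α h => DFinsupp.mem_support_iff.2 h⟩

lemma incl_mul (α : I) (x y : Mat n α) : incl n α (x * y) = incl n α x * incl n α y := by
  refine alg_ext fun β => ?_
  rw [mul_comp, incl_apply, incl_apply, incl_apply]
  by_cases hb : β = α
  · subst hb; simp
  · simp [Pi.single_eq_of_ne hb]

lemma star_incl (α : I) (x : Mat n α) : star (incl n α x) = incl n α (star x) := by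
  refine alg_ext fun β => ?_
  rw [star_comp, incl_apply, incl_apply]
  by_cases hb : β = α
  · subst hb; simp
  · simp [Pi.single_eq_of_ne hb]

/-- The central projection of `A` that is the unit of the components in `s`. -/
noncomputable def unitOn (n : I → ℕ) (s : Finset I) : Alg n := ∑ α ∈ s, incl n α 1

lemma unitOn_apply (s : Finset I) (β : I) : (unitOn n s).1 β = if β ∈ s then 1 else 0 := by
  have : (unitOn n s).1 β = ∑ α ∈ s, (incl n α 1).1 β := map_sum (comp n β) _ _
  rw [this]
  simp only [incl_apply]
  split_ifs with hb
  · rw [Finset.sum_eq_single_of_mem β hb fun α _ hne => Pi.single_eq_of_ne hne.symm _]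
    simp
  · exact Finset.sum_eq_zero fun α hα => Pi.single_eq_of_ne (fun e => hb (by rw [e]; exact hα)) _

/-- Elements of `A` that agree on the support of `b` have the same pairing with `b`. -/
lemma pairing_congr {b : DualSpace n} {a a' : Alg n} (h : ∀ α, b α ≠ 0 → a.1 α = a'.1 α) :
    pairing n b a = pairing n b a' := by
  classical
  conv_lhs => rw [← DirectSum.sum_support_of b]
  conv_rhs => rw [← DirectSum.sum_support_of b]
  simp only [map_sum, LinearMap.sum_apply, ← DirectSum.lof_eq_of ℂ, pairing_lof]
  refine Finset.sum_congr rfl fun α hα => ?_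
  rw [h α (DFinsupp.mem_support_iff.1 hα)]

lemma pairing₂_lof (α β : I) (g : Module.Dual ℂ (Mat n α)) (g' : Module.Dual ℂ (Mat n β))
    (m : MultAA n) :
    pairing₂ n (DirectSum.lof ℂ I (fun γ => Module.Dual ℂ (Mat n γ)) α g ⊗ₜ
      DirectSum.lof ℂ I (fun γ => Module.Dual ℂ (Mat n γ)) β g') m =
      TensorProduct.dualDistrib ℂ _ _ (g ⊗ₜ g') (m (α, β)) := by
  simp [pairing₂]

lemma pairing₂_congr {b b' : DualSpace n} {m m' : MultAA n}
    (h : ∀ α β, b α ≠ 0 → b' β ≠ 0 → m (α, β) = m' (α, β)) :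
    pairing₂ n (b ⊗ₜ b') m = pairing₂ n (b ⊗ₜ b') m' := by
  classical
  have key : ∀ m : MultAA n, pairing₂ n (b ⊗ₜ b') m =
      ∑ α ∈ DFinsupp.support b, ∑ β ∈ DFinsupp.support b',
        TensorProduct.dualDistrib ℂ _ _ (b α ⊗ₜ b' β) (m (α, β)) := fun m => by
    conv_lhs => rw [← DirectSum.sum_support_of b, ← DirectSum.sum_support_of b']
    simp only [TensorProduct.sum_tmul, TensorProduct.tmul_sum, map_sum, LinearMap.sum_apply,
      ← DirectSum.lof_eq_of ℂ, pairing₂_lof]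
    rw [Finset.sum_comm]
  rw [key, key]
  refine Finset.sum_congr rfl fun α hα => Finset.sum_congr rfl fun β hβ => ?_
  rw [h α β (DFinsupp.mem_support_iff.1 hα) (DFinsupp.mem_support_iff.1 hβ)]

/-- Every element of `M(A ⊗ A)` agrees with an element of `A ⊗ A` on finitely many components. -/
lemma exists_toMult_eq (s : Finset I) (m : MultAA n) :
    ∃ z : Alg n ⊗[ℂ] Alg n, ∀ α ∈ s, ∀ β ∈ s, toMult n z (α, β) = m (α, β) := by
  refine ⟨∑ p ∈ s ×ˢ s, TensorProduct.map (incl n p.1) (incl n p.2) (m p), fun α hα β hβ => ?_⟩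
  have h0 : ∀ (p q : I × I) (w : Mat n p.1 ⊗[ℂ] Mat n p.2), q ≠ p →
      toMult n (TensorProduct.map (incl n p.1) (incl n p.2) w) q = 0 := fun p q w hpq => by
    induction w with
    | zero => simp
    | add x y hx hy => rw [map_add, map_add, Pi.add_apply, hx, hy, add_zero]
    | tmul x y =>
      rw [TensorProduct.map_tmul]
      change (incl n p.1 x).1 q.1 ⊗ₜ[ℂ] (incl n p.2 y).1 q.2 = 0
      rw [incl_apply, incl_apply]
      by_cases h1 : q.1 = p.1
      · have h2 : q.2 ≠ p.2 := fun h2 => hpq (Prod.ext h1 h2)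
        rw [Pi.single_eq_of_ne h2, TensorProduct.tmul_zero]
      · rw [Pi.single_eq_of_ne h1, TensorProduct.zero_tmul]
  have h1 : ∀ (p : I × I) (w : Mat n p.1 ⊗[ℂ] Mat n p.2),
      toMult n (TensorProduct.map (incl n p.1) (incl n p.2) w) p = w := fun p w => by
    induction w with
    | zero => simp
    | add x y hx hy => rw [map_add, map_add, Pi.add_apply, hx, hy]
    | tmul x y =>
      rw [TensorProduct.map_tmul]
      change (incl n p.1 x).1 p.1 ⊗ₜ[ℂ] (incl n p.2 y).1 p.2 = x ⊗ₜ y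
      rw [incl_apply, incl_apply, Pi.single_eq_same, Pi.single_eq_same]
  rw [map_sum, Finset.sum_apply, Finset.sum_eq_single_of_mem (α, β) (Finset.mk_mem_product hα hβ)
    fun p _ hp => h0 p _ _ hp.symm, h1]

/-- Pairing with `A ⊗ A`, evaluated by slicing with the first leg first. -/
lemma pairing₂_toMult_left (b x : DualSpace n) (w : Alg n ⊗[ℂ] Alg n) :
    pairing₂ n (b ⊗ₜ x) (toMult n w) =
      pairing n x (TensorProduct.lid ℂ (Alg n) ((pairing n b).rTensor (Alg n) w)) := by
  induction w with
  | zero => simp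
  | add y z hy hz => simp only [map_add, hy, hz]
  | tmul y z => rw [pairing₂_tmul_toMult]; simp

lemma pairing₂_toMult_right (b x : DualSpace n) (w : Alg n ⊗[ℂ] Alg n) :
    pairing₂ n (b ⊗ₜ x) (toMult n w) =
      pairing n b (TensorProduct.rid ℂ (Alg n) ((pairing n x).lTensor (Alg n) w)) := by
  induction w with
  | zero => simp
  | add y z hy hz => simp only [map_add, hy, hz]
  | tmul y z => rw [pairing₂_tmul_toMult]; simp [mul_comm]

/-- The functional `b(c ·)`. -/
noncomputable def lmul (c : Alg n) : DualSpace n →ₗ[ℂ] DualSpace n where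
  toFun b := reduced (pairing n b ∘ₗ LinearMap.mulLeft ℂ c)
    (finite_of_mul _ c fun a ha _ => by simp [ha])
  map_add' b b' := pairing_injective (by
    simp only [map_add, pairing_reduced, LinearMap.add_comp])
  map_smul' r b := pairing_injective (by
    simp only [map_smul, pairing_reduced, LinearMap.smul_comp, RingHom.id_apply])

lemma pairing_lmul (c : Alg n) (b : DualSpace n) (a : Alg n) :
    pairing n (lmul c b) a = pairing n b (c * a) :=
  LinearMap.congr_fun (pairing_reduced (pairing n b ∘ₗ LinearMap.mulLeft ℂ c) _) a

/-- The functional `b(· c)`. -/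
noncomputable def rmul (c : Alg n) : DualSpace n →ₗ[ℂ] DualSpace n where
  toFun b := reduced (pairing n b ∘ₗ LinearMap.mulRight ℂ c)
    (finite_of_mul _ c fun a _ ha => by simp [ha])
  map_add' b b' := pairing_injective (by
    simp only [map_add, pairing_reduced, LinearMap.add_comp])
  map_smul' r b := pairing_injective (by
    simp only [map_smul, pairing_reduced, LinearMap.smul_comp, RingHom.id_apply])

lemma pairing_rmul (c : Alg n) (b : DualSpace n) (a : Alg n) :
    pairing n (rmul c b) a = pairing n b (a * c) :=
  LinearMap.congr_fun (pairing_reduced (pairing n b ∘ₗ LinearMap.mulRight ℂ c) _) a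

lemma lmul_coeff (c : Alg n) (α : I) (i j : Fin (n α)) :
    lmul c (coeff n α i j) = ∑ k, c.1 α i k • coeff n α k j := by
  refine dual_ext fun a => ?_
  simp [pairing_lmul, pairing_coeff, mul_comp, Matrix.mul_apply]

lemma lmul_apply (c : Alg n) (b : DualSpace n) (γ : I) :
    lmul c b γ = b γ ∘ₗ LinearMap.mulLeft ℂ (c.1 γ) := by
  refine LinearMap.ext fun x => ?_
  rw [← pairing_incl, pairing_lmul, LinearMap.comp_apply, LinearMap.mulLeft_apply, ← pairing_incl]
  congr 1
  refine alg_ext fun β => ?_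
  rw [mul_comp, incl_apply, incl_apply]
  by_cases hb : β = γ
  · subst hb; simp
  · simp [Pi.single_eq_of_ne hb]

lemma pairing₂_lmul (c : Alg n) (b x : DualSpace n) (m : MultAA n) :
    pairing₂ n (lmul c b ⊗ₜ x) m = pairing₂ n (b ⊗ₜ x) (inclL c * m) := by
  obtain ⟨s, hs⟩ := exists_support b
  obtain ⟨t, ht⟩ := exists_support x
  obtain ⟨z, hz⟩ := exists_toMult_eq (s ∪ t) m
  have h1 : pairing₂ n (lmul c b ⊗ₜ x) m = pairing₂ n (lmul c b ⊗ₜ x) (toMult n z) := by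
    refine pairing₂_congr fun α β hα hβ => (hz α (Finset.mem_union_left _ (hs α fun h => hα ?_)) β
      (Finset.mem_union_right _ (ht β hβ))).symm
    rw [lmul_apply, h, LinearMap.zero_comp]
  have h2 : pairing₂ n (b ⊗ₜ x) (inclL c * m) = pairing₂ n (b ⊗ₜ x) (inclL c * toMult n z) := by
    refine pairing₂_congr fun α β hα hβ => ?_
    rw [Pi.mul_apply, Pi.mul_apply, hz α (Finset.mem_union_left _ (hs α hα)) β
      (Finset.mem_union_right _ (ht β hβ))]
  rw [h1, h2]
  clear h1 h2 hz
  induction z with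
  | zero => simp
  | add y z hy hz => simp only [map_add, mul_add, hy, hz]
  | tmul y z =>
    rw [pairing₂_tmul_toMult, toMult_tmul, ← mul_assoc, ← inclL_mul, ← toMult_tmul,
      pairing₂_tmul_toMult, pairing_lmul]

lemma lmul_unitOn {b : DualSpace n} {s : Finset I} (hs : ∀ α, b α ≠ 0 → α ∈ s) :
    lmul (unitOn n s) b = b := by
  refine dual_ext fun a => ?_
  rw [pairing_lmul]
  refine pairing_congr fun α hα => ?_
  rw [mul_comp, unitOn_apply, if_pos (hs α hα), one_mul]

lemma rmul_unitOn {b : DualSpace n} {s : Finset I} (hs : ∀ α, b α ≠ 0 → α ∈ s) :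
    rmul (unitOn n s) b = b := by
  refine dual_ext fun a => ?_
  rw [pairing_rmul]
  refine pairing_congr fun α hα => ?_
  rw [mul_comp, unitOn_apply, if_pos (hs α hα), mul_one]

lemma pairing₂_mul_inclR_unitOn {b x : DualSpace n} {s : Finset I} (hs : ∀ α, x α ≠ 0 → α ∈ s)
    (m : MultAA n) : pairing₂ n (b ⊗ₜ x) (m * inclR (unitOn n s)) = pairing₂ n (b ⊗ₜ x) m := by
  refine pairing₂_congr fun α β _ hβ => ?_
  rw [Pi.mul_apply]
  simp only [inclR]
  rw [unitOn_apply, if_pos (hs β hβ), ← Algebra.TensorProduct.one_def, mul_one]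

/-- The coproduct of a matrix coefficient: `Δ(u_{ij}) = ∑ u_{ik} ⊗ u_{kj}`. -/
lemma dualComul_coeff (α : I) (i j : Fin (n α)) :
    dualComul n (coeff n α i j) = ∑ k, coeff n α i k ⊗ₜ coeff n α k j := by
  have h : (TensorProduct.dualDistribEquiv ℂ (Mat n α) (Mat n α)).symm
      ((LinearMap.mul' ℂ (Mat n α)).dualMap (Matrix.entryLinearMap ℂ ℂ i j)) =
      ∑ k, Matrix.entryLinearMap ℂ ℂ i k ⊗ₜ Matrix.entryLinearMap ℂ ℂ k j := by
    rw [LinearEquiv.symm_apply_eq]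
    refine Eq.trans ?_ (map_sum (TensorProduct.dualDistrib ℂ (Mat n α) (Mat n α)) _ _).symm
    refine TensorProduct.ext' fun x y => ?_
    rw [LinearMap.sum_apply]
    exact Matrix.mul_apply (M := x) (N := y)
  have h3 : dualComul n (coeff n α i j) =
      TensorProduct.map (DirectSum.lof ℂ I (fun γ => Module.Dual ℂ (Mat n γ)) α)
        (DirectSum.lof ℂ I (fun γ => Module.Dual ℂ (Mat n γ)) α)
        ((TensorProduct.dualDistribEquiv ℂ (Mat n α) (Mat n α)).symm
          ((LinearMap.mul' ℂ (Mat n α)).dualMap (Matrix.entryLinearMap ℂ ℂ i j))) := by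
    simp only [dualComul, coeff, DirectSum.toModule_lof]; rfl
  rw [h3, h, map_sum]
  rfl

/-- The counit `b ↦ ⟨1, b⟩` of `B`. -/
noncomputable def counitB : DualSpace n →ₗ[ℂ] ℂ :=
  DirectSum.toModule ℂ I ℂ fun _ => LinearMap.applyₗ 1

lemma counitB_coeff (α : I) (i j : Fin (n α)) :
    counitB (coeff n α i j) = if i = j then 1 else 0 := by
  rw [counitB, coeff, DirectSum.toModule_lof]
  exact Matrix.one_apply

lemma counitB_eq_pairing {b : DualSpace n} {s : Finset I} (hs : ∀ α, b α ≠ 0 → α ∈ s) :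
    counitB b = pairing n b (unitOn n s) := by
  classical
  conv_lhs => rw [← DirectSum.sum_support_of b]
  conv_rhs => rw [← DirectSum.sum_support_of b]
  simp only [map_sum, LinearMap.sum_apply, ← DirectSum.lof_eq_of ℂ, pairing_lof]
  refine Finset.sum_congr rfl fun α hα => ?_
  rw [unitOn_apply, if_pos (hs α (DFinsupp.mem_support_iff.1 hα)), counitB, DirectSum.toModule_lof]
  rfl

lemma counitB_lmul (c : Alg n) (b : DualSpace n) : counitB (lmul c b) = pairing n b c := by
  obtain ⟨s, hs⟩ := exists_support b
  rw [counitB_eq_pairing (s := s), pairing_lmul]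
  · refine pairing_congr fun α hα => ?_
    rw [mul_comp, unitOn_apply, if_pos (hs α hα), mul_one]
  · refine fun α hα => hs α fun h => hα ?_
    rw [lmul_apply, h, LinearMap.zero_comp]

namespace DiscreteQuantumGroup

variable (D : DiscreteQuantumGroup n)

/-! ### The algebra structure of the dual -/

lemma pairing_slice_T₂ (c a : Alg n) (d x : DualSpace n) :
    pairing n x (TensorProduct.lid ℂ (Alg n) ((pairing n d).rTensor (Alg n) (D.T₂ (c ⊗ₜ a)))) =
      pairing n (D.dualMul x (lmul c d)) a := by
  rw [← pairing₂_toMult_left, D.T₂_spec, ← pairing₂_lmul, pairing_dualMul]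

lemma pairing₂_T₁ {x : DualSpace n} {s : Finset I} (hs : ∀ α, x α ≠ 0 → α ∈ s) (b : DualSpace n)
    (a : Alg n) :
    pairing₂ n (b ⊗ₜ x) (toMult n (D.T₁ (a ⊗ₜ unitOn n s))) = pairing n (D.dualMul x b) a := by
  rw [D.T₁_spec, pairing₂_mul_inclR_unitOn hs, pairing_dualMul]

lemma pairing₂_T₂ {d : DualSpace n} {s : Finset I} (hs : ∀ α, d α ≠ 0 → α ∈ s) (x : DualSpace n)
    (a : Alg n) :
    pairing₂ n (d ⊗ₜ x) (toMult n (D.T₂ (unitOn n s ⊗ₜ a))) = pairing n (D.dualMul x d) a := by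
  rw [D.T₂_spec, ← pairing₂_lmul, lmul_unitOn hs, pairing_dualMul]

/-- The product of `B` is associative, which is coassociativity of `Δ` paired with `B ⊗ B ⊗ B`. -/
lemma dualMul_assoc (x y z : DualSpace n) :
    D.dualMul (D.dualMul x y) z = D.dualMul x (D.dualMul y z) := by
  refine dual_ext fun a => ?_
  obtain ⟨s, hs⟩ := exists_support z
  obtain ⟨t, ht⟩ := exists_support x
  let f : (Alg n ⊗[ℂ] Alg n) ⊗[ℂ] Alg n →ₗ[ℂ] ℂ := LinearMap.mul' ℂ ℂ ∘ₗ TensorProduct.map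
    (pairing₂ n (z ⊗ₜ y) ∘ₗ toMult n) (pairing n x)
  let A := TensorProduct.assoc ℂ (Alg n) (Alg n) (Alg n)
  have hf : ∀ p, f ∘ₗ A.symm.toLinearMap ∘ₗ TensorProduct.mk ℂ (Alg n) (Alg n ⊗[ℂ] Alg n) p =
      pairing n z p • (pairing₂ n (y ⊗ₜ x) ∘ₗ toMult n) := fun p =>
    TensorProduct.ext' fun q r => by
      have h1 : f (A.symm (p ⊗ₜ (q ⊗ₜ r))) =
          pairing₂ n (z ⊗ₜ y) (toMult n (p ⊗ₜ q)) * pairing n x r := rfl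
      have h2 : pairing₂ n (y ⊗ₜ x) (toMult n (q ⊗ₜ r)) = pairing n y q * pairing n x r :=
        pairing₂_tmul_toMult _ _ _ _
      rw [pairing₂_tmul_toMult, mul_assoc, ← h2] at h1
      exact h1
  have h1 : f ∘ₗ D.T₂.toLinearMap.rTensor (Alg n) ∘ₗ A.symm.toLinearMap ∘ₗ
      TensorProduct.mk ℂ (Alg n) (Alg n ⊗[ℂ] Alg n) (unitOn n s) =
      pairing₂ n (D.dualMul y z ⊗ₜ x) ∘ₗ toMult n := TensorProduct.ext' fun q r => by
    have h2 : pairing₂ n (D.dualMul y z ⊗ₜ x) (toMult n (q ⊗ₜ r)) =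
        pairing n (D.dualMul y z) q * pairing n x r := pairing₂_tmul_toMult _ _ _ _
    rw [← D.pairing₂_T₂ hs] at h2
    exact h2.symm
  have h2 : f ∘ₗ A.symm.toLinearMap ∘ₗ D.T₁.toLinearMap.lTensor (Alg n) ∘ₗ A.toLinearMap ∘ₗ
      (TensorProduct.mk ℂ (Alg n ⊗[ℂ] Alg n) (Alg n)).flip (unitOn n t) =
      pairing₂ n (z ⊗ₜ D.dualMul x y) ∘ₗ toMult n := TensorProduct.ext' fun p q => by
    have h2 : pairing₂ n (z ⊗ₜ D.dualMul x y) (toMult n (p ⊗ₜ q)) =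
        pairing n z p * pairing n (D.dualMul x y) q := pairing₂_tmul_toMult _ _ _ _
    rw [← D.pairing₂_T₁ ht] at h2
    exact (LinearMap.congr_fun (hf p) (D.T₁ (q ⊗ₜ unitOn n t))).trans h2.symm
  have h3 := congrArg f (D.coassoc (unitOn n s) a (unitOn n t))
  have h4 := (LinearMap.congr_fun h1 (D.T₁ (a ⊗ₜ unitOn n t))).symm.trans
    (h3.trans (LinearMap.congr_fun h2 (D.T₂ (unitOn n s ⊗ₜ a))))
  rw [LinearMap.comp_apply, LinearMap.comp_apply, D.pairing₂_T₁ ht, D.pairing₂_T₂ hs] at h4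
  exact h4.symm

lemma exists_actL (b : DualSpace n) (a : Alg n) :
    ∃ a', ∀ x, pairing n x a' = pairing n (D.dualMul x b) a := by
  obtain ⟨s, hs⟩ := exists_support b
  exact ⟨_, fun x => by rw [D.pairing_slice_T₂ (unitOn n s) a b x, lmul_unitOn hs]⟩

/-- The left action of `B` on `A`, dual to right multiplication: `⟨b · a, x⟩ = ⟨a, xb⟩`, that is,
`b · a = (b ⊗ ι)Δ(a)`. -/
noncomputable def actL : DualSpace n →ₗ[ℂ] Alg n →ₗ[ℂ] Alg n :=
  LinearMap.mk₂ ℂ (fun b a => (D.exists_actL b a).choose)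
    (fun b b' a => alg_ext_pairing fun x => by
      rw [map_add, (D.exists_actL _ a).choose_spec, (D.exists_actL _ a).choose_spec,
        (D.exists_actL _ a).choose_spec, map_add, map_add, LinearMap.add_apply])
    (fun r b a => alg_ext_pairing fun x => by
      rw [map_smul, (D.exists_actL _ a).choose_spec, (D.exists_actL _ a).choose_spec,
        map_smul, map_smul, LinearMap.smul_apply])
    (fun b a a' => alg_ext_pairing fun x => by
      rw [map_add, (D.exists_actL _ _).choose_spec, (D.exists_actL _ _).choose_spec,
        (D.exists_actL _ _).choose_spec, map_add])
    (fun r b a => alg_ext_pairing fun x => by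
      rw [map_smul, (D.exists_actL _ _).choose_spec, (D.exists_actL _ _).choose_spec,
        map_smul])

lemma pairing_actL (b x : DualSpace n) (a : Alg n) :
    pairing n x (D.actL b a) = pairing n (D.dualMul x b) a := (D.exists_actL b a).choose_spec x

lemma slice_T₂ (c a : Alg n) (d : DualSpace n) :
    TensorProduct.lid ℂ (Alg n) ((pairing n d).rTensor (Alg n) (D.T₂ (c ⊗ₜ a))) =
      D.actL (lmul c d) a :=
  alg_ext_pairing fun x => by rw [pairing_slice_T₂, pairing_actL]

lemma actL_actL (b c : DualSpace n) (a : Alg n) :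
    D.actL b (D.actL c a) = D.actL (D.dualMul b c) a :=
  alg_ext_pairing fun x => by simp only [pairing_actL, dualMul_assoc]

/-- A given element `w` of `A ⊗ A` satisfies `(p ⊗ 1)w = w` for every large enough central
projection `p`. -/
lemma exists_rTensor_unitOn (w : Alg n ⊗[ℂ] Alg n) : ∃ s₀ : Finset I, ∀ s, s₀ ⊆ s →
    (LinearMap.mulLeft ℂ (unitOn n s)).rTensor (Alg n) w = w := by
  induction w with
  | zero => exact ⟨∅, fun s _ => by simp⟩
  | add x y hx hy =>
    obtain ⟨s, hs⟩ := hx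
    obtain ⟨t, ht⟩ := hy
    refine ⟨s ∪ t, fun r hr => ?_⟩
    rw [map_add, hs r (Finset.union_subset_left hr), ht r (Finset.union_subset_right hr)]
  | tmul x y =>
    refine ⟨x.2.toFinset, fun s hs => ?_⟩
    rw [LinearMap.rTensor_tmul]
    congr 1
    refine alg_ext fun α => ?_
    rw [LinearMap.mulLeft_apply, mul_comp, unitOn_apply]
    split_ifs with h
    · rw [one_mul]
    · rw [zero_mul]
      by_contra hc
      exact h (hs (x.2.mem_toFinset.2 fun h => hc h.symm))

lemma counitB_dualMul (b b' : DualSpace n) :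
    counitB (D.dualMul b b') = counitB b * counitB b' := by
  obtain ⟨t, ht⟩ := exists_support b
  obtain ⟨t', ht'⟩ := exists_support b'
  obtain ⟨r, hr⟩ := exists_support (D.dualMul b b')
  obtain ⟨s₀, hs₀⟩ := exists_rTensor_unitOn (D.T₁.symm (unitOn n t' ⊗ₜ unitOn n t))
  have h1 : pairing₂ n (b' ⊗ₜ b) (D.Δ (unitOn n (r ∪ s₀))) =
      pairing₂ n (b' ⊗ₜ b) (toMult n (unitOn n t' ⊗ₜ unitOn n t)) := by
    have h2 := D.comul_mul_toMult_T₁ (unitOn n (r ∪ s₀)) (D.T₁.symm (unitOn n t' ⊗ₜ unitOn n t))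
    rw [hs₀ _ Finset.subset_union_right, LinearEquiv.apply_symm_apply] at h2
    rw [← h2]
    refine pairing₂_congr fun α β hα hβ => ?_
    rw [Pi.mul_apply, toMult_tmul, Pi.mul_apply]
    simp only [inclL, inclR]
    rw [unitOn_apply, unitOn_apply, if_pos (ht' α hα), if_pos (ht β hβ),
      ← Algebra.TensorProduct.one_def, mul_one, mul_one]
  rw [counitB_eq_pairing (s := r ∪ s₀) fun α hα => Finset.mem_union_left _ (hr α hα),
    pairing_dualMul, h1, pairing₂_tmul_toMult, counitB_eq_pairing ht, counitB_eq_pairing ht',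
    mul_comm]

end DiscreteQuantumGroup

/-! ### Coproducts in the dual -/

/-- `Δ(f) = ∑ f₁ ⊗ f₂` in `B ⊗ B`, expressed through the pairing:
`⟨aa', f⟩ = ∑ ⟨a, f₁⟩⟨a', f₂⟩`. -/
def IsComul {ι : Type*} [Fintype ι] (f : DualSpace n) (f₁ f₂ : ι → DualSpace n) : Prop :=
  ∀ a a', pairing n f (a * a') = ∑ p, pairing n (f₁ p) a * pairing n (f₂ p) a'

lemma isComul_coeff (α : I) (i j : Fin (n α)) :
    IsComul (coeff n α i j) (fun k => coeff n α i k) (fun k => coeff n α k j) := fun a a' => by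
  simp only [pairing_coeff, mul_comp, Matrix.mul_apply]

lemma exists_support_family {ι : Type*} [Fintype ι] (f : ι → DualSpace n) :
    ∃ s : Finset I, ∀ i α, f i α ≠ 0 → α ∈ s := by
  choose s hs using fun i => exists_support (f i)
  exact ⟨Finset.univ.biUnion s, fun i α h =>
    Finset.mem_biUnion.2 ⟨i, Finset.mem_univ i, hs i α h⟩⟩

namespace DiscreteQuantumGroup

variable (D : DiscreteQuantumGroup n)

/-- The coproduct of `B` is multiplicative, because that of `A` is. -/
lemma isComul_dualMul {ι κ : Type*} [Fintype ι] [Fintype κ] {f g : DualSpace n}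
    {f₁ f₂ : ι → DualSpace n} {g₁ g₂ : κ → DualSpace n} (hf : IsComul f f₁ f₂)
    (hg : IsComul g g₁ g₂) : IsComul (D.dualMul f g)
      (fun p : ι × κ => D.dualMul (f₁ p.1) (g₁ p.2)) (fun p => D.dualMul (f₂ p.1) (g₂ p.2)) := by
  intro a a'
  have key : ∀ z z' : Alg n ⊗[ℂ] Alg n, pairing₂ n (g ⊗ₜ f) (toMult n z * toMult n z') =
      ∑ p : ι × κ, pairing₂ n (g₁ p.2 ⊗ₜ f₁ p.1) (toMult n z) *
        pairing₂ n (g₂ p.2 ⊗ₜ f₂ p.1) (toMult n z') := fun z z' => by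
    induction z with
    | zero => simp
    | add x y hx hy => simp only [map_add, add_mul, hx, hy, Finset.sum_add_distrib]
    | tmul x y =>
      induction z' with
      | zero => simp
      | add v w hv hw => simp only [map_add, mul_add, hv, hw, Finset.sum_add_distrib]
      | tmul v w =>
        have : toMult n (x ⊗ₜ y) * toMult n (v ⊗ₜ w) = toMult n ((x * v) ⊗ₜ (y * w)) := by
          rw [toMult_tmul, toMult_tmul, toMult_tmul, inclL_mul, inclR_mul, mul_assoc, mul_assoc,
            ← mul_assoc (inclR y), ← mul_assoc (inclL v), inclL_mul_inclR]
        rw [this]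
        simp only [pairing₂_tmul_toMult]
        rw [hf, hg, Finset.sum_mul_sum, Finset.sum_comm, ← Finset.sum_product',
          ← Finset.univ_product_univ, Finset.sum_product_right, Finset.sum_product_right]
        refine Finset.sum_congr rfl fun p _ => Finset.sum_congr rfl fun q _ => ?_
        ring
  obtain ⟨s, hs⟩ := exists_support_family (Sum.elim (fun _ : Unit => f) (Sum.elim f₁ f₂))
  obtain ⟨t, ht⟩ := exists_support_family (Sum.elim (fun _ : Unit => g) (Sum.elim g₁ g₂))
  obtain ⟨z, hz⟩ := exists_toMult_eq (s ∪ t) (D.Δ a)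
  obtain ⟨z', hz'⟩ := exists_toMult_eq (s ∪ t) (D.Δ a')
  simp only [pairing_dualMul, map_mul]
  refine Eq.trans (pairing₂_congr (m' := toMult n z * toMult n z') fun α β hα hβ => ?_)
    ((key z z').trans (Finset.sum_congr rfl fun p _ => congrArg₂ _
      (pairing₂_congr fun α β hα hβ => ?_) (pairing₂_congr fun α β hα hβ => ?_)))
  · have h1 := Finset.mem_union_right s (ht (Sum.inl ()) α hα)
    have h2 := Finset.mem_union_left t (hs (Sum.inl ()) β hβ)
    rw [Pi.mul_apply, Pi.mul_apply, hz α h1 β h2, hz' α h1 β h2]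
  · exact hz α (Finset.mem_union_right s (ht (Sum.inr (Sum.inl p.2)) α hα)) β
      (Finset.mem_union_left t (hs (Sum.inr (Sum.inl p.1)) β hβ))
  · exact hz' α (Finset.mem_union_right s (ht (Sum.inr (Sum.inr p.2)) α hα)) β
      (Finset.mem_union_left t (hs (Sum.inr (Sum.inr p.1)) β hβ))

/-! ### The cointegral and the unit of the dual -/

/-- The counit is a character of `A`, so it lives on a single component, which is one-dimensional
because matrix algebras are simple. The unit of this component is the cointegral. -/
lemma exists_isCointegral_of_ne_zero (hε : D.ε ≠ 0) : ∃ h, D.IsCointegral h := by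
  obtain ⟨α, x, hx⟩ : ∃ α x, D.ε (incl n α x) ≠ 0 := by
    by_contra hc
    push Not at hc
    exact hε (functional_ext fun γ x => by rw [hc]; rfl)
  have h1 : D.ε (incl n α 1) = 1 := by
    have := D.counit_mul (incl n α 1) (incl n α x)
    rw [← incl_mul, one_mul] at this
    exact mul_right_cancel₀ hx (by rw [one_mul, ← this])
  let χ : Mat n α →+* ℂ :=
    { toFun := fun x => D.ε (incl n α x)
      map_one' := h1
      map_mul' := fun x y => by rw [incl_mul, counit_mul]
      map_zero' := by simp
      map_add' := fun x y => by simp }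
  have : Nonempty (Fin (n α)) := by
    by_contra hc
    rw [not_nonempty_iff] at hc
    exact hx (by rw [Subsingleton.elim x 0, map_zero, map_zero])
  have hχ : Function.Injective χ := χ.injective
  refine ⟨incl n α 1, fun h => ?_, ?_, ?_, fun a => ?_⟩
  · rw [h, map_zero] at h1; exact zero_ne_one h1
  · rw [star_incl, star_one]
  · rw [← incl_mul, one_mul]
  · rw [mul_incl_one, ← map_smul]
    congr 1
    refine hχ ?_
    change D.ε (incl n α (a.1 α)) = D.ε (incl n α (D.ε a • 1))
    rw [map_smul, map_smul, h1, ← mul_incl_one, counit_mul, h1, mul_one, smul_eq_mul, mul_one]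

lemma exists_isCointegral [Nonempty I] [∀ α, NeZero (n α)] : ∃ h, D.IsCointegral h := by
  refine D.exists_isCointegral_of_ne_zero fun h => ?_
  have := D.subsingleton_of_counit h
  obtain ⟨α⟩ := ‹Nonempty I›
  have h1 := incl_eq_zero (Subsingleton.elim (incl n α 1) 0)
  have h2 := congrFun (congrFun h1 0) 0
  simp at h2

lemma IsCointegral.counit_eq_one {D : DiscreteQuantumGroup n} {h : Alg n} (hh : D.IsCointegral h) :
    D.ε h = 1 := by
  have h1 := hh.mul_eq h
  rw [hh.mul_self] at h1
  exact (smul_left_injective ℂ hh.ne_zero ((one_smul ℂ h).trans h1)).symm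

lemma IsCointegral.eq_mul {D : DiscreteQuantumGroup n} {h : Alg n} (hh : D.IsCointegral h)
    (a : Alg n) : h * a = D.ε a • h := by
  have h1 := congrArg star (hh.mul_eq (star a))
  rw [star_mul, star_star, hh.star_eq, star_smul, hh.star_eq, counit_star, star_star] at h1
  exact h1

lemma IsCointegral.unique {D : DiscreteQuantumGroup n} {h k : Alg n} (hh : D.IsCointegral h)
    (hk : D.IsCointegral k) : k = h := by
  have h1 := hh.mul_eq k
  rw [hk.eq_mul, hh.counit_eq_one, hk.counit_eq_one, one_smul, one_smul] at h1
  exact h1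

lemma finite_counit : {γ | D.ε ∘ₗ incl n γ ≠ 0}.Finite := by
  by_cases hε : D.ε = 0
  · simp [hε]
  obtain ⟨h, hh⟩ := D.exists_isCointegral_of_ne_zero hε
  refine finite_of_mul _ h fun a _ ha => ?_
  rw [hh.mul_eq] at ha
  exact (smul_eq_zero.1 ha).resolve_right hh.ne_zero

/-- The unit of `B`, which is the counit of `A`. It belongs to the reduced dual because the counit
lives on a single component. -/
noncomputable def dualOne : DualSpace n := reduced D.ε D.finite_counit

lemma pairing_dualOne (a : Alg n) : pairing n D.dualOne a = D.ε a :=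
  LinearMap.congr_fun (pairing_reduced D.ε D.finite_counit) a

lemma dualOne_mul (b : DualSpace n) : D.dualMul D.dualOne b = b := by
  refine dual_ext fun a => ?_
  obtain ⟨s, hs⟩ := exists_support b
  have h1 : pairing n D.dualOne = D.ε := pairing_reduced D.ε D.finite_counit
  rw [← D.pairing₂_T₂ hs, pairing₂_toMult_right, h1, D.isCounit.right, ← pairing_lmul,
    lmul_unitOn hs]

lemma mul_dualOne (b : DualSpace n) : D.dualMul b D.dualOne = b := by
  refine dual_ext fun a => ?_
  obtain ⟨s, hs⟩ := exists_support b
  have h1 : pairing n D.dualOne = D.ε := pairing_reduced D.ε D.finite_counit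
  rw [← D.pairing₂_T₁ hs, pairing₂_toMult_left, h1, D.isCounit.left, ← pairing_rmul,
    rmul_unitOn hs]

/-! ### The antipode of the dual -/

lemma finite_comp_antipode (b : DualSpace n) :
    {γ | (pairing n b ∘ₗ D.S) ∘ₗ incl n γ ≠ 0}.Finite := by
  obtain ⟨s, hs⟩ := exists_support b
  obtain ⟨w, hw⟩ := D.antipode_bijective.2 (unitOn n s)
  refine finite_of_mul _ w fun a _ ha => ?_
  have h1 : unitOn n s * D.S a = 0 := by rw [← hw, ← antipode_mul, ha, map_zero]
  rw [LinearMap.comp_apply, ← lmul_unitOn hs, pairing_lmul, h1, map_zero]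

/-- The functional `b ∘ S`. Since the product of `B` is opposite to the dual of `Δ`, this is the
inverse of the antipode of `B` applied to `b`. -/
noncomputable def coAntipode : DualSpace n →ₗ[ℂ] DualSpace n where
  toFun b := reduced (pairing n b ∘ₗ D.S) (D.finite_comp_antipode b)
  map_add' b c := pairing_injective (by simp only [map_add, pairing_reduced, LinearMap.add_comp])
  map_smul' r b := pairing_injective (by
    simp only [map_smul, pairing_reduced, LinearMap.smul_comp, RingHom.id_apply])

lemma pairing_coAntipode (b : DualSpace n) (a : Alg n) :
    pairing n (D.coAntipode b) a = pairing n b (D.S a) :=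
  LinearMap.congr_fun (pairing_reduced (pairing n b ∘ₗ D.S) (D.finite_comp_antipode b)) a

lemma sum_mul_coAntipode {ι : Type*} [Fintype ι] {f : DualSpace n} {f₁ f₂ : ι → DualSpace n}
    (hf : IsComul f f₁ f₂) :
    ∑ p, D.dualMul (f₂ p) (D.coAntipode (f₁ p)) = counitB f • D.dualOne := by
  refine dual_ext fun a => ?_
  obtain ⟨s, hs⟩ := exists_support_family (Sum.elim (fun _ : Unit => f) f₂)
  have hs₀ : ∀ α, f α ≠ 0 → α ∈ s := hs (Sum.inl ())
  have hs₁ : ∀ p α, f₂ p α ≠ 0 → α ∈ s := fun p => hs (Sum.inr p)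
  have key : ∀ w : Alg n ⊗[ℂ] Alg n, ∑ p, pairing₂ n (D.coAntipode (f₁ p) ⊗ₜ f₂ p) (toMult n w) =
      pairing n f (LinearMap.mul' ℂ (Alg n) (D.S.rTensor (Alg n) w)) := fun w => by
    induction w with
    | zero => simp
    | add x y hx hy => simp only [map_add, Finset.sum_add_distrib, hx, hy]
    | tmul x y =>
      rw [LinearMap.rTensor_tmul, LinearMap.mul'_apply, hf]
      simp only [pairing₂_tmul_toMult, pairing_coAntipode]
  simp only [map_sum, LinearMap.sum_apply]
  rw [Finset.sum_congr rfl fun p _ => (D.pairing₂_T₁ (hs₁ p) _ a).symm, key,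
    D.isAntipode.left, map_smul, map_smul, LinearMap.smul_apply, pairing_dualOne,
    counitB_eq_pairing hs₀, smul_eq_mul, smul_eq_mul, mul_comm]

lemma sum_coAntipode_mul {ι : Type*} [Fintype ι] {f : DualSpace n} {f₁ f₂ : ι → DualSpace n}
    (hf : IsComul f f₁ f₂) :
    ∑ p, D.dualMul (D.coAntipode (f₂ p)) (f₁ p) = counitB f • D.dualOne := by
  refine dual_ext fun a => ?_
  obtain ⟨s, hs⟩ := exists_support_family (Sum.elim (fun _ : Unit => f) f₁)
  have hs₀ : ∀ α, f α ≠ 0 → α ∈ s := hs (Sum.inl ())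
  have hs₁ : ∀ p α, f₁ p α ≠ 0 → α ∈ s := fun p => hs (Sum.inr p)
  have key : ∀ w : Alg n ⊗[ℂ] Alg n, ∑ p, pairing₂ n (f₁ p ⊗ₜ D.coAntipode (f₂ p)) (toMult n w) =
      pairing n f (LinearMap.mul' ℂ (Alg n) (D.S.lTensor (Alg n) w)) := fun w => by
    induction w with
    | zero => simp
    | add x y hx hy => simp only [map_add, Finset.sum_add_distrib, hx, hy]
    | tmul x y =>
      rw [LinearMap.lTensor_tmul, LinearMap.mul'_apply, hf]
      simp only [pairing₂_tmul_toMult, pairing_coAntipode]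
  simp only [map_sum, LinearMap.sum_apply]
  rw [Finset.sum_congr rfl fun p _ => (D.pairing₂_T₂ (hs₁ p) _ a).symm, key,
    D.isAntipode.right, map_smul, map_smul, LinearMap.smul_apply, pairing_dualOne,
    counitB_eq_pairing hs₀, smul_eq_mul, smul_eq_mul, mul_comm]

lemma sum_coeff_mul_coAntipode (α : I) (i j : Fin (n α)) :
    ∑ k, D.dualMul (coeff n α k j) (D.coAntipode (coeff n α i k)) =
      if i = j then D.dualOne else 0 := by
  rw [D.sum_mul_coAntipode (isComul_coeff α i j), counitB_coeff, ite_smul, one_smul, zero_smul]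

lemma sum_coAntipode_mul_coeff (α : I) (i j : Fin (n α)) :
    ∑ k, D.dualMul (D.coAntipode (coeff n α k j)) (coeff n α i k) =
      if i = j then D.dualOne else 0 := by
  rw [D.sum_coAntipode_mul (isComul_coeff α i j), counitB_coeff, ite_smul, one_smul, zero_smul]

/-- `b ↦ b ∘ S` is anti-multiplicative: for matrix coefficients `u`, `v` both sides give the inverse
of the matrix with entries `u_{ij}v_{kl}` over the opposite algebra of `B`. -/
lemma coAntipode_dualMul (x y : DualSpace n) :
    D.coAntipode (D.dualMul x y) = D.dualMul (D.coAntipode y) (D.coAntipode x) := by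
  suffices h : D.dualMul.compr₂ D.coAntipode =
      (D.dualMul.compl₁₂ D.coAntipode D.coAntipode).flip from
    LinearMap.congr_fun₂ h x y
  refine dual_hom_ext fun α i m => dual_hom_ext fun β k l => ?_
  let T := fun p q => D.coAntipode (D.dualMul (coeff n α i p) (coeff n β k q))
  have h1 : ∀ j r, ∑ p, ∑ q, D.dualMul (D.dualMul (coeff n α p j) (coeff n β q r)) (T p q) =
      if i = j then (if k = r then D.dualOne else 0) else 0 := fun j r => by
    have := D.sum_mul_coAntipode (D.isComul_dualMul (isComul_coeff α i j) (isComul_coeff β k r))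
    rw [counitB_dualMul, counitB_coeff, counitB_coeff, Fintype.sum_prod_type] at this
    rw [this]
    split_ifs <;> simp
  have h2 : ∀ p q, ∑ j, ∑ r, D.dualMul (D.dualMul (D.coAntipode (coeff n β r l))
      (D.coAntipode (coeff n α j m)))
        (D.dualMul (D.dualMul (coeff n α p j) (coeff n β q r)) (T p q)) =
      if p = m then (if q = l then T p q else 0) else 0 := fun p q => by
    have h3 : ∀ r, ∑ j, D.dualMul (D.dualMul (D.coAntipode (coeff n β r l))
        (D.coAntipode (coeff n α j m)))
          (D.dualMul (D.dualMul (coeff n α p j) (coeff n β q r)) (T p q)) =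
        D.dualMul (D.coAntipode (coeff n β r l)) (D.dualMul (if p = m then D.dualOne else 0)
          (D.dualMul (coeff n β q r) (T p q))) := fun r => by
      rw [← sum_coAntipode_mul_coeff, map_sum, LinearMap.sum_apply, map_sum]
      refine Finset.sum_congr rfl fun j _ => ?_
      simp only [dualMul_assoc]
    rw [Finset.sum_comm, Finset.sum_congr rfl fun r _ => h3 r]
    by_cases hp : p = m
    · simp only [if_pos hp, dualOne_mul]
      have h4 := congrArg (fun b => D.dualMul b (T p q)) (D.sum_coAntipode_mul_coeff β q l)
      simp only [map_sum, LinearMap.sum_apply, dualMul_assoc] at h4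
      rw [h4]
      split_ifs
      · rw [dualOne_mul]
      · simp
    · simp [hp]
  have h5 : ∑ j, ∑ r, D.dualMul (D.dualMul (D.coAntipode (coeff n β r l))
      (D.coAntipode (coeff n α j m)))
      (∑ p, ∑ q, D.dualMul (D.dualMul (coeff n α p j) (coeff n β q r)) (T p q)) = T m l := by
    simp only [map_sum]
    have : ∀ F : Fin (n α) → Fin (n β) → Fin (n α) → Fin (n β) → DualSpace n,
        ∑ j, ∑ r, ∑ p, ∑ q, F j r p q = ∑ p, ∑ q, ∑ j, ∑ r, F j r p q := fun F => by
      refine (Finset.sum_congr rfl fun j _ => Finset.sum_comm.trans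
        (Finset.sum_congr rfl fun p _ => Finset.sum_comm)).trans ?_
      exact Finset.sum_comm.trans (Finset.sum_congr rfl fun p _ => Finset.sum_comm)
    rw [this]
    simp only [h2]
    simp
  simp only [h1] at h5
  change T m l = _
  rw [← h5, Finset.sum_eq_single_of_mem i (Finset.mem_univ i) fun j _ hj => by simp [hj.symm],
    Finset.sum_eq_single_of_mem k (Finset.mem_univ k) fun r _ hr => by simp [hr.symm]]
  simp [mul_dualOne]

/-! ### The involution of the dual -/

/-- The functional `a ↦ ⟨a^*, b⟩⁻`. -/
noncomputable def dualBar : DualSpace n →ₗ⋆[ℂ] DualSpace n := D.coAntipode ∘ₛₗ D.dualStar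

lemma pairing_dualBar (b : DualSpace n) (a : Alg n) :
    pairing n (D.dualBar b) a = star (pairing n b (star a)) := by
  have h1 := D.antipode_star_antipode_star (star a)
  rw [star_star] at h1
  change pairing n (D.coAntipode (D.dualStar b)) a = _
  rw [pairing_coAntipode, pairing_dualStar, h1]

lemma dualStar_eq (b : DualSpace n) : D.dualStar b = D.dualBar (D.coAntipode b) :=
  dual_ext fun a => by rw [pairing_dualStar, pairing_dualBar, pairing_coAntipode]

lemma counitB_dualBar (b : DualSpace n) : counitB (D.dualBar b) = star (counitB b) := by
  obtain ⟨s, hs⟩ := exists_support_family ![b, D.dualBar b]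
  have hs₀ : ∀ α, b α ≠ 0 → α ∈ s := hs 0
  have hs₁ : ∀ α, D.dualBar b α ≠ 0 → α ∈ s := hs 1
  rw [counitB_eq_pairing hs₀, counitB_eq_pairing hs₁, pairing_dualBar]
  congr 2
  refine alg_ext fun α => ?_
  rw [star_comp, unitOn_apply]
  split_ifs <;> simp

lemma pairing₂_dualBar (b b' : DualSpace n) (m : MultAA n) :
    pairing₂ n (D.dualBar b ⊗ₜ D.dualBar b') m = star (pairing₂ n (b ⊗ₜ b') (star m)) := by
  obtain ⟨s, hs⟩ := exists_support_family ![b, b', D.dualBar b, D.dualBar b']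
  have hs₀ : ∀ α, b α ≠ 0 → α ∈ s := hs 0
  have hs₁ : ∀ α, b' α ≠ 0 → α ∈ s := hs 1
  have hs₂ : ∀ α, D.dualBar b α ≠ 0 → α ∈ s := hs 2
  have hs₃ : ∀ α, D.dualBar b' α ≠ 0 → α ∈ s := hs 3
  obtain ⟨z, hz⟩ := exists_toMult_eq s m
  rw [pairing₂_congr (m' := toMult n z) fun α β hα hβ => (hz α (hs₂ α hα) β (hs₃ β hβ)).symm,
    pairing₂_congr (b := b) (m' := star (toMult n z)) fun α β hα hβ => by
      rw [Pi.star_apply, Pi.star_apply, hz α (hs₀ α hα) β (hs₁ β hβ)], ← toMult_star]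
  clear hz
  induction z with
  | zero => simp
  | add x y hx hy => rw [map_add, map_add, hx, hy, star_add, map_add, map_add, star_add]
  | tmul x y =>
    rw [TensorProduct.star_tmul, pairing₂_tmul_toMult, pairing₂_tmul_toMult, pairing_dualBar,
      pairing_dualBar, star_mul']

lemma dualBar_dualMul (x y : DualSpace n) :
    D.dualBar (D.dualMul x y) = D.dualMul (D.dualBar x) (D.dualBar y) :=
  dual_ext fun a => by
    rw [pairing_dualBar, pairing_dualMul, pairing_dualMul, pairing₂_dualBar, map_star]

lemma dualStar_dualMul (x y : DualSpace n) :
    D.dualStar (D.dualMul x y) = D.dualMul (D.dualStar y) (D.dualStar x) := by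
  rw [dualStar_eq, coAntipode_dualMul, dualBar_dualMul, dualStar_eq, dualStar_eq]

lemma dualStar_dualStar (b : DualSpace n) : D.dualStar (D.dualStar b) = b :=
  dual_ext fun a => by
    rw [pairing_dualStar, pairing_dualStar, star_star, antipode_star_antipode_star]

lemma dualStar_dualOne : D.dualStar D.dualOne = D.dualOne := by
  have h1 := D.dualStar_dualMul (D.dualStar D.dualOne) D.dualOne
  rw [mul_dualOne, dualStar_dualStar, mul_dualOne] at h1
  exact h1.symm

lemma isComul_dualStar {ι : Type*} [Fintype ι] {f : DualSpace n} {f₁ f₂ : ι → DualSpace n}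
    (hf : IsComul f f₁ f₂) :
    IsComul (D.dualStar f) (fun p => D.dualStar (f₁ p)) (fun p => D.dualStar (f₂ p)) :=
  fun a a' => by
    simp only [pairing_dualStar, star_mul, antipode_mul]
    rw [hf, star_sum]
    exact Finset.sum_congr rfl fun p _ => star_mul' _ _

/-- The matrix `u` of coefficients of a component satisfies `u^*u = 1`. -/
lemma sum_star_coeff_mul_coeff (α : I) (i j : Fin (n α)) :
    ∑ k, D.dualMul (D.dualStar (coeff n α k i)) (coeff n α k j) =
      if i = j then D.dualOne else 0 := by
  have h1 : ∀ k l, D.dualStar (coeff n α k l) = D.dualBar (D.coAntipode (coeff n α k l)) :=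
    fun k l => D.dualStar_eq _
  have h2 : ∀ k l, D.dualBar (coeff n α k l) = coeff n α l k := fun k l =>
    dual_ext fun a => by
      rw [pairing_dualBar, pairing_coeff, pairing_coeff, star_comp, Matrix.star_apply, star_star]
  have h3 := congrArg D.dualBar (D.sum_coAntipode_mul_coeff α j i)
  simp only [map_sum, dualBar_dualMul, ← h1, h2] at h3
  rw [h3, apply_ite D.dualBar, map_zero]
  have h4 : D.dualBar D.dualOne = D.dualOne := dual_ext fun a => by
    rw [pairing_dualBar, pairing_dualOne, pairing_dualOne, counit_star, star_star]
  simp only [h4, eq_comm]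

end DiscreteQuantumGroup

namespace DiscreteQuantumGroup

variable {D : DiscreteQuantumGroup n} {h : Alg n}

/-! ### The inverse Fourier transform -/

/-- Left invariance of `φ_B = ⟨h, ·⟩`: `(ι ⊗ φ_B)Δ(f) = φ_B(f)1`. -/
lemma IsCointegral.sum_pairing_smul (hh : D.IsCointegral h) {ι : Type*} [Fintype ι]
    {f : DualSpace n} {f₁ f₂ : ι → DualSpace n} (hf : IsComul f f₁ f₂) :
    ∑ p, pairing n (f₂ p) h • f₁ p = pairing n f h • D.dualOne := by
  refine dual_ext fun a => ?_
  have h1 := hf a h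
  rw [hh.mul_eq, map_smul, smul_eq_mul] at h1
  rw [map_smul, LinearMap.smul_apply, pairing_dualOne, smul_eq_mul, mul_comm, h1]
  simp only [map_sum, map_smul, LinearMap.sum_apply, LinearMap.smul_apply, smul_eq_mul]
  exact Finset.sum_congr rfl fun p _ => mul_comm _ _

/-- Strong left invariance of `φ_B`:
`∑ c₍₁₎ φ_B(c₍₂₎b) = ∑ φ_B(c b₍₂₎) b₍₁₎ ∘ S` for matrix coefficients `c` and `b`. -/
lemma IsCointegral.strong_invariance (hh : D.IsCointegral h) (α β : I) (i j : Fin (n α))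
    (k l : Fin (n β)) :
    ∑ p, pairing n (D.dualMul (coeff n α p j) (coeff n β k l)) h • coeff n α i p =
      ∑ q, pairing n (D.dualMul (coeff n α i j) (coeff n β q l)) h •
        D.coAntipode (coeff n β k q) := by
  have h1 : ∀ q, pairing n (D.dualMul (coeff n α i j) (coeff n β q l)) h •
      D.coAntipode (coeff n β k q) =
      ∑ p, ∑ r, pairing n (D.dualMul (coeff n α p j) (coeff n β r l)) h •
        D.dualMul (coeff n α i p) (D.dualMul (coeff n β q r) (D.coAntipode (coeff n β k q))) :=
    fun q => by
      have h2 := congrArg (fun b => D.dualMul b (D.coAntipode (coeff n β k q)))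
        (hh.sum_pairing_smul (D.isComul_dualMul (isComul_coeff α i j) (isComul_coeff β q l)))
      simp only [map_sum, map_smul, LinearMap.sum_apply, LinearMap.smul_apply, dualOne_mul] at h2
      rw [← h2, Fintype.sum_prod_type]
      simp only [dualMul_assoc]
  rw [Finset.sum_congr rfl fun q _ => h1 q, Finset.sum_comm]
  refine Finset.sum_congr rfl fun p _ => ?_
  rw [Finset.sum_comm]
  simp only [← Finset.smul_sum, ← map_sum, sum_coeff_mul_coAntipode]
  rw [Finset.sum_eq_single_of_mem k (Finset.mem_univ k) fun r _ hr => by simp [hr.symm]]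
  simp [mul_dualOne]

variable (D h) in
/-- The map `b ↦ (b ⊗ ι)Δ(h)` from `B` to `A`, that is, `⟨G(b), c⟩ = φ_B(cb)`. It turns out to be
the inverse of the Fourier transform. -/
noncomputable def invFourier : DualSpace n →ₗ[ℂ] Alg n := D.actL.flip h

lemma pairing_invFourier (b x : DualSpace n) :
    pairing n x (D.invFourier h b) = pairing n (D.dualMul x b) h := pairing_actL D b x h

/-- `(1 ⊗ a)Δ(h) = (S(a) ⊗ 1)Δ(h)`. -/
lemma IsCointegral.mul_invFourier (hh : D.IsCointegral h) (a : Alg n) (b : DualSpace n) :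
    a * D.invFourier h b = D.invFourier h (lmul (D.S a) b) := by
  suffices key : LinearMap.mulLeft ℂ a ∘ₗ D.invFourier h = D.invFourier h ∘ₗ lmul (D.S a) from
    LinearMap.congr_fun key b
  refine dual_hom_ext fun β k l => alg_ext fun α => Matrix.ext fun i j => ?_
  rw [← pairing_coeff, ← pairing_coeff, LinearMap.comp_apply, LinearMap.comp_apply,
    LinearMap.mulLeft_apply, isComul_coeff, pairing_invFourier, lmul_coeff]
  have h1 := congrArg (fun b => pairing n b a) (hh.strong_invariance α β i j k l)
  simp only [map_sum, map_smul, LinearMap.sum_apply, LinearMap.smul_apply, smul_eq_mul,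
    pairing_coAntipode, pairing_invFourier] at h1 ⊢
  simp only [pairing_coeff, mul_comm] at h1 ⊢
  exact h1

lemma IsCointegral.star_invFourier (hh : D.IsCointegral h) (b : DualSpace n) :
    star (D.invFourier h b) = D.invFourier h (D.dualBar b) := by
  refine alg_ext_pairing fun x => ?_
  have h1 := D.pairing_dualBar x (D.invFourier h b)
  have h2 : ∀ y z, pairing n y (D.invFourier h z) =
      star (pairing n (D.dualBar y) (D.invFourier h (D.dualBar z))) := fun y z => by
    rw [pairing_invFourier, pairing_invFourier, ← dualBar_dualMul, pairing_dualBar, star_star,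
      hh.star_eq]
  have h3 := h2 (D.dualBar x) b
  have h4 : D.dualBar (D.dualBar x) = x := dual_ext fun a => by
    rw [pairing_dualBar, pairing_dualBar, star_star, star_star]
  rw [h4, h1] at h3
  exact star_injective h3

lemma antipode_star (a : Alg n) : D.S (star a) = star (D.antipodeEquiv.symm a) := by
  have h1 := D.antipode_star_antipode_star a
  have h2 : D.antipodeEquiv.symm a = star (D.S (star a)) := by
    rw [LinearEquiv.symm_apply_eq]; exact h1.symm
  rw [h2, star_star]

/-- `Δ(h)(1 ⊗ a) = Δ(h)(S⁻¹(a) ⊗ 1)`. -/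
lemma IsCointegral.invFourier_mul (hh : D.IsCointegral h) (a : Alg n) (b : DualSpace n) :
    D.invFourier h b * a = D.invFourier h (rmul (D.antipodeEquiv.symm a) b) := by
  rw [← star_star (D.invFourier h b * a), star_mul, hh.star_invFourier, hh.mul_invFourier,
    hh.star_invFourier]
  refine congrArg (D.invFourier h) (dual_ext fun x => ?_)
  rw [pairing_dualBar, pairing_lmul, pairing_dualBar, pairing_rmul, antipode_star, star_mul,
    star_star, star_star, star_star]

/-- The integral `φ_B` does not vanish on some product `u^* u` of matrix coefficients. -/
lemma IsCointegral.exists_pairing_ne_zero (hh : D.IsCointegral h) (α : I) (i : Fin (n α)) :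
    ∃ k, pairing n (D.dualMul (D.dualStar (coeff n α k i)) (coeff n α k i)) h ≠ 0 := by
  by_contra hc
  push Not at hc
  have h1 := congrArg (fun b => pairing n b h) (D.sum_star_coeff_mul_coeff α i i)
  simp only [map_sum, LinearMap.sum_apply, hc, if_pos, pairing_dualOne, hh.counit_eq_one,
    Finset.sum_const_zero] at h1
  exact zero_ne_one h1

lemma incl_single_mul_mul (α : I) (a : Alg n) (k i j l : Fin (n α)) :
    incl n α (Matrix.single k i 1) * a * incl n α (Matrix.single j l 1) =
      a.1 α i j • incl n α (Matrix.single k l 1) := by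
  have h1 : incl n α (Matrix.single k i 1) * a = incl n α (Matrix.single k i 1 * a.1 α) := by
    rw [incl_mul, ← incl_one_mul, ← mul_assoc, ← incl_mul, mul_one]
  rw [h1, ← incl_mul, ← map_smul]
  congr 1
  rw [Matrix.single_mul_mul_single]
  simp [Matrix.smul_single]

lemma IsCointegral.invFourier_injective (hh : D.IsCointegral h) :
    Function.Injective (D.invFourier h) := by
  refine (injective_iff_map_eq_zero _).2 fun b hb => ?_
  by_contra hne
  obtain ⟨α, k, l, hkl⟩ : ∃ α k l, pairing n b (incl n α (Matrix.single k l 1)) ≠ 0 := by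
    by_contra hc
    push Not at hc
    refine hne (pairing_injective (functional_ext fun γ x => ?_))
    rw [Matrix.matrix_eq_sum_single x]
    simp only [map_sum]
    refine Finset.sum_congr rfl fun i _ => Finset.sum_congr rfl fun j _ => ?_
    rw [← mul_one (x i j), ← smul_eq_mul (x i j), ← Matrix.smul_single, map_smul, map_smul, hc]
    simp
  -- the kernel is stable under `b ↦ b(x · y)`, so it contains all coefficients of the component `α`
  have h1 : ∀ i j, D.invFourier h (coeff n α i j) = 0 := fun i j => by
    have h2 : lmul (incl n α (Matrix.single k i 1)) (rmul (incl n α (Matrix.single j l 1)) b) =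
        pairing n b (incl n α (Matrix.single k l 1)) • coeff n α i j := dual_ext fun a => by
      rw [pairing_lmul, pairing_rmul, incl_single_mul_mul, map_smul, map_smul,
        LinearMap.smul_apply, pairing_coeff, smul_eq_mul, smul_eq_mul, mul_comm]
    obtain ⟨x, hx⟩ := D.antipode_bijective.2 (incl n α (Matrix.single k i 1))
    have h3 : D.antipodeEquiv.symm (D.S (incl n α (Matrix.single j l 1))) =
        incl n α (Matrix.single j l 1) := D.antipodeEquiv.symm_apply_apply _
    have h4 : D.invFourier h (lmul (incl n α (Matrix.single k i 1))
        (rmul (incl n α (Matrix.single j l 1)) b)) = 0 := by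
      rw [← hx, ← hh.mul_invFourier, ← h3, ← hh.invFourier_mul, hb, zero_mul, mul_zero]
    rw [h2, map_smul] at h4
    exact (smul_eq_zero.1 h4).resolve_left hkl
  obtain ⟨p, hp⟩ := hh.exists_pairing_ne_zero α l
  exact hp (by rw [← pairing_invFourier, h1, map_zero])

lemma IsCointegral.invFourier_surjective (hh : D.IsCointegral h) :
    Function.Surjective (D.invFourier h) := by
  rw [← LinearMap.range_eq_top, eq_top_iff]
  intro a _
  rw [← sum_incl a a.2.toFinset fun α hα => a.2.mem_toFinset.2 hα]
  refine Submodule.sum_mem _ fun α _ => ?_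
  rw [Matrix.matrix_eq_sum_single (a.1 α)]
  simp only [map_sum]
  refine Submodule.sum_mem _ fun k _ => Submodule.sum_mem _ fun l _ => ?_
  rw [← mul_one (a.1 α k l), ← smul_eq_mul (a.1 α k l), ← Matrix.smul_single, map_smul]
  refine Submodule.smul_mem _ _ ?_
  -- the image is a two-sided ideal that has a non-zero entry in the component `α`
  obtain ⟨i, j, b, hij⟩ : ∃ i j b, (D.invFourier h b).1 α i j ≠ 0 := by
    by_contra hc
    push Not at hc
    have h1 := congrArg (fun b => pairing n b h) (D.sum_coeff_mul_coAntipode α k k)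
    simp only [map_sum, LinearMap.sum_apply, if_pos, pairing_dualOne, hh.counit_eq_one,
      ← pairing_invFourier, pairing_coeff, hc, Finset.sum_const_zero] at h1
    exact zero_ne_one h1
  have h2 : incl n α (Matrix.single k l 1) = ((D.invFourier h b).1 α i j)⁻¹ •
      (incl n α (Matrix.single k i 1) * D.invFourier h b * incl n α (Matrix.single j l 1)) := by
    rw [incl_single_mul_mul, smul_smul, inv_mul_cancel₀ hij, one_smul]
  rw [h2, hh.mul_invFourier, hh.invFourier_mul]
  exact Submodule.smul_mem _ _ (LinearMap.mem_range_self _ _)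

/-! ### The left integral on `A` -/

/-- Left invariance in terms of the action of `B` on `A`: `φ((b ⊗ ι)Δ(a)) = ⟨1, b⟩φ(a)`. -/
lemma isLeftInvariant_iff {φ : Alg n →ₗ[ℂ] ℂ} :
    D.IsLeftInvariant φ ↔ ∀ b a, φ (D.actL b a) = counitB b * φ a := by
  have key : ∀ (d : DualSpace n) (w : Alg n ⊗[ℂ] Alg n),
      pairing n d (TensorProduct.rid ℂ (Alg n) (φ.lTensor (Alg n) w)) =
        φ (TensorProduct.lid ℂ (Alg n) ((pairing n d).rTensor (Alg n) w)) := fun d w => by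
    induction w with
    | zero => simp
    | add x y hx hy => simp only [map_add, hx, hy]
    | tmul x y => simp [mul_comm]
  refine ⟨fun hφ b a => ?_, fun hφ c a => alg_ext_pairing fun d => ?_⟩
  · obtain ⟨s, hs⟩ := exists_support b
    have h1 := congrArg (pairing n b) (hφ (unitOn n s) a)
    rw [key, slice_T₂, lmul_unitOn hs, map_smul, smul_eq_mul, ← counitB_eq_pairing hs] at h1
    rw [h1, mul_comm]
  · rw [key, slice_T₂, hφ, counitB_lmul, map_smul, smul_eq_mul, mul_comm]

lemma IsLeftInvariant.invFourier {φ : Alg n →ₗ[ℂ] ℂ} (hφ : D.IsLeftInvariant φ) (hφh : φ h = 1)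
    (b : DualSpace n) : φ (D.invFourier h b) = counitB b := by
  have h1 := isLeftInvariant_iff.1 hφ b h
  rw [hφh, mul_one] at h1
  exact h1

lemma IsCointegral.existsUnique_leftInvariant (hh : D.IsCointegral h) :
    ∃! φ : Alg n →ₗ[ℂ] ℂ, D.IsLeftInvariant φ ∧ φ h = 1 := by
  let G := LinearEquiv.ofBijective (D.invFourier h)
    ⟨hh.invFourier_injective, hh.invFourier_surjective⟩
  have hG : ∀ b, G.symm (D.invFourier h b) = b := fun b => G.symm_apply_apply b
  refine ⟨counitB ∘ₗ G.symm.toLinearMap, ⟨isLeftInvariant_iff.2 fun b a => ?_, ?_⟩,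
    fun ψ hψ => LinearMap.ext fun a => ?_⟩
  · obtain ⟨c, rfl⟩ := hh.invFourier_surjective a
    have h1 : D.actL b (D.invFourier h c) = D.invFourier h (D.dualMul b c) := D.actL_actL b c h
    rw [h1]
    simp only [LinearMap.comp_apply, LinearEquiv.coe_coe, hG, counitB_dualMul]
  · have h1 : D.invFourier h D.dualOne = h := alg_ext_pairing fun x => by
      rw [pairing_invFourier, mul_dualOne]
    have h2 := hG D.dualOne
    rw [h1] at h2
    obtain ⟨α, i⟩ : ∃ α, Nonempty (Fin (n α)) := by
      by_contra hc
      push Not at hc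
      exact hh.ne_zero (alg_ext fun α => by
        have := hc α
        exact Subsingleton.elim _ _)
    obtain ⟨i⟩ := i
    have h3 := D.counitB_dualMul D.dualOne (coeff n α i i)
    rw [dualOne_mul, counitB_coeff, if_pos rfl, mul_one] at h3
    rw [LinearMap.comp_apply, LinearEquiv.coe_coe, h2, ← h3]
  · obtain ⟨b, rfl⟩ := hh.invFourier_surjective a
    rw [hψ.1.invFourier hψ.2, LinearMap.comp_apply, LinearEquiv.coe_coe, hG]

section Positivity

variable {φ : Alg n →ₗ[ℂ] ℂ}

/-- The inverse Fourier transform inverts the Fourier transform. -/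
lemma IsLeftInvariant.fourier_invFourier (hφ : D.IsLeftInvariant φ) (hh : D.IsCointegral h)
    (hφh : φ h = 1) (b : DualSpace n) : D.fourier φ (D.invFourier h b) = b := by
  refine dual_ext fun x => ?_
  have h1 : D.S (D.antipodeEquiv.symm x) = x := D.antipodeEquiv.apply_symm_apply x
  rw [pairing_fourier, hh.mul_invFourier, h1, hφ.invFourier hφh, counitB_lmul]

lemma IsLeftInvariant.invFourier_fourier (hφ : D.IsLeftInvariant φ) (hh : D.IsCointegral h)
    (hφh : φ h = 1) (a : Alg n) : D.invFourier h (D.fourier φ a) = a := by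
  obtain ⟨b, rfl⟩ := hh.invFourier_surjective a
  rw [hφ.fourier_invFourier hh hφh]

lemma IsLeftInvariant.apply_star (hφ : D.IsLeftInvariant φ) (hh : D.IsCointegral h)
    (hφh : φ h = 1) (a : Alg n) : φ (star a) = star (φ a) := by
  obtain ⟨b, rfl⟩ := hh.invFourier_surjective a
  rw [hh.star_invFourier, hφ.invFourier hφh, hφ.invFourier hφh, counitB_dualBar]

/-- A product of diagonal entry functionals is positive on the squares of `M(A ⊗ A)`. -/
lemma pairing₂_coeff_star_mul_self_nonneg (α β : I) (i : Fin (n α)) (k : Fin (n β))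
    (m : MultAA n) : 0 ≤ pairing₂ n (coeff n α i i ⊗ₜ coeff n β k k) (star m * m) := by
  have key : ∀ w w' : Mat n α ⊗[ℂ] Mat n β, TensorProduct.dualDistrib ℂ _ _
      (Matrix.entryLinearMap ℂ ℂ i i ⊗ₜ Matrix.entryLinearMap ℂ ℂ k k) (star w * w') =
      ∑ p, ∑ q, star (TensorProduct.dualDistrib ℂ _ _
        (Matrix.entryLinearMap ℂ ℂ p i ⊗ₜ Matrix.entryLinearMap ℂ ℂ q k) w) *
        TensorProduct.dualDistrib ℂ _ _
        (Matrix.entryLinearMap ℂ ℂ p i ⊗ₜ Matrix.entryLinearMap ℂ ℂ q k) w' := fun w w' => by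
    induction w with
    | zero => simp
    | add x y hx hy =>
      simp only [map_add, star_add, add_mul, hx, hy, Finset.sum_add_distrib]
    | tmul x y =>
      induction w' with
      | zero => simp
      | add v w hv hw => simp only [map_add, mul_add, hv, hw, Finset.sum_add_distrib]
      | tmul v w =>
        simp only [TensorProduct.star_tmul, Algebra.TensorProduct.tmul_mul_tmul,
          TensorProduct.dualDistrib_apply, Matrix.entryLinearMap_apply, Matrix.mul_apply,
          Matrix.star_apply, Finset.sum_mul_sum]
        refine Finset.sum_congr rfl fun p _ => Finset.sum_congr rfl fun q _ => ?_
        rw [star_mul']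
        ring
  rw [coeff, coeff, pairing₂_lof, Pi.mul_apply, Pi.star_apply, key]
  exact Finset.sum_nonneg fun p _ => Finset.sum_nonneg fun q _ => star_mul_self_nonneg _

/-- The left integral is positive on the squares of the elements of `A` that consist of a single
row `k` of a component `β`. -/
lemma IsLeftInvariant.row_nonneg (hφ : D.IsLeftInvariant φ) (hh : D.IsCointegral h)
    (hφh : φ h = 1) (β : I) (k : Fin (n β)) (r : Alg n)
    (hr : incl n β (Matrix.single k k 1) * r = r) : 0 ≤ φ (star r * r) := by
  by_cases hr0 : r = 0
  · simp [hr0]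
  set s := D.antipodeEquiv.symm r with hs
  have hs0 : s ≠ 0 := fun h0 => hr0 (by simpa [hs] using h0)
  obtain ⟨γ, j, i, hij⟩ : ∃ γ j i, s.1 γ j i ≠ 0 := by
    by_contra hc
    push Not at hc
    exact hs0 (alg_ext fun γ => Matrix.ext fun j i => hc γ j i)
  have hr' : star r * incl n β (Matrix.single k k 1) = star r := by
    have := congrArg star hr
    rw [star_mul, star_incl, Matrix.star_eq_conjTranspose, Matrix.conjTranspose_single,
      star_one] at this
    exact this
  -- `r^* G(b) r = G(b)_{kk} r^* r`, where `b` is a diagonal coefficient of the component `γ`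
  have h1 : star r * D.invFourier h (coeff n γ i i) * r =
      pairing n (D.dualMul (coeff n β k k) (coeff n γ i i)) h • (star r * r) := by
    have h2 := incl_single_mul_mul β (D.invFourier h (coeff n γ i i)) k k k k
    rw [← pairing_coeff, pairing_invFourier] at h2
    calc star r * D.invFourier h (coeff n γ i i) * r
        = star r * (incl n β (Matrix.single k k 1) * D.invFourier h (coeff n γ i i) *
            incl n β (Matrix.single k k 1)) * r := by
          have h3 : star r * D.invFourier h (coeff n γ i i) * r =
              (star r * incl n β (Matrix.single k k 1)) * D.invFourier h (coeff n γ i i) *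
                (incl n β (Matrix.single k k 1) * r) := by rw [hr', hr]
          rw [h3]
          simp only [mul_assoc]
      _ = _ := by rw [h2, mul_smul_comm, smul_mul_assoc, hr']
  have h3 : φ (star r * D.invFourier h (coeff n γ i i) * r) = (star s * s).1 γ i i := by
    rw [hh.mul_invFourier, hh.invFourier_mul, hφ.invFourier hφh, antipode_star, ← hs]
    have h4 : rmul s (lmul (star s) (coeff n γ i i)) = lmul (star s) (rmul s (coeff n γ i i)) :=
      dual_ext fun a => by simp only [pairing_rmul, pairing_lmul, mul_assoc]
    rw [h4, counitB_lmul, pairing_rmul, pairing_coeff]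
  have h5 : 0 ≤ pairing n (D.dualMul (coeff n β k k) (coeff n γ i i)) h := by
    have := pairing₂_coeff_star_mul_self_nonneg γ β i k (D.Δ h)
    rwa [← map_star D.Δ, ← map_mul, hh.star_eq, hh.mul_self, ← pairing_dualMul] at this
  have h6 : 0 < (star s * s).1 γ i i := by
    rw [mul_comp, star_comp, Matrix.mul_apply]
    refine Finset.sum_pos' (fun p _ => star_mul_self_nonneg _) ⟨j, Finset.mem_univ j, ?_⟩
    rw [Matrix.star_apply]
    exact star_mul_self_pos (IsRegular.of_ne_zero hij)
  rw [h1, map_smul, smul_eq_mul] at h3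
  rw [← h3] at h6
  exact (pos_of_mul_pos_right h6 h5).le

lemma IsLeftInvariant.nonneg (hφ : D.IsLeftInvariant φ) (hh : D.IsCointegral h)
    (hφh : φ h = 1) (a : Alg n) : 0 ≤ φ (star a * a) := by
  have h1 : ∀ α, ∑ k, incl n α (Matrix.single k k 1) = incl n α 1 := fun α => by
    rw [← map_sum]
    congr 1
    ext i j
    rw [Matrix.sum_apply, Finset.sum_eq_single_of_mem i (Finset.mem_univ i) fun k _ hk => by
      simp [hk], Matrix.single_apply, Matrix.one_apply]
    simp
  have h2 : ∑ α ∈ a.2.toFinset, ∑ k, incl n α (Matrix.single k k 1) * a = a := by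
    simp only [← Finset.sum_mul, h1]
    conv_rhs => rw [← sum_incl a a.2.toFinset fun α hα => a.2.mem_toFinset.2 hα]
    rw [Finset.sum_mul]
    exact Finset.sum_congr rfl fun α _ => incl_one_mul α a
  have h3 : ∀ α k, star (incl n α (Matrix.single k k 1) * a) *
      (incl n α (Matrix.single k k 1) * a) = star a * (incl n α (Matrix.single k k 1) * a) :=
    fun α k => by
      rw [star_mul, star_incl, Matrix.star_eq_conjTranspose, Matrix.conjTranspose_single, star_one,
        mul_assoc, ← mul_assoc (incl n α _) (incl n α _) a, ← incl_mul,
        Matrix.single_mul_single_same, one_mul]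
  have h4 : star a * a = ∑ α ∈ a.2.toFinset, ∑ k, star (incl n α (Matrix.single k k 1) * a) *
      (incl n α (Matrix.single k k 1) * a) := by
    simp only [h3, ← Finset.mul_sum]
    rw [h2]
  rw [h4, map_sum]
  refine Finset.sum_nonneg fun α _ => ?_
  rw [map_sum]
  refine Finset.sum_nonneg fun k _ => hφ.row_nonneg hh hφh α k _ ?_
  rw [← mul_assoc, ← incl_mul, Matrix.single_mul_single_same, one_mul]

lemma IsLeftInvariant.isPosSemidef_formA (hφ : D.IsLeftInvariant φ) (hh : D.IsCointegral h)
    (hφh : φ h = 1) : (formA φ).IsPosSemidef where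
  isSymm := ⟨fun x y => by
    change star (φ (star x * y)) = φ (star y * x)
    rw [← hφ.apply_star hh hφh, star_mul, star_star]⟩
  isNonneg := ⟨fun x => hφ.nonneg hh hφh x⟩

lemma formB_apply (b b' : DualSpace n) :
    D.formB h b b' = pairing n (D.dualMul (D.dualStar b) b') h := rfl

/-- The Plancherel formula: the inverse Fourier transform preserves inner products. -/
lemma IsLeftInvariant.formA_invFourier (hφ : D.IsLeftInvariant φ) (hh : D.IsCointegral h)
    (hφh : φ h = 1) (b b' : DualSpace n) :
    formA φ (D.invFourier h b) (D.invFourier h b') = D.formB h b b' := by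
  have h1 : ∀ b b', formA φ (D.invFourier h b) (D.invFourier h b') = star (D.formB h b' b) :=
    fun b b' => by
      change φ (star (D.invFourier h b) * D.invFourier h b') = _
      rw [hh.mul_invFourier, hφ.invFourier hφh, counitB_lmul, formB_apply, ← pairing_invFourier,
        pairing_dualStar, star_star]
  rw [← (hφ.isPosSemidef_formA hh hφh).isSymm.eq, h1]
  exact star_star _

lemma IsLeftInvariant.isPosSemidef_formB (hφ : D.IsLeftInvariant φ) (hh : D.IsCointegral h)
    (hφh : φ h = 1) : (D.formB h).IsPosSemidef where
  isSymm := ⟨fun x y => by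
    rw [← hφ.formA_invFourier hh hφh, ← hφ.formA_invFourier hh hφh]
    exact (hφ.isPosSemidef_formA hh hφh).isSymm.eq _ _⟩
  isNonneg := ⟨fun x => by
    rw [← hφ.formA_invFourier hh hφh]
    exact (hφ.isPosSemidef_formA hh hφh).isNonneg.nonneg _⟩

end Positivity

end DiscreteQuantumGroup

/-! ### Hilbert space tensor products -/

section HilbertTensor

variable {K H : Type*} [NormedAddCommGroup K] [InnerProductSpace ℂ K]
  [NormedAddCommGroup H] [InnerProductSpace ℂ H]

lemma inner_toHilbertTensor (η η' : K) (ξ ξ' : H) :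
    inner ℂ (toHilbertTensor (η ⊗ₜ ξ)) (toHilbertTensor (η' ⊗ₜ[ℂ] ξ')) =
      inner ℂ η η' * inner ℂ ξ ξ' :=
  (UniformSpace.Completion.inner_coe (𝕜 := ℂ) _ _).trans (TensorProduct.inner_tmul ℂ _ _ _ _)

/-- A closed subspace of `K ⊗ H` that contains all `η ⊗ Λ(b)`, where `Λ` has dense range, is
everything. -/
lemma topologicalClosure_eq_top {V : Type*} {L : V → H} (hL : DenseRange L)
    {M : Submodule ℂ (HilbertTensor K H)} (hM : ∀ (η : K) b, toHilbertTensor (η ⊗ₜ L b) ∈ M) :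
    M.topologicalClosure = ⊤ := by
  rw [eq_top_iff]
  intro x _
  have h1 : ∀ (η : K) (ξ : H), toHilbertTensor (η ⊗ₜ ξ) ∈ M.topologicalClosure := fun η ξ => by
    refine hL.induction_on ξ ?_ fun b => M.le_topologicalClosure (hM η b)
    refine M.isClosed_topologicalClosure.preimage
      (f := fun ξ => toHilbertTensor (TensorProduct.mkL ℂ K H η ξ)) ?_
    fun_prop
  refine UniformSpace.Completion.denseRange_coe.induction_on x M.isClosed_topologicalClosure
    fun w => ?_
  change toHilbertTensor w ∈ _
  induction w with
  | zero => rw [map_zero]; exact Submodule.zero_mem _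
  | add v w hv hw => rw [map_add]; exact Submodule.add_mem _ hv hw
  | tmul η ξ => exact h1 η ξ

/-- The bounded operator `ξ ↦ η ⊗ ξ` from `H` to `K ⊗ H`. -/
noncomputable def tmulLeft (η : K) : H →L[ℂ] HilbertTensor K H :=
  toHilbertTensor ∘L TensorProduct.mkL ℂ K H η

lemma inner_sliceRight [CompleteSpace K] (u : HilbertTensor K H →L[ℂ] HilbertTensor K H)
    (ζ ξ : H) (η' η : K) :
    inner ℂ η' (sliceRight u ζ ξ η) =
      inner ℂ (toHilbertTensor (η' ⊗ₜ ζ)) (u (toHilbertTensor (η ⊗ₜ ξ))) := by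
  rw [sliceRight, ContinuousLinearMap.comp_apply, ContinuousLinearMap.adjoint_inner_right]
  rfl

lemma sliceRight_add [CompleteSpace K] (u : HilbertTensor K H →L[ℂ] HilbertTensor K H)
    (ζ ξ ξ' : H) : sliceRight u ζ (ξ + ξ') = sliceRight u ζ ξ + sliceRight u ζ ξ' :=
  ContinuousLinearMap.ext fun η => ext_inner_left ℂ fun η' => by
    rw [add_apply, inner_add_right]
    simp only [inner_sliceRight, TensorProduct.tmul_add, map_add, inner_add_right]

lemma sliceRight_smul [CompleteSpace K] (u : HilbertTensor K H →L[ℂ] HilbertTensor K H)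
    (ζ : H) (r : ℂ) (ξ : H) : sliceRight u ζ (r • ξ) = r • sliceRight u ζ ξ :=
  ContinuousLinearMap.ext fun η => ext_inner_left ℂ fun η' => by
    rw [smul_apply, inner_smul_right]
    simp only [inner_sliceRight, TensorProduct.tmul_smul, map_smul, inner_smul_right]

lemma continuous_sliceRight [CompleteSpace K] (u : HilbertTensor K H →L[ℂ] HilbertTensor K H)
    (ζ : H) :
    Continuous fun ξ => sliceRight u ζ ξ := by
  have h1 : Continuous fun ξ : H => (tmulRight ξ : K →L[ℂ] HilbertTensor K H) :=
    continuous_const.clm_comp (TensorProduct.mkL ℂ K H).flip.continuous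
  exact continuous_const.clm_comp (continuous_const.clm_comp h1)

end HilbertTensor

/-- Bounded operators that agree on the range of a map with dense range are equal. -/
lemma clm_ext_of_denseRange {V H W : Type*} [NormedAddCommGroup H] [NormedSpace ℂ H]
    [NormedAddCommGroup W] [NormedSpace ℂ W] {L : V → H} (hL : DenseRange L) {f g : H →L[ℂ] W}
    (h : ∀ b, f (L b) = g (L b)) : f = g :=
  ContinuousLinearMap.ext fun ξ => hL.induction_on ξ (isClosed_eq f.continuous g.continuous) h

lemma norm_sq_Λ {V : Type*} [AddCommGroup V] [Module ℂ V] {s : V →ₗ⋆[ℂ] V →ₗ[ℂ] ℂ}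
    (hs : s.IsPosSemidef) (x : V) : ‖Λ hs x‖ ^ 2 = (s x x).re := by
  rw [← inner_Λ hs]; exact norm_sq_eq_re_inner (𝕜 := ℂ) _

namespace DiscreteQuantumGroup

variable {D : DiscreteQuantumGroup n} {h : Alg n}

/-! ### The GNS representation of the dual -/

section GNS

variable (hB : (D.formB h).IsPosSemidef)

lemma formB_dualMul_left (b x y : DualSpace n) :
    D.formB h (D.dualMul b x) y = D.formB h x (D.dualMul (D.dualStar b) y) := by
  rw [formB_apply, formB_apply, dualStar_dualMul, dualMul_assoc]

/-- Left multiplication by an element of `B` is bounded: matrix coefficients act by contractions,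
because the matrix `u` of coefficients satisfies `u^*u = 1`. -/
lemma exists_norm_dualMul_le (b : DualSpace n) :
    ∃ C, ∀ x, ‖Λ hB (D.dualMul b x)‖ ≤ C * ‖Λ hB x‖ := by
  induction b using coeff_induction with
  | zero => exact ⟨0, fun x => by simp⟩
  | add b c hb hc =>
    obtain ⟨C, hC⟩ := hb
    obtain ⟨C', hC'⟩ := hc
    refine ⟨C + C', fun x => ?_⟩
    rw [map_add, LinearMap.add_apply, map_add, add_mul]
    exact (norm_add_le _ _).trans (add_le_add (hC x) (hC' x))
  | smul r b hb =>
    obtain ⟨C, hC⟩ := hb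
    refine ⟨‖r‖ * C, fun x => ?_⟩
    rw [map_smul, LinearMap.smul_apply, map_smul, norm_smul, mul_assoc]
    exact mul_le_mul_of_nonneg_left (hC x) (norm_nonneg r)
  | coeff α i j =>
    refine ⟨1, fun x => ?_⟩
    rw [one_mul]
    refine le_of_sq_le_sq ?_ (norm_nonneg _)
    have h1 : ∑ k, ‖Λ hB (D.dualMul (coeff n α k j) x)‖ ^ 2 = ‖Λ hB x‖ ^ 2 := by
      simp only [norm_sq_Λ, formB_dualMul_left, ← dualMul_assoc]
      rw [← Complex.re_sum, ← map_sum, ← LinearMap.sum_apply, ← map_sum,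
        sum_star_coeff_mul_coeff, if_pos rfl, dualOne_mul]
    rw [← h1]
    exact Finset.single_le_sum (f := fun k => ‖Λ hB (D.dualMul (coeff n α k j) x)‖ ^ 2)
      (fun k _ => sq_nonneg _) (Finset.mem_univ i)

lemma existsUnique_gnsRepresentation :
    ∃! lam : DualSpace n →ₗ[ℂ] (GNSSpace hB →L[ℂ] GNSSpace hB),
      IsGNSRepresentation hB D.dualMul lam := by
  have h1 : ∀ b x, (Λ hB ∘ₗ D.dualMul b).extendOfNorm (Λ hB) (Λ hB x) = Λ hB (D.dualMul b x) :=
    fun b x => LinearMap.extendOfNorm_eq (denseRange_Λ hB) (exists_norm_dualMul_le hB b) x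
  refine ⟨{ toFun := fun b => (Λ hB ∘ₗ D.dualMul b).extendOfNorm (Λ hB)
            map_add' := fun b c => clm_ext_of_denseRange (denseRange_Λ hB) fun x => ?_
            map_smul' := fun r b => clm_ext_of_denseRange (denseRange_Λ hB) fun x => ?_ },
    fun b x => h1 b x, fun lam hlam => LinearMap.ext fun b =>
      clm_ext_of_denseRange (denseRange_Λ hB) fun x => ?_⟩
  · rw [_root_.add_apply, h1, h1, h1, map_add, LinearMap.add_apply, map_add]
  · rw [_root_.smul_apply, h1, h1, map_smul, LinearMap.smul_apply, map_smul, RingHom.id_apply]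
  · rw [hlam b x]
    exact (h1 b x).symm

variable {hB} {lam : DualSpace n →ₗ[ℂ] (GNSSpace hB →L[ℂ] GNSSpace hB)}

lemma gns_dualMul (hlam : IsGNSRepresentation hB D.dualMul lam) (b c : DualSpace n) :
    lam (D.dualMul b c) = lam b ∘L lam c := clm_ext_of_denseRange (denseRange_Λ hB) fun x => by
  rw [ContinuousLinearMap.comp_apply, hlam, hlam, hlam, dualMul_assoc]

lemma gns_dualOne (hlam : IsGNSRepresentation hB D.dualMul lam) :
    lam D.dualOne = ContinuousLinearMap.id ℂ _ :=
  clm_ext_of_denseRange (denseRange_Λ hB) fun x => by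
    rw [hlam, dualOne_mul, ContinuousLinearMap.id_apply]

lemma inner_gns_left (hlam : IsGNSRepresentation hB D.dualMul lam) (b : DualSpace n)
    (η η' : GNSSpace hB) : inner ℂ (lam b η) η' = inner ℂ η (lam (D.dualStar b) η') := by
  refine (denseRange_Λ hB).induction_on₂ ?_ (fun x y => ?_) η η'
  · exact isClosed_eq (by fun_prop) (by fun_prop)
  · rw [hlam, hlam, inner_Λ, inner_Λ, formB_dualMul_left]


end GNS

/-! ### The left regular corepresentation -/

section Corepresentation

variable {K H : Type*} [NormedAddCommGroup K] [InnerProductSpace ℂ K]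
  [CompleteSpace K] [NormedAddCommGroup H] [InnerProductSpace ℂ H] [CompleteSpace H]

variable (D) in
/-- `lam` is a unital `*`-representation of `B` by bounded operators. -/
structure IsStarRepresentation (lam : DualSpace n →ₗ[ℂ] (K →L[ℂ] K)) : Prop where
  map_mul : ∀ b c, lam (D.dualMul b c) = lam b ∘L lam c
  map_one : lam D.dualOne = ContinuousLinearMap.id ℂ K
  inner_left : ∀ b η η', inner ℂ (lam b η) η' = inner ℂ η (lam (D.dualStar b) η')

variable {lam : DualSpace n →ₗ[ℂ] (K →L[ℂ] K)} {L : DualSpace n →ₗ[ℂ] H}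

/-- The map `η ⊗ b ↦ ∑ b₍₁₎η ⊗ Λ(b₍₂₎)`. -/
noncomputable def coregular (lam : DualSpace n →ₗ[ℂ] (K →L[ℂ] K))
    (L : DualSpace n →ₗ[ℂ] H) :
    K ⊗[ℂ] DualSpace n →ₗ[ℂ] HilbertTensor K H :=
  TensorProduct.lift <| LinearMap.mk₂ ℂ
    (fun η b => toHilbertTensor (TensorProduct.map
      ((ContinuousLinearMap.apply ℂ K η).toLinearMap ∘ₗ lam) L (dualComul n b)))
    (fun η η' b => by
      rw [map_add, ContinuousLinearMap.toLinearMap_add, LinearMap.add_comp,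
        TensorProduct.map_add_left, LinearMap.add_apply, map_add])
    (fun r η b => by
      rw [map_smul, ContinuousLinearMap.toLinearMap_smul, LinearMap.smul_comp,
        TensorProduct.map_smul_left, LinearMap.smul_apply, map_smul])
    (fun η b b' => by simp only [map_add])
    (fun r η b => by simp only [map_smul])

lemma coregular_coeff (η : K) (α : I) (i j : Fin (n α)) :
    coregular lam L (η ⊗ₜ coeff n α i j) =
      ∑ k, toHilbertTensor (lam (coeff n α i k) η ⊗ₜ L (coeff n α k j)) := by
  have h1 : coregular lam L (η ⊗ₜ coeff n α i j) = toHilbertTensor (TensorProduct.map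
      ((ContinuousLinearMap.apply ℂ K η).toLinearMap ∘ₗ lam) L
      (dualComul n (coeff n α i j))) := rfl
  rw [h1, dualComul_coeff, map_sum, map_sum]
  rfl

lemma inner_coregular (hh : D.IsCointegral h) (hlam : D.IsStarRepresentation lam)
    (hL : ∀ x y, inner ℂ (L x) (L y) = D.formB h x y)
    (x y : K ⊗[ℂ] DualSpace n) :
    inner ℂ (coregular lam L x) (coregular lam L y) =
      inner ℂ (toHilbertTensor (L.lTensor K x))
        (toHilbertTensor (L.lTensor K y)) := by
  induction x with
  | zero => simp
  | add x x' hx hx' => simp only [map_add, inner_add_left, hx, hx']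
  | tmul η b =>
  induction y with
  | zero => simp
  | add y y' hy hy' => simp only [map_add, inner_add_right, hy, hy']
  | tmul η' b' =>
  induction b using coeff_induction with
  | zero => simp
  | add b c hb hc => simp only [TensorProduct.tmul_add, map_add, inner_add_left, hb, hc]
  | smul r b hb => simp only [TensorProduct.tmul_smul, map_smul, inner_smul_left, hb]
  | coeff α i j =>
  induction b' using coeff_induction with
  | zero => simp
  | add b c hb hc => simp only [TensorProduct.tmul_add, map_add, inner_add_right, hb, hc]
  | smul r b hb => simp only [TensorProduct.tmul_smul, map_smul, inner_smul_right, hb]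
  | coeff β k l =>
    have h1 := congrArg (fun b => inner ℂ η (lam b η')) (hh.sum_pairing_smul
      (D.isComul_dualMul (D.isComul_dualStar (isComul_coeff α i j)) (isComul_coeff β k l)))
    simp only [map_sum, map_smul, _root_.sum_apply, _root_.smul_apply,
      hlam.map_one, ContinuousLinearMap.id_apply, inner_sum, inner_smul_right,
      ← formB_apply] at h1
    rw [coregular_coeff, coregular_coeff, LinearMap.lTensor_tmul, LinearMap.lTensor_tmul,
      inner_toHilbertTensor, hL, mul_comm, ← h1, sum_inner, Fintype.sum_prod_type]
    refine Finset.sum_congr rfl fun p _ => ?_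
    rw [inner_sum]
    refine Finset.sum_congr rfl fun q _ => ?_
    rw [inner_toHilbertTensor, hL, hlam.inner_left, hlam.map_mul, mul_comm]
    rfl

/-- The inverse of `η ⊗ b ↦ ∑ b₍₁₎η ⊗ b₍₂₎` is `η ⊗ b ↦ ∑ (b₍₁₎ ∘ S)η ⊗ b₍₂₎`. -/
lemma sum_coregular (hlam : D.IsStarRepresentation lam) (η : K) (α : I)
    (i j : Fin (n α)) :
    coregular lam L (∑ k, lam (D.coAntipode (coeff n α i k)) η ⊗ₜ coeff n α k j) =
      toHilbertTensor (η ⊗ₜ L (coeff n α i j)) := by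
  simp only [map_sum, coregular_coeff]
  rw [Finset.sum_comm]
  have h1 : ∀ l, ∑ k, toHilbertTensor (lam (coeff n α k l) (lam (D.coAntipode (coeff n α i k)) η) ⊗ₜ
      L (coeff n α l j)) =
      toHilbertTensor ((if i = l then η else 0) ⊗ₜ[ℂ] L (coeff n α l j)) := fun l => by
    rw [← map_sum, ← TensorProduct.sum_tmul]
    congr 2
    have h2 := congrArg (fun b => lam b η) (D.sum_coeff_mul_coAntipode α i l)
    simp only [map_sum, _root_.sum_apply, hlam.map_mul,
      ContinuousLinearMap.comp_apply] at h2
    rw [h2]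
    split_ifs
    · rw [hlam.map_one, ContinuousLinearMap.id_apply]
    · simp
  simp only [h1]
  rw [Finset.sum_eq_single_of_mem i (Finset.mem_univ i) fun l _ hl => by simp [hl.symm], if_pos rfl]

lemma existsUnique_leftRegularCorepresentation (hh : D.IsCointegral h)
    (hlam : D.IsStarRepresentation lam) (hL : ∀ x y, inner ℂ (L x) (L y) = D.formB h x y)
    (hd : DenseRange L) :
    ∃! u : HilbertTensor K H ≃ₗᵢ[ℂ] HilbertTensor K H,
      ∀ η b, u.symm (toHilbertTensor (η ⊗ₜ L b)) = coregular lam L (η ⊗ₜ b) := by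
  let e₁ : K ⊗[ℂ] DualSpace n →ₗ[ℂ] HilbertTensor K H :=
    toHilbertTensor.toLinearMap ∘ₗ L.lTensor K
  have hd₁ : DenseRange e₁ := by
    have := topologicalClosure_eq_top hd (M := LinearMap.range e₁)
      fun η b => ⟨η ⊗ₜ b, rfl⟩
    exact Submodule.dense_iff_topologicalClosure_eq_top.2 this
  have hd₂ : DenseRange (coregular lam L) := by
    have := topologicalClosure_eq_top hd (M := LinearMap.range (coregular lam L))
      fun η b => by
        induction b using coeff_induction with
        | zero => simp
        | add b c hb hc =>
          rw [map_add, TensorProduct.tmul_add, map_add]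
          exact Submodule.add_mem _ hb hc
        | smul r b hb =>
          rw [map_smul, TensorProduct.tmul_smul, map_smul]
          exact Submodule.smul_mem _ _ hb
        | coeff α i j => exact ⟨_, sum_coregular hlam η α i j⟩
    exact Submodule.dense_iff_topologicalClosure_eq_top.2 this
  have hn : ∀ x, ‖coregular lam L x‖ = ‖e₁ x‖ := fun x => by
    rw [@norm_eq_sqrt_re_inner ℂ, @norm_eq_sqrt_re_inner ℂ, inner_coregular hh hlam hL]
    rfl
  let w := (LinearEquiv.refl ℂ (K ⊗[ℂ] DualSpace n)).extendOfIsometry e₁ (coregular lam L)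
    hd₁ hd₂ hn
  have hw : ∀ x, w (e₁ x) = coregular lam L x := fun x =>
    LinearEquiv.extendOfIsometry_eq _ _ _ hd₁ hd₂ hn x
  refine ⟨w.symm, fun η b => hw (η ⊗ₜ b), fun u hu => ?_⟩
  have h1 : u.symm = w := by
    refine LinearIsometryEquiv.ext fun x => ?_
    refine hd₁.induction_on x (isClosed_eq u.symm.continuous w.continuous) fun y => ?_
    rw [hw]
    induction y with
    | zero => simp
    | add x y hx hy => rw [map_add, map_add, map_add, hx, hy]
    | tmul η b => exact hu η b
  rw [← h1, LinearIsometryEquiv.symm_symm]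

variable {u : HilbertTensor K H ≃ₗᵢ[ℂ] HilbertTensor K H}

lemma corepresentation_apply_coeff (hlam : D.IsStarRepresentation lam)

    (hu : ∀ η b, u.symm (toHilbertTensor (η ⊗ₜ L b)) = coregular lam L (η ⊗ₜ b)) (η : K) (α : I)
    (i j : Fin (n α)) :
    u (toHilbertTensor (η ⊗ₜ L (coeff n α i j))) =
      ∑ k, toHilbertTensor (lam (D.coAntipode (coeff n α i k)) η ⊗ₜ L (coeff n α k j)) := by
  rw [← LinearIsometryEquiv.eq_symm_apply, ← sum_coregular hlam, map_sum, map_sum]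
  exact Finset.sum_congr rfl fun k _ => (hu _ _).symm

/-- The right slices `(ι ⊗ ω_{ζ,Λ(b)})u` are the elements `∑ (b₍₁₎ ∘ S)⟨ζ, Λ(b₍₂₎)⟩` of `B`. -/
lemma exists_sliceRight_eq
    (hlam : D.IsStarRepresentation lam)
    (hu : ∀ η b, u.symm (toHilbertTensor (η ⊗ₜ L b)) = coregular lam L (η ⊗ₜ b))
    (ζ : H) (b : DualSpace n) :
    ∃ c, sliceRight (u.toContinuousLinearEquiv : _ →L[ℂ] _) ζ (L b) = lam c ∧
      ∀ a, pairing n c a = inner ℂ ζ (L (lmul (D.S a) b)) := by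
  induction b using coeff_induction with
  | zero =>
    refine ⟨0, ?_, fun a => by simp⟩
    have := sliceRight_smul (u.toContinuousLinearEquiv : HilbertTensor K H →L[ℂ] _) ζ 0 0
    rwa [zero_smul, zero_smul, ← map_zero L, ← map_zero lam] at this
  | add b b' hb hb' =>
    obtain ⟨c, hc, hc₂⟩ := hb
    obtain ⟨c', hc', hc₂'⟩ := hb'
    exact ⟨c + c', by rw [map_add, sliceRight_add, hc, hc', map_add], fun a => by
      rw [map_add, LinearMap.add_apply, hc₂, hc₂', map_add, map_add, inner_add_right]⟩
  | smul r b hb =>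
    obtain ⟨c, hc, hc₂⟩ := hb
    exact ⟨r • c, by rw [map_smul, sliceRight_smul, hc, map_smul], fun a => by
      rw [map_smul, LinearMap.smul_apply, hc₂, map_smul, map_smul, inner_smul_right, smul_eq_mul]⟩
  | coeff α i j =>
    refine ⟨∑ k, inner ℂ ζ (L (coeff n α k j)) • D.coAntipode (coeff n α i k),
      ContinuousLinearMap.ext fun η => ext_inner_left ℂ fun η' => ?_, fun a => ?_⟩
    · rw [inner_sliceRight]
      refine (congrArg _ (corepresentation_apply_coeff hlam hu η α i j)).trans ?_
      simp only [map_sum, map_smul, _root_.sum_apply,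
        _root_.smul_apply, inner_sum, inner_smul_right, inner_toHilbertTensor,
        mul_comm]
    · rw [lmul_coeff]
      simp only [map_sum, map_smul, LinearMap.sum_apply, LinearMap.smul_apply, smul_eq_mul,
        inner_sum, inner_smul_right, pairing_coAntipode, pairing_coeff, mul_comm]

lemma sliceRight_mem_dualCompletion (hlam : D.IsStarRepresentation lam)

    (hu : ∀ η b, u.symm (toHilbertTensor (η ⊗ₜ L b)) = coregular lam L (η ⊗ₜ b))
    (hd : DenseRange L) (ζ ξ : H) :
    sliceRight (u.toContinuousLinearEquiv : _ →L[ℂ] _) ζ ξ ∈ dualCompletion lam := by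
  have hc : IsClosed
      ((fun ξ => sliceRight (u.toContinuousLinearEquiv : HilbertTensor K H →L[ℂ] _) ζ ξ) ⁻¹'
        (dualCompletion lam : Set (K →L[ℂ] K))) :=
    (Submodule.isClosed_topologicalClosure _).preimage (continuous_sliceRight _ ζ)
  refine closure_minimal (Set.range_subset_iff.2 fun b => ?_) hc (hd ξ)
  obtain ⟨c, hc, -⟩ := exists_sliceRight_eq hlam hu ζ b
  rw [Set.mem_preimage, hc]
  exact mem_dualCompletion lam c

/-! ### The representation of `A` determined by the corepresentation -/

/-- The representation determined by the left regular corepresentation is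
`π(a)Λ(b) = Λ(b(S(a) ·))`. -/
lemma apply_of_isDeterminedBy
    (hlam : D.IsStarRepresentation lam)
    (hu : ∀ η b, u.symm (toHilbertTensor (η ⊗ₜ L b)) = coregular lam L (η ⊗ₜ b))
    {π : Alg n → H →L[ℂ] H} (hπ : IsDeterminedBy lam u π) (a : Alg n)
    (b : DualSpace n) : π a (L b) = L (lmul (D.S a) b) := by
  obtain ⟨ω, hω, hω'⟩ := hπ a
  refine ext_inner_left ℂ fun ζ => ?_
  obtain ⟨hmem, h1⟩ := hω' ζ (L b)
  obtain ⟨c, hc, hc'⟩ := exists_sliceRight_eq hlam hu ζ b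
  rw [h1, ← hc', ← hω]
  exact congrArg ω (Subtype.ext hc)

lemma formB_lmul {φ : Alg n →ₗ[ℂ] ℂ} (hφ : D.IsLeftInvariant φ) (hh : D.IsCointegral h)
    (hφh : φ h = 1) (a : Alg n) (b b' : DualSpace n) :
    D.formB h b (lmul (D.S (star a)) b') = D.formB h (lmul (D.S a) b) b' := by
  rw [← hφ.formA_invFourier hh hφh, ← hφ.formA_invFourier hh hφh, ← hh.mul_invFourier,
    ← hh.mul_invFourier]
  change φ (star (D.invFourier h b) * (star a * _)) = φ (star (a * D.invFourier h b) * _)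
  rw [star_mul, mul_assoc]

lemma existsUnique_isDeterminedBy {lam : DualSpace n →ₗ[ℂ] (H →L[ℂ] H)}
    {u : HilbertTensor H H ≃ₗᵢ[ℂ] HilbertTensor H H} {φ : Alg n →ₗ[ℂ] ℂ} (hφ : D.IsLeftInvariant φ)
    (hh : D.IsCointegral h) (hφh : φ h = 1) (hlam : D.IsStarRepresentation lam)

    (hlamL : ∀ b x, lam b (L x) = L (D.dualMul b x))
    (hL : ∀ x y, inner ℂ (L x) (L y) = D.formB h x y) (hd : DenseRange L)
    (hu : ∀ η b, u.symm (toHilbertTensor (η ⊗ₜ L b)) = coregular lam L (η ⊗ₜ b)) :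
    ∃! π : Alg n →⋆ₙₐ[ℂ] (H →L[ℂ] H), IsDeterminedBy lam u π := by
  let π₀ : Alg n → H →L[ℂ] H := fun a =>
    ContinuousLinearMap.adjoint (tmulLeft (L D.dualOne)) ∘L
      (u.toContinuousLinearEquiv : _ →L[ℂ] _) ∘L tmulLeft (L (D.fourier φ a))
  -- `⟨a, b⟩ = φ_B(bc) = ⟨Λ(1), bΛ(c)⟩`, where `c` is the Fourier transform of `a`
  have hπ₀ : IsDeterminedBy lam u π₀ := fun a => by
    refine ⟨(innerSL ℂ (L D.dualOne) ∘L
      ContinuousLinearMap.apply ℂ H (L (D.fourier φ a))) ∘L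
        (dualCompletion lam).subtypeL, fun b => ?_,
      fun ζ ξ => ⟨sliceRight_mem_dualCompletion hlam hu hd ζ ξ, ?_⟩⟩
    · change inner ℂ (L D.dualOne) (lam b (L (D.fourier φ a))) = _
      rw [hlamL, hL, formB_apply, dualStar_dualOne, dualOne_mul, ← pairing_invFourier,
        hφ.invFourier_fourier hh hφh]
    · change _ = inner ℂ (L D.dualOne) (sliceRight _ ζ ξ (L (D.fourier φ a)))
      rw [inner_sliceRight, ContinuousLinearMap.comp_apply,
        ContinuousLinearMap.adjoint_inner_right]
      rfl
  have h1 := fun a b => apply_of_isDeterminedBy hlam hu hπ₀ a b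
  refine ⟨{ toFun := π₀
            map_smul' := fun r a => clm_ext_of_denseRange hd fun b => ?_
            map_zero' := clm_ext_of_denseRange hd fun b => ?_
            map_add' := fun a a' => clm_ext_of_denseRange hd fun b => ?_
            map_mul' := fun a a' => clm_ext_of_denseRange hd fun b => ?_
            map_star' := fun a => ?_ }, hπ₀, fun π hπ => ?_⟩
  · rw [h1]
    refine (congrArg L (?_ : _ = r • lmul (D.S a) b)).trans ?_
    · exact dual_ext fun x => by
        simp only [map_smul, pairing_lmul, LinearMap.smul_apply, smul_mul_assoc]
    · rw [map_smul, ← h1]; rfl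
  · rw [h1, map_zero]
    have h2 : lmul 0 b = 0 := dual_ext fun x => by simp [pairing_lmul]
    rw [h2, map_zero, _root_.zero_apply]
  · have h2 : lmul (D.S (a + a')) b = lmul (D.S a) b + lmul (D.S a') b := dual_ext fun x => by
      simp only [map_add, pairing_lmul, LinearMap.add_apply, add_mul]
    rw [_root_.add_apply, h1, h1, h1, h2, map_add]
  · have h2 : lmul (D.S (a * a')) b = lmul (D.S a) (lmul (D.S a') b) := dual_ext fun x => by
      simp only [pairing_lmul, antipode_mul, mul_assoc]
    rw [mul_apply_eq_comp, h1, h1, h1, h2]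
  · rw [ContinuousLinearMap.star_eq_adjoint, ContinuousLinearMap.eq_adjoint_iff]
    intro ξ ζ
    refine hd.induction_on₂ ?_ (fun x y => ?_) ξ ζ
    · exact isClosed_eq (by fun_prop) (by fun_prop)
    · rw [h1, h1, hL, hL, ← formB_lmul hφ hh hφh, star_star]
  · refine NonUnitalStarAlgHom.ext fun a => clm_ext_of_denseRange hd fun b => ?_
    rw [apply_of_isDeterminedBy hlam hu hπ]
    exact (h1 a b).symm

end Corepresentation

lemma isStarRepresentation_gns {hB : (D.formB h).IsPosSemidef}
    {lam : DualSpace n →ₗ[ℂ] (GNSSpace hB →L[ℂ] GNSSpace hB)}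
    (hlam : IsGNSRepresentation hB D.dualMul lam) : D.IsStarRepresentation lam :=
  ⟨gns_dualMul hlam, gns_dualOne hlam, inner_gns_left hlam⟩

/-! ### The Fourier transform -/

section Fourier

variable {φ : Alg n →ₗ[ℂ] ℂ}

lemma IsLeftInvariant.existsUnique_fourier (hφ : D.IsLeftInvariant φ) (hh : D.IsCointegral h)
    (hφh : φ h = 1) (hA : (formA φ).IsPosSemidef) (hB : (D.formB h).IsPosSemidef) :
    ∃! F : GNSSpace hA ≃ₗᵢ[ℂ] GNSSpace hB, ∀ a, F (Λ hA a) = Λ hB (D.fourier φ a) := by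
  let e₁ : DualSpace n →ₗ[ℂ] GNSSpace hA := Λ hA ∘ₗ D.invFourier h
  have hd₁ : DenseRange e₁ := by
    have := hh.invFourier_surjective.range_eq
    rw [DenseRange, LinearMap.coe_comp, Set.range_comp, this, Set.image_univ]
    exact denseRange_Λ hA
  have hn : ∀ b, ‖Λ hB b‖ = ‖e₁ b‖ := fun b => by
    refine (sq_eq_sq₀ (norm_nonneg _) (norm_nonneg _)).1 ?_
    change _ = ‖Λ hA (D.invFourier h b)‖ ^ 2
    rw [norm_sq_Λ, norm_sq_Λ, hφ.formA_invFourier hh hφh]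
  let F := (LinearEquiv.refl ℂ (DualSpace n)).extendOfIsometry e₁ (Λ hB) hd₁ (denseRange_Λ hB) hn
  have hF : ∀ b, F (Λ hA (D.invFourier h b)) = Λ hB b := fun b =>
    LinearEquiv.extendOfIsometry_eq _ _ _ hd₁ (denseRange_Λ hB) hn b
  refine ⟨F, fun a => ?_, fun F' hF' => LinearIsometryEquiv.ext fun ξ => ?_⟩
  · rw [← hF, hφ.invFourier_fourier hh hφh]
  · refine (denseRange_Λ hA).induction_on ξ (isClosed_eq F'.continuous F.continuous) fun a => ?_
    rw [hF', ← hF, hφ.invFourier_fourier hh hφh]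

/-- The Fourier transform intertwines left multiplication by `a` with `b ↦ b(S(a) ·)`. -/
lemma IsLeftInvariant.fourier_mul (hφ : D.IsLeftInvariant φ) (hh : D.IsCointegral h)
    (hφh : φ h = 1) (a a' : Alg n) :
    D.fourier φ (a * a') = lmul (D.S a) (D.fourier φ a') := by
  rw [← hφ.fourier_invFourier hh hφh (lmul (D.S a) (D.fourier φ a')), ← hh.mul_invFourier,
    hφ.invFourier_fourier hh hφh]

end Fourier

end DiscreteQuantumGroup

end QuantumDuality

theorem proposition3p13 {I : Type*} [DecidableEq I] [Nonempty I] (n : I → ℕ) [∀ α, NeZero (n α)]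
    (D : DiscreteQuantumGroup n) :
    -- the cointegral `h` and the normalized left integral `φ` of `A`
    (∃! h, D.IsCointegral h) ∧ ∀ h, D.IsCointegral h →
    (∃! φ : Alg n →ₗ[ℂ] ℂ, D.IsLeftInvariant φ ∧ φ h = 1) ∧
    ∀ φ : Alg n →ₗ[ℂ] ℂ, D.IsLeftInvariant φ → φ h = 1 →
    -- the integrals `φ` on `A` and `b ↦ ⟨h, b⟩` on `B` are positive, which gives the GNS spaces
    ∃ (hA : (formA φ).IsPosSemidef) (hB : (D.formB h).IsPosSemidef),
    -- the Fourier transform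
    (∃! F : GNSSpace hA ≃ₗᵢ[ℂ] GNSSpace hB, ∀ a, F (Λ hA a) = Λ hB (D.fourier φ a)) ∧
    -- the GNS representation of `B`
    (∃! lam : DualSpace n →ₗ[ℂ] (GNSSpace hB →L[ℂ] GNSSpace hB),
      IsGNSRepresentation hB D.dualMul lam) ∧
    ∀ lam : DualSpace n →ₗ[ℂ] (GNSSpace hB →L[ℂ] GNSSpace hB),
      IsGNSRepresentation hB D.dualMul lam →
    -- the left regular corepresentation of `B`
    (∃! u, D.IsLeftRegularCorepresentation hB lam u) ∧
    ∀ u, D.IsLeftRegularCorepresentation hB lam u →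
    -- the `*`-representation of `A` that it determines, and its equivalence with the GNS
    -- representation of `A`
    (∃! π : Alg n →⋆ₙₐ[ℂ] (GNSSpace hB →L[ℂ] GNSSpace hB), IsDeterminedBy lam u π) ∧
    ∀ π : Alg n →⋆ₙₐ[ℂ] (GNSSpace hB →L[ℂ] GNSSpace hB), IsDeterminedBy lam u π →
    ∀ F : GNSSpace hA ≃ₗᵢ[ℂ] GNSSpace hB, (∀ a, F (Λ hA a) = Λ hB (D.fourier φ a)) →
      IsGNSRepresentation hA (LinearMap.mul ℂ (Alg n)) fun a =>
        (F.symm.toContinuousLinearEquiv : GNSSpace hB →L[ℂ] GNSSpace hA) ∘L π a ∘L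
          (F.toContinuousLinearEquiv : GNSSpace hA →L[ℂ] GNSSpace hB) := by
  refine ⟨?_, fun h hh => ⟨hh.existsUnique_leftInvariant, fun φ hφ hφh =>
    ⟨hφ.isPosSemidef_formA hh hφh, hφ.isPosSemidef_formB hh hφh,
      hφ.existsUnique_fourier hh hφh _ _, DiscreteQuantumGroup.existsUnique_gnsRepresentation _,
      fun lam hlam => ?_⟩⟩⟩
  · obtain ⟨h, hh⟩ := D.exists_isCointegral
    exact ⟨h, hh, fun k hk => hh.unique hk⟩
  · have hB := hφ.isPosSemidef_formB hh hφh
    have hd := denseRange_Λ hB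
    have hst := DiscreteQuantumGroup.isStarRepresentation_gns hlam
    refine ⟨DiscreteQuantumGroup.existsUnique_leftRegularCorepresentation hh hst (inner_Λ hB) hd,
      fun u hu => ⟨DiscreteQuantumGroup.existsUnique_isDeterminedBy hφ hh hφh hst hlam
        (inner_Λ hB) hd hu, fun π hπ F hF a a' => ?_⟩⟩
    change F.symm (π a (F (Λ _ a'))) = Λ _ (a * a')
    rw [hF, DiscreteQuantumGroup.apply_of_isDeterminedBy hst hu hπ,
      LinearIsometryEquiv.symm_apply_eq, hF, hφ.fourier_mul hh hφh]
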